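/- Setting. There are $K\ge 1$ workers. Worker $k$ has stochastic losses $f^{(k)}(x,y;\xi)$, $\xi\sim\mathcal D_f^{(k)}$, and $g^{(k)}(x,y;\zeta)$, $\zeta\sim\mathcal D_g^{(k)}$, for $x\in\mathbb R^{d_x}$, $y\in\mathbb R^{d_y}$; put $f^{(k)}(x,y)=\mathbb E_\xi f^{(k)}(x,y;\xi)$, $g^{(k)}(x,y)=\mathbb E_\zeta g^{(k)}(x,y;\zeta)$ (these expectations exist), $y^*(x)=\arg\min_y\frac1K\sum_k g^{(k)}(x,y)$ and $F(x)=\frac1K\sum_k f^{(k)}(x,y^*(x))$. The distributions of different workers may be arbitrarily different. Assumptions, for all $k$ and all samples, with positive constants $\mu,\ell_{f_x},\ell_{f_y},c_{f_y},\ell_{g_y},\ell_{g_{xy}},\ell_{g_{yy}},c_{g_{xy}},\sigma$: (1) $g^{(k)}(x,\cdot)$ is $\mu$-strongly convex for every $x$. (2) $f^{(k)}(\cdot,\cdot;\xi)$ is $C^1$; $\nabla_1 f^{(k)}(\cdot,\cdot;\xi)$ is $\ell_{f_x}$-Lipschitz, $\nabla_2 f^{(k)}(\cdot,\cdot;\xi)$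 is $\ell_{f_y}$-Lipschitz and $\|\nabla_2 f^{(k)}(x,y;\xi)\|\le c_{f_y}$. (3) $g^{(k)}(x,\cdot;\zeta)$ is differentiable and $\nabla_2 g^{(k)}(\cdot,\cdot;\zeta)$ is $C^1$; $\nabla_2 g^{(k)}$, $\nabla^2_{12}g^{(k)}$, $\nabla^2_{22}g^{(k)}$ (at sample $\zeta$) are Lipschitz in $(x,y)$ with constants $\ell_{g_y},\ell_{g_{xy}},\ell_{g_{yy}}$, $\|\nabla^2_{12}g^{(k)}(x,y;\zeta)\|\le c_{g_{xy}}$ and $\mu I\preceq\nabla^2_{22}g^{(k)}(x,y;\zeta)\preceq \ell_{g_y}I$. (4) The stochastic gradients $\nabla_1 f^{(k)}$, $\nabla_2 f^{(k)}$, $\nabla_2 g^{(k)}$ have variance at most $\sigma^2$ at every $(x,y)$. (5) The gossip matrix $E\in\mathbb R^{K\times K}$ is symmetric and doubly stochastic with eigenvalues $|\lambda_K|\le\dots\le|\lambda_2|<|\lambda_1|=1$; $\lambda=|\lambda_2|$ ($\lambda=0$ if $K=1$). Algorithm (DSVRBGD-S). Let $\hat{\mathcal G}_F^{(k)}(x,y,z;\xi,\zeta)=\nabla_1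 f^{(k)}(x,y;\xi)-\nabla^2_{12}g^{(k)}(x,y;\zeta)z$ and $\hat{\mathcal G}_h^{(k)}(x,y,z;\xi,\zeta)=\nabla^2_{22}g^{(k)}(x,y;\zeta)z-\nabla_2 f^{(k)}(x,y;\xi)$. In iteration $t$ each worker draws a batch of samples $(\xi,\zeta)$ of size $B_0\ge1$ if $t=0$ and of size $B_1\ge1$ if $t>0$; $\xi$ has law $\mathcal D_f^{(k)}$, $\zeta$ has law $\mathcal D_g^{(k)}$, and the pairs $(\xi,\zeta)$ are independent over iterations, workers and batch positions. $\delta^F_t(X,Y,Z)$, $\delta^g_t(X,Y)$, $\delta^h_t(X,Y,Z)$ denote the matrices whose $k$-th columns are the averages over this batch of $\hat{\mathcal G}_F^{(k)}$, $\nabla_2 g^{(k)}$, $\hat{\mathcal G}_h^{(k)}$ at the $k$-th columns of the arguments. All columns of $X_0,Y_0,Z_0$ equal deterministic $x_0,y_0,z_0$ with $\|z_0\|\le c_{f_y}/\mu$. $U_0=\delta^F_0(X_0,Y_0,Z_0)$, $V_0=\delta^g_0(X_0,Y_0)$, $W_0=\delta^h_0(X_0,Y_0,Z_0)$, and for $t>0$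 $$U_t=(1-\alpha_1\eta^2)\big(U_{t-1}-\delta^F_t(X_{t-1},Y_{t-1},Z_{t-1})\big)+\delta^F_t(X_t,Y_t,Z_t),$$ with $V_t$ and $W_t$ defined likewise from $\delta^g,\alpha_2$ and from $\delta^h,\alpha_3$. With $P_{-1}=Q_{-1}=R_{-1}=0$ and $U_{-1}=V_{-1}=W_{-1}=0$, the trackers are $P_t=P_{t-1}E+U_t-U_{t-1}$, $Q_t=Q_{t-1}E+V_t-V_{t-1}$, $R_t=R_{t-1}E+W_t-W_{t-1}$, and $$X_{t+1}=X_t+\eta(X_tE-\beta_1P_t-X_t),\quad Y_{t+1}=Y_t+\eta(Y_tE-\beta_2Q_t-Y_t),\quad Z_{t+1}=Z_t+\eta\big(\mathcal P(Z_tE-\beta_3R_t)-Z_t\big),$$ where $\mathcal P$ projects each column onto the ball $\{\|z\|\le c_{f_y}/\mu\}$. Here $\eta,\alpha_i,\beta_i>0$ and $\alpha_i\eta^2<1$. Let $\bar x_t$ be the average of the columns of $X_t$. Theorem. There is a constant $c>0$ that depends only on $\mu,\ell_{f_x},\ell_{f_y},c_{f_y},\ell_{g_y},\ell_{g_{xy}},\ell_{g_{yy}},c_{g_{xy}}$,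 and for all $\sigma,A,\Delta>0$ there is a constant $C>0$ that depends only on these eight constants and on $\sigma,A,\Delta$, such that the following holds for every problem, network and run as above (whatever $K,d_x,d_y,\lambda$ are). Suppose that $F(x_0)-F(x)\le\Delta$ for all $x$, that $\frac1K\sum_k\|\nabla_1f^{(k)}(x_0,y_0)\|^2\le\Delta$ and $\frac1K\sum_k\|\nabla_2g^{(k)}(x_0,y_0)\|^2\le\Delta$ (at the initial point only), that $\alpha_i\le A/K$ for $i=1,2,3$, and that, with $m=\min\{1,\sqrt{K\alpha_1},\sqrt{K\alpha_2},\sqrt{K\alpha_3}\}$, $$\eta\le1,\quad \beta_2\le c(1-\lambda)^2m,\quad \beta_3\le c(1-\lambda)^4m,\quad \beta_1\le c\,\beta_2,\quad \beta_1\le c\,\beta_3 .$$ Then $F$ is differentiable, $\|\nabla F(\bar x_t)\|^2$ is integrable for every $t$, and for every $T\ge1$ $$\frac1T\sum_{t=0}^{T-1}\mathbb E\|\nabla F(\bar x_t)\|^2\le C\Big[\frac1{\beta_1\eta T}+\frac1{\beta_2\eta T}+\frac1{\beta_3\eta T}+\frac1{\eta T}+\frac1{\eta TB_0}+\sum_{i=1}^3\Big(\frac1{\alpha_i\eta^2TKB_0}+\frac{\alpha_i\eta^2}{K}+\alpha_i^2\eta^3\Big)\Big].$$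 -/

import Mathlib

open MeasureTheory ProbabilityTheory Finset
open scoped BigOperators RealInnerProductSpace

namespace DecBilevel

/-- Euclidean space `ℝⁿ`. -/
abbrev Vec (n : ℕ) : Type := EuclideanSpace ℝ (Fin n)

noncomputable section

/-! ### Partial derivatives of a function `φ(x, y)` -/

/-- `∇₁ φ(x, y)`. -/
def grad1 {dx dy : ℕ} (φ : Vec dx → Vec dy → ℝ) (x : Vec dx) (y : Vec dy) : Vec dx :=
  gradient (fun x' => φ x' y) x

/-- `∇₂ φ(x, y)`. -/
def grad2 {dx dy : ℕ} (φ : Vec dx → Vec dy → ℝ) (x : Vec dx) (y : Vec dy) : Vec dy :=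
  gradient (fun y' => φ x y') y

/-- `∇²₂₂ φ(x, y)`, as a linear map on `ℝ^{d_y}`. -/
def hess22 {dx dy : ℕ} (φ : Vec dx → Vec dy → ℝ) (x : Vec dx) (y : Vec dy) :
    Vec dy →L[ℝ] Vec dy :=
  fderiv ℝ (fun y' => grad2 φ x y') y

/-- `∇²₁₂ φ(x, y) ∈ ℝ^{d_x × d_y}`, as a linear map `ℝ^{d_y} → ℝ^{d_x}`: its `(i, j)` entry is
`∂_{x_i} ∂_{y_j} φ`, so it is the transpose of the derivative of `x ↦ ∇₂ φ(x, y)`. -/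
def jac12 {dx dy : ℕ} (φ : Vec dx → Vec dy → ℝ) (x : Vec dx) (y : Vec dy) :
    Vec dy →L[ℝ] Vec dx :=
  ContinuousLinearMap.adjoint (fderiv ℝ (fun x' => grad2 φ x' y) x)

/-- `Φ(x, y)` is `L`-Lipschitz in the pair `(x, y)`, for the Euclidean norm of the pair. -/
def JointLipschitz {dx dy : ℕ} {V : Type*} [NormedAddCommGroup V] (L : ℝ)
    (Φ : Vec dx → Vec dy → V) : Prop :=
  ∀ x y x' y', ‖Φ x y - Φ x' y'‖ ≤ L * √(‖x - x'‖ ^ 2 + ‖y - y'‖ ^ 2)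

/-! ### The problem -/

/-- The data of a decentralized stochastic bilevel problem with `K` workers: the stochastic losses
`f^{(k)}(x, y; ξ)`, `g^{(k)}(x, y; ζ)` and the data distributions of the workers. -/
structure Problem (K dx dy : ℕ) (Sf Sg : Type*) [MeasurableSpace Sf] [MeasurableSpace Sg] where
  f : Fin K → Vec dx → Vec dy → Sf → ℝ
  g : Fin K → Vec dx → Vec dy → Sg → ℝ
  Df : Fin K → Measure Sf
  Dg : Fin K → Measure Sg

namespace Problem

variable {K dx dy : ℕ} {Sf Sg : Type*} [MeasurableSpace Sf] [MeasurableSpace Sg]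

/-- The stochastic upper-level loss for a fixed sample. -/
def fAt (D : Problem K dx dy Sf Sg) (k : Fin K) (ξ : Sf) (x : Vec dx) (y : Vec dy) : ℝ :=
  D.f k x y ξ

/-- The stochastic lower-level loss for a fixed sample. -/
def gAt (D : Problem K dx dy Sf Sg) (k : Fin K) (ζ : Sg) (x : Vec dx) (y : Vec dy) : ℝ :=
  D.g k x y ζ

/-- `f^{(k)}(x, y) = E_ξ f^{(k)}(x, y; ξ)`. -/
def fFull (D : Problem K dx dy Sf Sg) (k : Fin K) (x : Vec dx) (y : Vec dy) : ℝ :=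
  ∫ ξ, D.f k x y ξ ∂(D.Df k)

/-- `g^{(k)}(x, y) = E_ζ g^{(k)}(x, y; ζ)`. -/
def gFull (D : Problem K dx dy Sf Sg) (k : Fin K) (x : Vec dx) (y : Vec dy) : ℝ :=
  ∫ ζ, D.g k x y ζ ∂(D.Dg k)

/-- The global lower-level loss. -/
def gAvg (D : Problem K dx dy Sf Sg) (x : Vec dx) (y : Vec dy) : ℝ :=
  (1 / (K : ℝ)) * ∑ k, D.gFull k x y

/-- `y*(x)`, a minimizer of the global lower-level loss `y ↦ g(x, y)`. -/
def yStar (D : Problem K dx dy Sf Sg) (x : Vec dx) : Vec dy :=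
  Classical.epsilon (fun y => ∀ y', D.gAvg x y ≤ D.gAvg x y')

/-- The bilevel objective `F(x) = (1/K) ∑ₖ f^{(k)}(x, y*(x))`. -/
def F (D : Problem K dx dy Sf Sg) (x : Vec dx) : ℝ :=
  (1 / (K : ℝ)) * ∑ k, D.fFull k x (D.yStar x)

/-- The distributions are probability measures and the expectations defining the losses exist. -/
structure WellPosed (D : Problem K dx dy Sf Sg) : Prop where
  prob_f : ∀ k, IsProbabilityMeasure (D.Df k)
  prob_g : ∀ k, IsProbabilityMeasure (D.Dg k)
  meas_f : ∀ k x y, Measurable (D.f k x y)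
  meas_g : ∀ k x y, Measurable (D.g k x y)
  int_f : ∀ k x y, Integrable (D.f k x y) (D.Df k)
  int_g : ∀ k x y, Integrable (D.g k x y) (D.Dg k)

/-- Strong convexity of each local lower-level loss. -/
def LowerStronglyConvex (D : Problem K dx dy Sf Sg) (μ : ℝ) : Prop :=
  ∀ k x, StrongConvexOn Set.univ μ (fun y => D.gFull k x y)

/-- Smoothness of the stochastic upper-level losses, bounded gradient with respect to `y`. -/
structure UpperSmooth (D : Problem K dx dy Sf Sg) (lfx lfy cfy : ℝ) : Prop where
  contDiff : ∀ k ξ, ContDiff ℝ 1 (fun p : Vec dx × Vec dy => D.fAt k ξ p.1 p.2)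
  lip_grad1 : ∀ k ξ, JointLipschitz lfx (grad1 (D.fAt k ξ))
  lip_grad2 : ∀ k ξ, JointLipschitz lfy (grad2 (D.fAt k ξ))
  bound_grad2 : ∀ k ξ x y, ‖grad2 (D.fAt k ξ) x y‖ ≤ cfy

/-- Smoothness of the stochastic lower-level losses. -/
structure LowerSmooth (D : Problem K dx dy Sf Sg) (μ lgy lgxy lgyy cgxy : ℝ) : Prop where
  differentiable : ∀ k ζ x, Differentiable ℝ (fun y => D.gAt k ζ x y)
  contDiff_grad2 : ∀ k ζ, ContDiff ℝ 1 (fun p : Vec dx × Vec dy => grad2 (D.gAt k ζ) p.1 p.2)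
  lip_grad2 : ∀ k ζ, JointLipschitz lgy (grad2 (D.gAt k ζ))
  lip_jac12 : ∀ k ζ, JointLipschitz lgxy (jac12 (D.gAt k ζ))
  lip_hess22 : ∀ k ζ, JointLipschitz lgyy (hess22 (D.gAt k ζ))
  bound_jac12 : ∀ k ζ x y, ‖jac12 (D.gAt k ζ) x y‖ ≤ cgxy
  hess22_lower : ∀ k ζ x y v, μ * ‖v‖ ^ 2 ≤ ⟪v, hess22 (D.gAt k ζ) x y v⟫
  hess22_upper : ∀ k ζ x y v, ⟪v, hess22 (D.gAt k ζ) x y v⟫ ≤ lgy * ‖v‖ ^ 2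

/-- The stochastic gradients have variance at most `σ²`. -/
structure BoundedVariance (D : Problem K dx dy Sf Sg) (σ : ℝ) : Prop where
  var_grad1_f : ∀ k x y, ∫⁻ ξ, ‖grad1 (D.fAt k ξ) x y - grad1 (D.fFull k) x y‖ₑ ^ 2 ∂(D.Df k)
    ≤ ENNReal.ofReal (σ ^ 2)
  var_grad2_f : ∀ k x y, ∫⁻ ξ, ‖grad2 (D.fAt k ξ) x y - grad2 (D.fFull k) x y‖ₑ ^ 2 ∂(D.Df k)
    ≤ ENNReal.ofReal (σ ^ 2)
  var_grad2_g : ∀ k x y, ∫⁻ ζ, ‖grad2 (D.gAt k ζ) x y - grad2 (D.gFull k) x y‖ₑ ^ 2 ∂(D.Dg k)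
    ≤ ENNReal.ofReal (σ ^ 2)

/-- The stochastic hypergradient estimator
`Ĝ_F^{(k)}(x, y, z; ξ, ζ) = ∇₁ f^{(k)}(x, y; ξ) - ∇²₁₂ g^{(k)}(x, y; ζ) z`. -/
def GF (D : Problem K dx dy Sf Sg) (k : Fin K) (x : Vec dx) (y z : Vec dy) (ξ : Sf) (ζ : Sg) :
    Vec dx :=
  grad1 (D.fAt k ξ) x y - jac12 (D.gAt k ζ) x y z

/-- The stochastic estimator
`Ĝ_h^{(k)}(x, y, z; ξ, ζ) = ∇²₂₂ g^{(k)}(x, y; ζ) z - ∇₂ f^{(k)}(x, y; ξ)`. -/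
def Gh (D : Problem K dx dy Sf Sg) (k : Fin K) (x : Vec dx) (y z : Vec dy) (ξ : Sf) (ζ : Sg) :
    Vec dy :=
  hess22 (D.gAt k ζ) x y z - grad2 (D.fAt k ξ) x y

end Problem

/-! ### The communication network -/

/-- `E` is symmetric and doubly stochastic, its eigenvalues can be enumerated (with multiplicity)
so that `|λ_K| ≤ ⋯ ≤ |λ₂| < |λ₁| = 1`, and `lam = |λ₂|` (with `lam = 0` for a single worker). -/
structure IsGossip {K : ℕ} (E : Matrix (Fin K) (Fin K) ℝ) (lam : ℝ) : Prop where
  isSymm : E.IsSymm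
  doubly : E ∈ doublyStochastic ℝ (Fin K)
  spectrum : ∃ (hE : E.IsHermitian) (e : Fin K ≃ Fin K),
    Antitone (fun n => |hE.eigenvalues (e n)|) ∧
    (∀ n : Fin K, n.val = 0 → |hE.eigenvalues (e n)| = 1) ∧
    (∀ n : Fin K, n.val = 1 → |hE.eigenvalues (e n)| = lam)
  single : K = 1 → lam = 0
  gap : lam < 1

/-- Communication: column `k` of `X E`, where `X = [x^{(1)}, …, x^{(K)}]`. -/
def mix {K n : ℕ} (E : Matrix (Fin K) (Fin K) ℝ) (X : Fin K → Vec n) (k : Fin K) : Vec n :=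
  ∑ j, E j k • X j

/-- The average over the workers. -/
def mean {K n : ℕ} (X : Fin K → Vec n) : Vec n :=
  (1 / (K : ℝ)) • ∑ k, X k

/-- Euclidean projection onto the ball of radius `r` centred at `0`. -/
def ballProj {n : ℕ} (r : ℝ) (z : Vec n) : Vec n :=
  if ‖z‖ ≤ r then z else (r / ‖z‖) • z

/-! ### The algorithm with simultaneous updates -/

/-- Parameters of the algorithm: step sizes, the size `B0` of the batches of the first iteration,
the size `B1` of the batches of all other iterations, and the radius of the constraint on `z`. -/
structure Params where
  η : ℝ
  α₁ : ℝ
  α₂ : ℝ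
  α₃ : ℝ
  β₁ : ℝ
  β₂ : ℝ
  β₃ : ℝ
  B0 : ℕ
  B1 : ℕ
  radius : ℝ

/-- All requirements of the algorithm on its parameters. -/
structure Params.Valid (p : Params) : Prop where
  η_pos : 0 < p.η
  α₁_pos : 0 < p.α₁
  α₂_pos : 0 < p.α₂
  α₃_pos : 0 < p.α₃
  β₁_pos : 0 < p.β₁
  β₂_pos : 0 < p.β₂
  β₃_pos : 0 < p.β₃
  α₁_lt : p.α₁ * p.η ^ 2 < 1
  α₂_lt : p.α₂ * p.η ^ 2 < 1
  α₃_lt : p.α₃ * p.η ^ 2 < 1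
  B0_pos : 1 ≤ p.B0
  B1_pos : 1 ≤ p.B1

/-- The batch size of iteration `t`. -/
def Params.batch (p : Params) (t : ℕ) : ℕ := if t = 0 then p.B0 else p.B1

/-- The variables of iteration `t`: the iterates `X_t, Y_t, Z_t`, the variance-reduced estimators
`U_t, V_t, W_t` and the gradient trackers `P_t, Q_t, R_t`. -/
structure State (K dx dy : ℕ) where
  X : Fin K → Vec dx
  Y : Fin K → Vec dy
  Z : Fin K → Vec dy
  U : Fin K → Vec dx
  V : Fin K → Vec dy
  W : Fin K → Vec dy
  P : Fin K → Vec dx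
  Q : Fin K → Vec dy
  R : Fin K → Vec dy

section Algorithm

variable {K dx dy : ℕ} {Sf Sg : Type*} [MeasurableSpace Sf] [MeasurableSpace Sg]

/-- Mini-batch average of `Ĝ_F` on each worker; `s k b` is sample `b` of worker `k`. -/
def deltaF (D : Problem K dx dy Sf Sg) (B : ℕ) (s : Fin K → ℕ → Sf × Sg)
    (X : Fin K → Vec dx) (Y Z : Fin K → Vec dy) (k : Fin K) : Vec dx :=
  (1 / (B : ℝ)) • ∑ b ∈ range B, D.GF k (X k) (Y k) (Z k) (s k b).1 (s k b).2

/-- Mini-batch average of `∇₂ g` on each worker. -/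
def deltaG (D : Problem K dx dy Sf Sg) (B : ℕ) (s : Fin K → ℕ → Sf × Sg)
    (X : Fin K → Vec dx) (Y : Fin K → Vec dy) (k : Fin K) : Vec dy :=
  (1 / (B : ℝ)) • ∑ b ∈ range B, grad2 (D.gAt k (s k b).2) (X k) (Y k)

/-- Mini-batch average of `Ĝ_h` on each worker. -/
def deltaH (D : Problem K dx dy Sf Sg) (B : ℕ) (s : Fin K → ℕ → Sf × Sg)
    (X : Fin K → Vec dx) (Y Z : Fin K → Vec dy) (k : Fin K) : Vec dy :=
  (1 / (B : ℝ)) • ∑ b ∈ range B, D.Gh k (X k) (Y k) (Z k) (s k b).1 (s k b).2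

/-- Iteration `0`. Since `P_{-1} = Q_{-1} = R_{-1} = 0` and `U_{-1} = V_{-1} = W_{-1} = 0`,
the trackers `P_0 = P_{-1} E + U_0 - U_{-1}`, etc., equal `U_0, V_0, W_0`. -/
def initState (D : Problem K dx dy Sf Sg) (p : Params) (x0 : Vec dx) (y0 z0 : Vec dy)
    (s : Fin K → ℕ → Sf × Sg) : State K dx dy :=
  let X : Fin K → Vec dx := fun _ => x0
  let Y : Fin K → Vec dy := fun _ => y0
  let Z : Fin K → Vec dy := fun _ => z0
  let U := deltaF D (p.batch 0) s X Y Z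
  let V := deltaG D (p.batch 0) s X Y
  let W := deltaH D (p.batch 0) s X Y Z
  { X := X, Y := Y, Z := Z, U := U, V := V, W := W, P := U, Q := V, R := W }

/-- From iteration `t` to iteration `t + 1`: update all iterates simultaneously, then form the
new estimators with the samples `s` (batch size `B`) of iteration `t + 1`, then the trackers. -/
def stepState (D : Problem K dx dy Sf Sg) (E : Matrix (Fin K) (Fin K) ℝ) (p : Params) (B : ℕ)
    (s : Fin K → ℕ → Sf × Sg) (S : State K dx dy) : State K dx dy :=
  let Xhalf : Fin K → Vec dx := fun k => mix E S.X k - p.β₁ • S.P k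
  let Yhalf : Fin K → Vec dy := fun k => mix E S.Y k - p.β₂ • S.Q k
  let Zhalf : Fin K → Vec dy := fun k => ballProj p.radius (mix E S.Z k - p.β₃ • S.R k)
  let X : Fin K → Vec dx := fun k => S.X k + p.η • (Xhalf k - S.X k)
  let Y : Fin K → Vec dy := fun k => S.Y k + p.η • (Yhalf k - S.Y k)
  let Z : Fin K → Vec dy := fun k => S.Z k + p.η • (Zhalf k - S.Z k)
  let U : Fin K → Vec dx := fun k =>
    (1 - p.α₁ * p.η ^ 2) • (S.U k - deltaF D B s S.X S.Y S.Z k) + deltaF D B s X Y Z k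
  let V : Fin K → Vec dy := fun k =>
    (1 - p.α₂ * p.η ^ 2) • (S.V k - deltaG D B s S.X S.Y k) + deltaG D B s X Y k
  let W : Fin K → Vec dy := fun k =>
    (1 - p.α₃ * p.η ^ 2) • (S.W k - deltaH D B s S.X S.Y S.Z k) + deltaH D B s X Y Z k
  { X := X, Y := Y, Z := Z, U := U, V := V, W := W
    P := fun k => mix E S.P k + U k - S.U k
    Q := fun k => mix E S.Q k + V k - S.V k
    R := fun k => mix E S.R k + W k - S.W k }

/-- The run of the algorithm on a stream of samples: `s t k b` is sample `b` that worker `k` draws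
in iteration `t`. -/
def run (D : Problem K dx dy Sf Sg) (E : Matrix (Fin K) (Fin K) ℝ) (p : Params)
    (x0 : Vec dx) (y0 z0 : Vec dy) (s : ℕ → Fin K → ℕ → Sf × Sg) : ℕ → State K dx dy
  | 0 => initState D p x0 y0 z0 (s 0)
  | t + 1 => stepState D E p (p.batch (t + 1)) (s (t + 1)) (run D E p x0 y0 z0 s t)

/-- The samples `(ξ, ζ)` are independent over iterations, workers and positions in the batch, and
on worker `k` they follow the data distributions of that worker. -/
structure IsSampling (D : Problem K dx dy Sf Sg) {Ω : Type*} [MeasurableSpace Ω] (Pr : Measure Ω)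
    (s : ℕ → Fin K → ℕ → Ω → Sf × Sg) : Prop where
  measurable : ∀ t k b, Measurable (s t k b)
  indep : iIndepFun (fun (i : ℕ × Fin K × ℕ) => s i.1 i.2.1 i.2.2) Pr
  law_f : ∀ t k b, Pr.map (fun ω => (s t k b ω).1) = D.Df k
  law_g : ∀ t k b, Pr.map (fun ω => (s t k b ω).2) = D.Dg k

end Algorithm

/-- The step-size conditions, for a threshold `c`, a network with `K` workers and `|λ₂| = lam`. -/
structure StepSizes (c : ℝ) (K : ℕ) (lam : ℝ) (p : Params) : Prop where
  η_le : p.η ≤ 1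
  β₂_le : p.β₂ ≤ c * (1 - lam) ^ 2 * min 1 (√(K * min p.α₁ (min p.α₂ p.α₃)))
  β₃_le : p.β₃ ≤ c * (1 - lam) ^ 4 * min 1 (√(K * min p.α₁ (min p.α₂ p.α₃)))
  β₁_le_β₂ : p.β₁ ≤ c * p.β₂
  β₁_le_β₃ : p.β₁ ≤ c * p.β₃

/-- The sum of all rate terms, after `T` iterations with `K` workers. -/
def rate (K T : ℕ) (p : Params) : ℝ :=
  1 / (p.β₁ * p.η * T) + 1 / (p.β₂ * p.η * T) + 1 / (p.β₃ * p.η * T)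
    + 1 / (p.η * T) + 1 / (p.η * T * p.B0)
    + 1 / (p.α₁ * p.η ^ 2 * T * K * p.B0) + 1 / (p.α₂ * p.η ^ 2 * T * K * p.B0)
    + 1 / (p.α₃ * p.η ^ 2 * T * K * p.B0)
    + p.α₁ * p.η ^ 2 / K + p.α₂ * p.η ^ 2 / K + p.α₃ * p.η ^ 2 / K
    + p.α₁ ^ 2 * p.η ^ 3 + p.α₂ ^ 2 * p.η ^ 3 + p.α₃ ^ 2 * p.η ^ 3

end

end DecBilevel

/-!
# Convergence of a decentralized variance-reduced bilevel method

The argument has a deterministic part, a stochastic part and a final small-gain argument.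

*Landscape.* In expectation the method sees three oracles: the hypergradient oracle with mean
`Problem.meanF`, the lower-level gradient with mean `Problem.meanG`, and the residual with mean
`Problem.meanH` of the linear system that defines `z*(x)`. On the ball `‖z‖ ≤ cfy / μ` they are
Lipschitz. The averaged lower-level gradient and the averaged linear system are `μ`-strongly
monotone, so their zeros `y*(x)` and `z*(x)` exist, are unique and Lipschitz in `x`, and `z*(x)` lies
in the ball. The first-order expansions of the losses at fixed samples have quadratic remainders
with uniform constants and therefore survive the expectation; adding the expansion of `f` to that of
`⟪z*(x), ∇₂ g⟫` cancels the increment of `y*` and gives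
`F(x') = F(x) + ⟪hyperGrad x, x' - x⟫ + O(‖x' - x‖²)` (`Problem.Regular.F_expansion`). Hence `F` is differentiable with gradient `hyperGrad`. All
this is collected, with a single constant `L`, in `Problem.Landscape` and `Problem.Model`.

*One iteration.* The errors of the variance-reduced estimators contract by `1 - αη²`; the new noise
of each sample is conditionally centred given the past, and noises of different samples are
orthogonal, so the error of the average estimator receives only `1/K` of it
(`integral_mean_stormErr_le`, `integral_msq_stormErr_le`). A gossip matrix contracts deviations from
the average by `lam` (`IsGossip.contract`), hence so do the trackers up to the increments of the
estimators (`dev_tracker_le`), and the iterates up to the deviations of the trackers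
(`dev_relaxed_gossip_le`); averages of trackers equal averages of estimators. Strong monotonicity
contracts the inner gaps `‖ȳ - y*(x̄)‖²` and `(1/K) ∑ₖ ‖zₖ - z*(x̄)‖²` up to the drift of their targets
(`gapY_stepState_le`, `gapZ_stepState_le`). The second gap is measured column by column because the
projection does not commute with averaging; it does not increase these distances, since `z*` lies in
the ball. Finally, `F` decreases along `x̄` (`F_stepState_le`). In expectation these are the recursions
`Moments.Step` (`moments_step`).

*Summation.* Every recursion is a contraction with disturbance, so its sum over `t < T` is bounded
by the initial value and the summed disturbances. This leaves finitely many linear inequalities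
between the sums, coupled in loops whose gain is at most of order `c² L¹⁰`, because the step sizes
satisfy `β ≤ c (1 - lam)² min(1, √(K α))`: the factor `(1 - lam)²` pays for the two nested gossip
contractions (iterates and trackers), and `√(K α)` for the accumulation `1 / (K α η²)` of the
estimator errors against displacements of order `η β`. With `c = 1 / (2000 L¹⁰)` the loops close
(`small_gain`), and what remains of the initial values and of the noise is the stated rate
(`sum_hyperGrad_le`, `bound_le_rate`).
-/

namespace DecBilevel

noncomputable section

/-! ### Families of columns: averages, deviations and gossip -/

section Columns

variable {K n : ℕ}

/-- Mean square of the columns, `(1/K) ∑ₖ ‖X k‖²`. -/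
def msq (X : Fin K → Vec n) : ℝ := (1 / (K : ℝ)) * ∑ k, ‖X k‖ ^ 2

/-- Consensus error: the mean square of the deviations of the columns from their average. -/
def dev (X : Fin K → Vec n) : ℝ := msq (fun k => X k - mean X)

lemma msq_nonneg (X : Fin K → Vec n) : 0 ≤ msq X := by unfold msq; positivity

lemma dev_nonneg (X : Fin K → Vec n) : 0 ≤ dev X := msq_nonneg _

lemma mean_add (X Y : Fin K → Vec n) : mean (fun k => X k + Y k) = mean X + mean Y := by
  simp [mean, sum_add_distrib]

lemma mean_sub (X Y : Fin K → Vec n) : mean (fun k => X k - Y k) = mean X - mean Y := by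
  simp [mean, sum_sub_distrib, smul_sub]

lemma mean_smul (a : ℝ) (X : Fin K → Vec n) : mean (fun k => a • X k) = a • mean X := by
  simp only [mean, ← smul_sum]; rw [smul_comm]

lemma mean_const (hK : 1 ≤ K) (c : Vec n) : mean (fun _ : Fin K => c) = c := by
  have : (K : ℝ) ≠ 0 := by positivity
  simp [mean, ← Nat.cast_smul_eq_nsmul ℝ, smul_smul, this]

lemma mean_inner (X : Fin K → Vec n) (v : Vec n) :
    ⟪mean X, v⟫ = (1 / (K : ℝ)) * ∑ k, ⟪X k, v⟫ := by
  simp [mean, inner_smul_left, sum_inner]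

/-- The weighted average of a quantity bounded by `c` is at most `c`. -/
lemma avg_le (hK : 1 ≤ K) {a : Fin K → ℝ} {c : ℝ} (h : ∀ k, a k ≤ c) :
    (1 / (K : ℝ)) * ∑ k, a k ≤ c := by
  have h0 : (0 : ℝ) < K := by positivity
  calc (1 / (K : ℝ)) * ∑ k, a k ≤ (1 / (K : ℝ)) * ∑ _k : Fin K, c := by gcongr; exact h _
    _ = c := by simp; field_simp

lemma msq_const (hK : 1 ≤ K) (c : Vec n) : msq (fun _ : Fin K => c) = ‖c‖ ^ 2 := by
  have : (K : ℝ) ≠ 0 := by positivity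
  simp [msq, this]

lemma msq_mono {m : ℕ} {X : Fin K → Vec n} {Y : Fin K → Vec m} {c : ℝ}
    (h : ∀ k, ‖X k‖ ^ 2 ≤ c * ‖Y k‖ ^ 2) : msq X ≤ c * msq Y := by
  unfold msq
  rw [mul_left_comm c]
  gcongr
  rw [mul_sum]
  exact sum_le_sum fun k _ => h k

lemma msq_smul (a : ℝ) (X : Fin K → Vec n) : msq (fun k => a • X k) = a ^ 2 * msq X := by
  simp only [msq, norm_smul, mul_pow, ← mul_sum, Real.norm_eq_abs, sq_abs]; ring

/-- Bias-variance decomposition. -/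
lemma msq_sub_const (hK : 1 ≤ K) (X : Fin K → Vec n) (c : Vec n) :
    msq (fun k => X k - c) = ‖mean X - c‖ ^ 2 + dev X := by
  have h0 : (K : ℝ) ≠ 0 := by positivity
  have h1 : ∀ k, ‖X k - c‖ ^ 2
      = ‖mean X - c‖ ^ 2 + 2 * ⟪X k - mean X, mean X - c⟫ + ‖X k - mean X‖ ^ 2 := by
    intro k
    have : X k - c = (X k - mean X) + (mean X - c) := by abel
    rw [this, norm_add_sq_real]; ring
  have h2 : (1 / (K : ℝ)) * ∑ k, ⟪X k - mean X, mean X - c⟫ = 0 := by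
    rw [← mean_inner (fun k => X k - mean X), mean_sub, mean_const hK, sub_self, inner_zero_left]
  unfold dev msq
  simp only [h1, sum_add_distrib, ← mul_sum, mul_add]
  rw [mul_left_comm _ (2 : ℝ), h2]
  simp [h0]

lemma msq_eq (hK : 1 ≤ K) (X : Fin K → Vec n) : msq X = ‖mean X‖ ^ 2 + dev X := by
  simpa using msq_sub_const hK X 0

lemma norm_mean_sq_le (hK : 1 ≤ K) (X : Fin K → Vec n) : ‖mean X‖ ^ 2 ≤ msq X := by
  rw [msq_eq hK X]; linarith [dev_nonneg X]

lemma dev_le_msq (hK : 1 ≤ K) (X : Fin K → Vec n) : dev X ≤ msq X := by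
  rw [msq_eq hK X]; nlinarith [sq_nonneg ‖mean X‖]

lemma dev_le_msq_sub (hK : 1 ≤ K) (X : Fin K → Vec n) (c : Vec n) :
    dev X ≤ msq (fun k => X k - c) := by
  rw [msq_sub_const hK X c]; nlinarith [sq_nonneg ‖mean X - c‖]

lemma dev_const (hK : 1 ≤ K) (c : Vec n) : dev (fun _ : Fin K => c) = 0 := by
  simp [dev, mean_const hK, msq]

end Columns

/-- Young's inequality for the square of a norm. -/
lemma norm_add_sq_young {V : Type*} [NormedAddCommGroup V] [InnerProductSpace ℝ V] (a b : V)
    {s : ℝ} (hs : 0 < s) : ‖a + b‖ ^ 2 ≤ (1 + s) * ‖a‖ ^ 2 + (1 + 1 / s) * ‖b‖ ^ 2 := by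
  have h1 : ‖a + b‖ ^ 2 ≤ (‖a‖ + ‖b‖) ^ 2 := by gcongr; exact norm_add_le a b
  have h2 : 0 ≤ (1 / s) * (s * ‖a‖ - ‖b‖) ^ 2 := by positivity
  have h3 : (1 / s) * (s * ‖a‖ - ‖b‖) ^ 2
      = s * ‖a‖ ^ 2 - 2 * ‖a‖ * ‖b‖ + 1 / s * ‖b‖ ^ 2 := by
    field_simp; ring
  nlinarith

lemma norm_add_sq_le_two {V : Type*} [NormedAddCommGroup V] [InnerProductSpace ℝ V] (a b : V) :
    ‖a + b‖ ^ 2 ≤ 2 * ‖a‖ ^ 2 + 2 * ‖b‖ ^ 2 := by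
  have := norm_add_sq_young a b one_pos; norm_num at this; exact this

lemma norm_sub_sq_le_two {V : Type*} [NormedAddCommGroup V] [InnerProductSpace ℝ V] (a b : V) :
    ‖a - b‖ ^ 2 ≤ 2 * ‖a‖ ^ 2 + 2 * ‖b‖ ^ 2 := by
  have := norm_add_sq_le_two a (-b); rwa [← sub_eq_add_neg, norm_neg] at this

/-- Convexity of the square of a norm. -/
lemma norm_sq_convex {V : Type*} [NormedAddCommGroup V] [InnerProductSpace ℝ V] (a b : V)
    {θ : ℝ} (h0 : 0 ≤ θ) (h1 : θ ≤ 1) :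
    ‖a + θ • (b - a)‖ ^ 2 ≤ (1 - θ) * ‖a‖ ^ 2 + θ * ‖b‖ ^ 2 := by
  have h : a + θ • (b - a) = (1 - θ) • a + θ • b := by module
  have h2 : ‖(1 - θ) • a + θ • b‖ ≤ (1 - θ) * ‖a‖ + θ * ‖b‖ := by
    refine (norm_add_le _ _).trans (le_of_eq ?_)
    rw [norm_smul, norm_smul, Real.norm_of_nonneg h0, Real.norm_of_nonneg (by linarith)]
  rw [h]
  calc ‖(1 - θ) • a + θ • b‖ ^ 2 ≤ ((1 - θ) * ‖a‖ + θ * ‖b‖) ^ 2 := by gcongr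
    _ ≤ _ := by nlinarith [mul_nonneg (mul_nonneg h0 (by linarith : 0 ≤ 1 - θ))
                  (sq_nonneg (‖a‖ - ‖b‖))]

section Columns

variable {K n : ℕ}

lemma msq_add_young (X Y : Fin K → Vec n) {s : ℝ} (hs : 0 < s) :
    msq (fun k => X k + Y k) ≤ (1 + s) * msq X + (1 + 1 / s) * msq Y := by
  unfold msq
  have : (1 + s) * ((1 / (K : ℝ)) * ∑ k, ‖X k‖ ^ 2) + (1 + 1 / s) * ((1 / (K : ℝ)) * ∑ k, ‖Y k‖ ^ 2)
      = (1 / (K : ℝ)) * ∑ k, ((1 + s) * ‖X k‖ ^ 2 + (1 + 1 / s) * ‖Y k‖ ^ 2) := by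
    rw [sum_add_distrib, ← mul_sum, ← mul_sum]; ring
  rw [this]
  gcongr
  exact norm_add_sq_young _ _ hs

lemma msq_add_le_two (X Y : Fin K → Vec n) :
    msq (fun k => X k + Y k) ≤ 2 * msq X + 2 * msq Y := by
  have := msq_add_young X Y one_pos; norm_num at this; exact this

lemma msq_neg (X : Fin K → Vec n) : msq (fun k => - X k) = msq X := by simp [msq]

lemma msq_sub_le_two (X Y : Fin K → Vec n) :
    msq (fun k => X k - Y k) ≤ 2 * msq X + 2 * msq Y := by
  have := msq_add_le_two X (fun k => - Y k)
  rw [msq_neg] at this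
  simpa only [sub_eq_add_neg] using this

lemma msq_convex (X Y : Fin K → Vec n) {θ : ℝ} (h0 : 0 ≤ θ) (h1 : θ ≤ 1) :
    msq (fun k => X k + θ • (Y k - X k)) ≤ (1 - θ) * msq X + θ * msq Y := by
  unfold msq
  have : (1 - θ) * ((1 / (K : ℝ)) * ∑ k, ‖X k‖ ^ 2) + θ * ((1 / (K : ℝ)) * ∑ k, ‖Y k‖ ^ 2)
      = (1 / (K : ℝ)) * ∑ k, ((1 - θ) * ‖X k‖ ^ 2 + θ * ‖Y k‖ ^ 2) := by
    rw [sum_add_distrib, ← mul_sum, ← mul_sum]; ring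
  rw [this]
  gcongr
  exact norm_sq_convex _ _ h0 h1

lemma dev_convex (X Y : Fin K → Vec n) {θ : ℝ} (h0 : 0 ≤ θ) (h1 : θ ≤ 1) :
    dev (fun k => X k + θ • (Y k - X k)) ≤ (1 - θ) * dev X + θ * dev Y := by
  have := msq_convex (fun k => X k - mean X) (fun k => Y k - mean Y) h0 h1
  unfold dev
  convert this using 3 with k
  rw [mean_add, mean_smul, mean_sub]
  module

lemma dev_add_young (X Y : Fin K → Vec n) {s : ℝ} (hs : 0 < s) :
    dev (fun k => X k + Y k) ≤ (1 + s) * dev X + (1 + 1 / s) * dev Y := by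
  have := msq_add_young (fun k => X k - mean X) (fun k => Y k - mean Y) hs
  unfold dev
  convert this using 3 with k
  rw [mean_add]
  module

lemma dev_smul (a : ℝ) (X : Fin K → Vec n) : dev (fun k => a • X k) = a ^ 2 * dev X := by
  unfold dev
  rw [← msq_smul]
  simp only [mean_smul, smul_sub]

/-- Nonexpansive maps do not increase the consensus error. -/
lemma dev_comp_le (hK : 1 ≤ K) (X : Fin K → Vec n) {φ : Vec n → Vec n}
    (hφ : ∀ a b, ‖φ a - φ b‖ ≤ ‖a - b‖) : dev (fun k => φ (X k)) ≤ dev X := by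
  refine (dev_le_msq_sub hK _ (φ (mean X))).trans ?_
  have := msq_mono (X := fun k => φ (X k) - φ (mean X)) (Y := fun k => X k - mean X) (c := 1)
    (fun k => by rw [one_mul]; gcongr; exact hφ _ _)
  simpa [dev] using this

/-! #### Gossip -/

lemma mix_sub (E : Matrix (Fin K) (Fin K) ℝ) (X Y : Fin K → Vec n) (k : Fin K) :
    mix E (fun j => X j - Y j) k = mix E X k - mix E Y k := by
  simp [mix, smul_sub, sum_sub_distrib]

variable {E : Matrix (Fin K) (Fin K) ℝ} {lam : ℝ}

lemma IsGossip.row_sum (h : IsGossip E lam) (i : Fin K) : ∑ j, E i j = 1 :=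
  (mem_doublyStochastic_iff_sum.1 h.doubly).2.1 i

lemma IsGossip.col_sum (h : IsGossip E lam) (j : Fin K) : ∑ i, E i j = 1 :=
  (mem_doublyStochastic_iff_sum.1 h.doubly).2.2 j

lemma IsGossip.mean_mix (h : IsGossip E lam) (X : Fin K → Vec n) : mean (mix E X) = mean X := by
  unfold mean mix
  rw [sum_comm]
  simp only [← sum_smul, h.row_sum, one_smul]

lemma IsGossip.mix_const (h : IsGossip E lam) (c : Vec n) (k : Fin K) :
    mix E (fun _ => c) k = c := by
  unfold mix
  rw [← sum_smul, h.col_sum, one_smul]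

lemma IsGossip.lam_nonneg (h : IsGossip E lam) (hK : 1 ≤ K) : 0 ≤ lam := by
  obtain ⟨hE, e, _, _, h1⟩ := h.spectrum
  rcases Nat.lt_or_ge 1 K with hK' | hK'
  · rw [← h1 ⟨1, hK'⟩ rfl]; exact abs_nonneg _
  · rw [h.single (by omega)]

/-- On vectors orthogonal to the constants, the gossip matrix contracts by `|λ₂|`: an eigenvector
whose eigenvalue differs from `1` is orthogonal to the vector of ones, so the latter spans the
eigenspace of the leading eigenvalue. -/
lemma IsGossip.contract (h : IsGossip E lam) (hK : 1 ≤ K) (v : Fin K → ℝ) (hv : ∑ k, v k = 0) :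
    ∑ k, (∑ j, E j k * v j) ^ 2 ≤ lam ^ 2 * ∑ k, v k ^ 2 := by
  have hl0 := h.lam_nonneg hK
  obtain ⟨hE, e, hanti, h0, h1⟩ := h.spectrum
  set b := hE.eigenvectorBasis with hb
  have hsymm : ∀ i j, E i j = E j i := fun i j => congrFun (congrFun h.isSymm j) i
  have key : ∀ (i : Fin K) (w : Fin K → ℝ),
      ⟪b i, WithLp.toLp 2 (E.mulVec w)⟫ = hE.eigenvalues i * ⟪b i, WithLp.toLp 2 w⟫ := by
    intro i w
    have hm := hE.mulVec_eigenvectorBasis i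
    have hc : ∀ j, ∑ l, E j l * (b i) l = hE.eigenvalues i * (b i) j := by
      intro j
      have := congrFun hm j
      simpa [Matrix.mulVec, dotProduct] using this
    simp only [PiLp.inner_apply, RCLike.inner_apply, conj_trivial, Matrix.mulVec, dotProduct]
    simp only [sum_mul, mul_sum]
    rw [sum_comm]
    refine sum_congr rfl fun l _ => ?_
    have : hE.eigenvalues i * (w l * (b i) l) = w l * (hE.eigenvalues i * (b i) l) := by ring
    rw [this, ← hc l, mul_sum]
    refine sum_congr rfl fun j _ => ?_
    rw [hsymm l j]; ring
  -- every eigenvalue but the first is at most `lam` in absolute value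
  have hle : ∀ n : Fin K, n.val ≠ 0 → |hE.eigenvalues (e n)| ≤ lam := by
    intro n hn
    have hK2 : 1 < K := by have := n.isLt; omega
    rw [← h1 ⟨1, hK2⟩ rfl]
    exact hanti (by rw [Fin.le_def]; show 1 ≤ n.val; omega)
  let z : Fin K := ⟨0, hK⟩
  let one : EuclideanSpace ℝ (Fin K) := WithLp.toLp 2 (fun _ => (1 : ℝ))
  have hone : ∀ n : Fin K, n.val ≠ 0 → ⟪b (e n), one⟫ = 0 := by
    intro n hn
    have h2 := key (e n) (fun _ => 1)
    have h3 : E.mulVec (fun _ => (1 : ℝ)) = fun _ => 1 := by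
      ext i; simp [Matrix.mulVec, dotProduct, h.row_sum]
    rw [h3] at h2
    have h4 : hE.eigenvalues (e n) ≠ 1 := by
      intro h5
      have := hle n hn
      rw [h5, abs_one] at this
      linarith [h.gap]
    have h5 : (1 - hE.eigenvalues (e n)) * ⟪b (e n), one⟫ = 0 := by
      have : ⟪b (e n), one⟫ = hE.eigenvalues (e n) * ⟪b (e n), one⟫ := h2
      linarith
    rcases mul_eq_zero.1 h5 with h6 | h6
    · exact absurd (by linarith) h4
    · exact h6
  have hsum : ∀ w : EuclideanSpace ℝ (Fin K),
      ⟪one, w⟫ = ⟪one, b (e z)⟫ * ⟪b (e z), w⟫ := by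
    intro w
    rw [← b.sum_inner_mul_inner one w, ← Equiv.sum_comp e]
    refine sum_eq_single z (fun n _ hn => ?_) (fun hz => absurd (mem_univ _) hz)
    have : n.val ≠ 0 := fun h' => hn (Fin.ext h')
    rw [real_inner_comm, hone n this, zero_mul]
  have hz : ⟪b (e z), WithLp.toLp 2 v⟫ = 0 := by
    have h2 := hsum (WithLp.toLp 2 v)
    have h3 : ⟪one, (WithLp.toLp 2 v : EuclideanSpace ℝ (Fin K))⟫ = 0 := by
      simp [one, PiLp.inner_apply, hv]
    rw [h3] at h2
    rcases mul_eq_zero.1 h2.symm with h4 | h4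
    · exfalso
      have h5 := hsum one
      rw [h4, zero_mul] at h5
      have : ⟪one, one⟫ = (K : ℝ) := by rw [PiLp.inner_apply]; simp [one]
      rw [this] at h5
      have : (0 : ℝ) < K := by positivity
      linarith
    · exact h4
  have hL : ∑ k, (∑ j, E j k * v j) ^ 2
      = ∑ i, (hE.eigenvalues i * ⟪b i, WithLp.toLp 2 v⟫) ^ 2 := by
    have h2 := b.sum_sq_norm_inner_right (WithLp.toLp 2 (E.mulVec v))
    rw [EuclideanSpace.norm_sq_eq] at h2
    simp only [key, Real.norm_eq_abs, sq_abs] at h2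
    rw [h2]
    refine sum_congr rfl fun k _ => ?_
    congr 1
    simp only [Matrix.mulVec, dotProduct]
    exact sum_congr rfl fun j _ => by rw [hsymm j k]
  have hR : ∑ k, v k ^ 2 = ∑ i, ⟪b i, (WithLp.toLp 2 v : EuclideanSpace ℝ (Fin K))⟫ ^ 2 := by
    have h2 := b.sum_sq_norm_inner_right (WithLp.toLp 2 v)
    rw [EuclideanSpace.norm_sq_eq] at h2
    simp only [Real.norm_eq_abs, sq_abs] at h2
    rw [h2]
  rw [hL, hR, mul_sum, ← Equiv.sum_comp e, ← Equiv.sum_comp e (fun i => lam ^ 2 * _)]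
  refine sum_le_sum fun n _ => ?_
  by_cases hn : n.val = 0
  · have : n = z := Fin.ext hn
    rw [this, hz]; simp
  · rw [mul_pow]
    gcongr ?_ * _
    rw [← sq_abs]
    gcongr
    exact hle n hn

lemma IsGossip.sum_mix_le (h : IsGossip E lam) (hK : 1 ≤ K) (X : Fin K → Vec n)
    (hX : ∑ k, X k = 0) : msq (mix E X) ≤ lam ^ 2 * msq X := by
  unfold msq
  rw [mul_left_comm]
  gcongr
  simp only [EuclideanSpace.norm_sq_eq, Real.norm_eq_abs, sq_abs]
  rw [sum_comm, sum_comm (f := fun k i => (X k) i ^ 2), mul_sum]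
  refine sum_le_sum fun i _ => ?_
  have h1 : ∑ k, (X k) i = 0 := by
    have := congrArg (fun w : Vec n => w i) hX
    simpa using this
  have := h.contract hK (fun k => (X k) i) h1
  simpa [mix] using this

lemma IsGossip.dev_mix (h : IsGossip E lam) (hK : 1 ≤ K) (X : Fin K → Vec n) :
    dev (mix E X) ≤ lam ^ 2 * dev X := by
  have h0 : (K : ℝ) ≠ 0 := by positivity
  have h1 : ∑ k, (X k - mean X) = 0 := by
    have : mean (fun k => X k - mean X) = 0 := by rw [mean_sub, mean_const hK, sub_self]
    have h2 := congrArg (fun w => (K : ℝ) • w) this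
    simpa only [mean, smul_smul, mul_one_div_cancel h0, one_smul, smul_zero] using h2
  have := h.sum_mix_le hK (fun k => X k - mean X) h1
  unfold dev
  convert this using 3 with k
  rw [mix_sub, h.mix_const, h.mean_mix]

/-- One gossip step with a perturbation. -/
lemma IsGossip.dev_mix_add (h : IsGossip E lam) (hK : 1 ≤ K) (X Y : Fin K → Vec n) :
    dev (fun k => mix E X k + Y k) ≤ lam * dev X + 2 / (1 - lam) * dev Y := by
  have hl0 := h.lam_nonneg hK
  have hρ : 0 < 1 - lam := by linarith [h.gap]
  have h1 := dev_add_young (mix E X) Y hρ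
  have h2 := h.dev_mix hK X
  have h3 : (1 + (1 - lam)) * dev (mix E X) ≤ lam * dev X := by
    calc (1 + (1 - lam)) * dev (mix E X) ≤ (1 + (1 - lam)) * (lam ^ 2 * dev X) := by gcongr
      _ ≤ lam * dev X := by
        have : (1 + (1 - lam)) * lam ^ 2 ≤ lam := by nlinarith [mul_nonneg hl0 (sq_nonneg (1 - lam))]
        nlinarith [dev_nonneg X]
  have h4 : 1 + 1 / (1 - lam) ≤ 2 / (1 - lam) := by
    rw [show (2 : ℝ) / (1 - lam) = 1 / (1 - lam) + 1 / (1 - lam) by ring]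
    have : 1 ≤ 1 / (1 - lam) := by rw [le_div_iff₀ hρ]; linarith
    linarith
  nlinarith [dev_nonneg Y]

lemma IsGossip.dev_mix_sub_smul (h : IsGossip E lam) (hK : 1 ≤ K) (X Y : Fin K → Vec n) (β : ℝ) :
    dev (fun k => mix E X k - β • Y k) ≤ lam * dev X + 2 / (1 - lam) * (β ^ 2 * dev Y) := by
  have := h.dev_mix_add hK X (fun k => (-β) • Y k)
  rw [dev_smul, neg_sq] at this
  simpa only [neg_smul, ← sub_eq_add_neg] using this

/-- Size of a gossip step before relaxation. -/
lemma IsGossip.msq_step_le (h : IsGossip E lam) (hK : 1 ≤ K) (X Y : Fin K → Vec n) (β : ℝ) :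
    msq (fun k => mix E X k - β • Y k - X k) ≤ 8 * dev X + 2 * (β ^ 2 * msq Y) := by
  have h1 : msq (fun k => mix E X k - β • Y k - X k)
      = msq (fun k => (mix E X k - X k) - β • Y k) := by
    congr 1; ext1 k; abel
  have h2 : msq (fun k => mix E X k - X k) = msq (fun k => (mix E X k - mean (mix E X))
      - (X k - mean X)) := by
    congr 1; ext1 k; rw [h.mean_mix]; abel
  have h3 := msq_sub_le_two (fun k => mix E X k - mean (mix E X)) (fun k => X k - mean X)
  have h4 := h.dev_mix hK X
  have h5 := msq_sub_le_two (fun k => mix E X k - X k) (fun k => β • Y k)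
  have h6 : lam ^ 2 ≤ 1 := by nlinarith [h.lam_nonneg hK, h.gap]
  rw [msq_smul] at h5
  rw [h1]
  change _ ≤ 2 * dev _ + 2 * dev _ at h3
  nlinarith [dev_nonneg X]

end Columns

/-! ### The projection onto a ball -/

section Ball

variable {n : ℕ}

lemma norm_ballProj_le {r : ℝ} (hr : 0 ≤ r) (z : Vec n) : ‖ballProj r z‖ ≤ r := by
  unfold ballProj
  split_ifs with h
  · exact h
  · push Not at h
    have : 0 < ‖z‖ := lt_of_le_of_lt hr h
    rw [norm_smul, norm_div, norm_norm, Real.norm_of_nonneg hr, div_mul_cancel₀ _ this.ne']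

lemma ballProj_of_le {r : ℝ} {z : Vec n} (hz : ‖z‖ ≤ r) : ballProj r z = z := if_pos hz

/-- Variational inequality of the projection. -/
lemma ballProj_inner_nonpos {r : ℝ} (hr : 0 ≤ r) (z w : Vec n) (hw : ‖w‖ ≤ r) :
    ⟪z - ballProj r z, w - ballProj r z⟫ ≤ 0 := by
  unfold ballProj
  split_ifs with h
  · simp
  · push Not at h
    have hz : 0 < ‖z‖ := lt_of_le_of_lt hr h
    set q := r / ‖z‖ with hq
    have hq1 : q ≤ 1 := by rw [hq, div_le_one hz]; exact h.le
    have hqz : q * ‖z‖ = r := by rw [hq]; field_simp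
    have h1 : z - q • z = (1 - q) • z := by module
    rw [h1, inner_smul_left, inner_sub_right, inner_smul_right, real_inner_self_eq_norm_sq]
    have h2 : ⟪z, w⟫ ≤ ‖z‖ * r :=
      (real_inner_le_norm z w).trans (by gcongr)
    have h3 : q * ‖z‖ ^ 2 = ‖z‖ * r := by rw [pow_two, ← mul_assoc, hqz]; ring
    rw [h3]
    simp only [conj_trivial]
    exact mul_nonpos_of_nonneg_of_nonpos (by linarith) (by linarith)

lemma ballProj_nonexpansive {r : ℝ} (hr : 0 ≤ r) (a b : Vec n) :
    ‖ballProj r a - ballProj r b‖ ≤ ‖a - b‖ := by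
  have h1 := ballProj_inner_nonpos hr a (ballProj r b) (norm_ballProj_le hr b)
  have h2 := ballProj_inner_nonpos hr b (ballProj r a) (norm_ballProj_le hr a)
  set p := ballProj r a
  set q := ballProj r b
  have h3 : ‖p - q‖ ^ 2 ≤ ⟪a - b, p - q⟫ := by
    rw [← real_inner_self_eq_norm_sq]
    have e1 : ⟪a - p, q - p⟫ = - ⟪a - p, p - q⟫ := by rw [← inner_neg_right, neg_sub]
    have e2 : ⟪a - b, p - q⟫ = ⟪a - p, p - q⟫ + ⟪p - q, p - q⟫ - ⟪b - q, p - q⟫ := by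
      rw [← inner_add_left, ← inner_sub_left]; congr 1; abel
    linarith
  have h4 := real_inner_le_norm (a - b) (p - q)
  by_contra hlt
  push Not at hlt
  nlinarith [norm_nonneg (a - b), norm_nonneg (p - q)]

lemma continuous_ballProj {r : ℝ} (hr : 0 ≤ r) : Continuous (ballProj (n := n) r) :=
  (LipschitzWith.of_dist_le_mul (K := 1) fun a b => by
    simpa [dist_eq_norm] using ballProj_nonexpansive hr a b).continuous

end Ball

/-! ### First-order expansions of the losses at a fixed sample -/

lemma inner_gradient_apply {n : ℕ} (φ : Vec n → ℝ) (x v : Vec n) :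
    ⟪gradient φ x, v⟫ = fderiv ℝ φ x v := by
  unfold gradient; exact InnerProductSpace.toDual_symm_apply

/-- Mean value inequality: the increment over `[0, 1]` differs from `c` by at most the largest
deviation of the derivative from `c`. -/
lemma abs_increment_sub_le {φ φ' : ℝ → ℝ} {c M : ℝ} (h : ∀ s, HasDerivAt φ (φ' s) s)
    (hb : ∀ s, 0 ≤ s → s ≤ 1 → |φ' s - c| ≤ M) : |φ 1 - φ 0 - c| ≤ M := by
  have h1 : ∀ s, HasDerivAt (fun s => φ s - s * c) (φ' s - c) s := fun s => by
    have := (h s).sub ((hasDerivAt_id s).mul_const c)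
    rw [one_mul] at this
    exact this
  have := norm_image_sub_le_of_norm_deriv_le_segment_01' (f := fun s => φ s - s * c)
    (f' := fun s => φ' s - c) (C := M) (fun s _ => (h1 s).hasDerivWithinAt)
    (fun s hs => by simpa using hb s hs.1 hs.2.le)
  simp only [Real.norm_eq_abs] at this
  convert this using 2
  ring

section Path

variable {E F V : Type*} [NormedAddCommGroup E] [NormedSpace ℝ E] [NormedAddCommGroup F]
  [NormedSpace ℝ F] [NormedAddCommGroup V] [NormedSpace ℝ V]

lemma fderiv_uncurry_apply {φ : E → F → V} {x : E} {y : F}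
    (h : DifferentiableAt ℝ (fun p : E × F => φ p.1 p.2) (x, y)) (dx : E) (dy : F) :
    fderiv ℝ (fun p : E × F => φ p.1 p.2) (x, y) (dx, dy)
      = fderiv ℝ (fun x' => φ x' y) x dx + fderiv ℝ (fun y' => φ x y') y dy := by
  have h1 : HasFDerivAt (fun x' => φ x' y)
      ((fderiv ℝ (fun p : E × F => φ p.1 p.2) (x, y)).comp (.inl ℝ E F)) x :=
    HasFDerivAt.comp x (g := fun p : E × F => φ p.1 p.2) (f := fun x' => (x', y))
      h.hasFDerivAt (hasFDerivAt_prodMk_left x y)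
  have h2 : HasFDerivAt (fun y' => φ x y')
      ((fderiv ℝ (fun p : E × F => φ p.1 p.2) (x, y)).comp (.inr ℝ E F)) y :=
    HasFDerivAt.comp y (g := fun p : E × F => φ p.1 p.2) (f := fun y' => (x, y'))
      h.hasFDerivAt (hasFDerivAt_prodMk_right x y)
  rw [h1.fderiv, h2.fderiv]
  simp [← map_add]

lemma hasDerivAt_line {φ : E → F → V} (h : Differentiable ℝ (fun p : E × F => φ p.1 p.2))
    (x dx : E) (y dy : F) (s : ℝ) :
    HasDerivAt (fun s : ℝ => φ (x + s • dx) (y + s • dy))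
      (fderiv ℝ (fun x' => φ x' (y + s • dy)) (x + s • dx) dx
        + fderiv ℝ (fun y' => φ (x + s • dx) y') (y + s • dy) dy) s := by
  have h1 : HasDerivAt (fun s : ℝ => (x + s • dx, y + s • dy)) (dx, dy) s := by
    refine HasDerivAt.prodMk ?_ ?_
    · simpa using ((hasDerivAt_id s).smul_const dx).const_add x
    · simpa using ((hasDerivAt_id s).smul_const dy).const_add y
  rw [← fderiv_uncurry_apply (h _)]
  exact (h (x + s • dx, y + s • dy)).hasFDerivAt.comp_hasDerivAt s h1

lemma hasDerivAt_line' {φ : F → V} (h : Differentiable ℝ φ) (y dy : F) (s : ℝ) :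
    HasDerivAt (fun s : ℝ => φ (y + s • dy)) (fderiv ℝ φ (y + s • dy) dy) s := by
  have h1 : HasDerivAt (fun s : ℝ => y + s • dy) dy s := by
    simpa using ((hasDerivAt_id s).smul_const dy).const_add y
  exact (h (y + s • dy)).hasFDerivAt.comp_hasDerivAt s h1

end Path

lemma sqrt_line_le {a b s : ℝ} (h0 : 0 ≤ s) (h1 : s ≤ 1) :
    √((s * a) ^ 2 + (s * b) ^ 2) ≤ √(a ^ 2 + b ^ 2) := by
  apply Real.sqrt_le_sqrt
  have : s ^ 2 ≤ 1 := by nlinarith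
  nlinarith [mul_nonneg (by linarith : 0 ≤ 1 - s ^ 2) (add_nonneg (sq_nonneg a) (sq_nonneg b))]

lemma le_sqrt_add_left (a b : ℝ) : a ≤ √(a ^ 2 + b ^ 2) :=
  Real.le_sqrt_of_sq_le (by nlinarith [sq_nonneg b])

lemma le_sqrt_add_right (a b : ℝ) : b ≤ √(a ^ 2 + b ^ 2) :=
  Real.le_sqrt_of_sq_le (by nlinarith [sq_nonneg a])

/-- A jointly Lipschitz map varies by at most `L √(‖dx‖² + ‖dy‖²)` along a segment. -/
lemma JointLipschitz.line {dx dy : ℕ} {V : Type*} [NormedAddCommGroup V] {L : ℝ} (hL : 0 ≤ L)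
    {Φ : Vec dx → Vec dy → V} (h : JointLipschitz L Φ) (x u : Vec dx) (y v : Vec dy) {s : ℝ}
    (h0 : 0 ≤ s) (h1 : s ≤ 1) :
    ‖Φ (x + s • u) (y + s • v) - Φ x y‖ ≤ L * √(‖u‖ ^ 2 + ‖v‖ ^ 2) := by
  refine (h _ _ _ _).trans ?_
  gcongr ?_ * ?_
  simp only [add_sub_cancel_left, norm_smul, Real.norm_of_nonneg h0]
  exact sqrt_line_le h0 h1

namespace Problem

variable {K dx dy : ℕ} {Sf Sg : Type*} [MeasurableSpace Sf] [MeasurableSpace Sg]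
  {D : Problem K dx dy Sf Sg}

/-- First-order expansion of an upper loss at a fixed sample. Being quadratic with a constant
uniform in the sample, the remainder survives the expectation, so that no differentiation under the
integral sign is needed. -/
lemma UpperSmooth.taylor {lfx lfy cfy : ℝ} (hx : 0 ≤ lfx) (hy : 0 ≤ lfy)
    (h : D.UpperSmooth lfx lfy cfy) (k : Fin K) (ξ : Sf) (x x' : Vec dx) (y y' : Vec dy) :
    |D.fAt k ξ x' y' - D.fAt k ξ x y
        - (⟪grad1 (D.fAt k ξ) x y, x' - x⟫ + ⟪grad2 (D.fAt k ξ) x y, y' - y⟫)|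
      ≤ (lfx + lfy) * (‖x' - x‖ ^ 2 + ‖y' - y‖ ^ 2) := by
  set u := x' - x
  set v := y' - y
  have hd : Differentiable ℝ (fun p : Vec dx × Vec dy => D.fAt k ξ p.1 p.2) :=
    (h.contDiff k ξ).differentiable (by norm_num)
  have key := abs_increment_sub_le (φ := fun s => D.fAt k ξ (x + s • u) (y + s • v))
    (φ' := fun s => ⟪grad1 (D.fAt k ξ) (x + s • u) (y + s • v), u⟫
      + ⟪grad2 (D.fAt k ξ) (x + s • u) (y + s • v), v⟫)
    (c := ⟪grad1 (D.fAt k ξ) x y, u⟫ + ⟪grad2 (D.fAt k ξ) x y, v⟫)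
    (M := (lfx + lfy) * (‖u‖ ^ 2 + ‖v‖ ^ 2))
    (fun s => by
      have := hasDerivAt_line hd x u y v s
      simpa only [grad1, grad2, inner_gradient_apply] using this)
    (fun s h0 h1 => by
      have e1 := (h.lip_grad1 k ξ).line hx x u y v h0 h1
      have e2 := (h.lip_grad2 k ξ).line hy x u y v h0 h1
      have e3 := abs_real_inner_le_norm
        (grad1 (D.fAt k ξ) (x + s • u) (y + s • v) - grad1 (D.fAt k ξ) x y) u
      have e4 := abs_real_inner_le_norm
        (grad2 (D.fAt k ξ) (x + s • u) (y + s • v) - grad2 (D.fAt k ξ) x y) v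
      have e5 := le_sqrt_add_left ‖u‖ ‖v‖
      have e6 := le_sqrt_add_right ‖u‖ ‖v‖
      have e7 : √(‖u‖ ^ 2 + ‖v‖ ^ 2) ^ 2 = ‖u‖ ^ 2 + ‖v‖ ^ 2 := Real.sq_sqrt (by positivity)
      rw [← e7]
      set R := √(‖u‖ ^ 2 + ‖v‖ ^ 2)
      have hR : 0 ≤ R := Real.sqrt_nonneg _
      rw [inner_sub_left] at e3 e4
      have e8 := mul_le_mul e1 e5 (norm_nonneg _) (mul_nonneg hx hR)
      have e9 := mul_le_mul e2 e6 (norm_nonneg _) (mul_nonneg hy hR)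
      rw [add_sub_add_comm]
      refine (abs_add_le _ _).trans ?_
      nlinarith)
  simpa [u, v] using key

/-- First-order expansion of a lower loss in its second argument at a fixed sample. -/
lemma LowerSmooth.taylor {μ lgy lgxy lgyy cgxy : ℝ} (hy : 0 ≤ lgy)
    (h : D.LowerSmooth μ lgy lgxy lgyy cgxy) (k : Fin K) (ζ : Sg) (x : Vec dx) (y y' : Vec dy) :
    |D.gAt k ζ x y' - D.gAt k ζ x y - ⟪grad2 (D.gAt k ζ) x y, y' - y⟫|
      ≤ lgy * ‖y' - y‖ ^ 2 := by
  set v := y' - y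
  have key := abs_increment_sub_le (φ := fun s => D.gAt k ζ x (y + s • v))
    (φ' := fun s => ⟪grad2 (D.gAt k ζ) x (y + s • v), v⟫)
    (c := ⟪grad2 (D.gAt k ζ) x y, v⟫) (M := lgy * ‖v‖ ^ 2)
    (fun s => by
      have := hasDerivAt_line' (h.differentiable k ζ x) y v s
      simpa only [grad2, inner_gradient_apply] using this)
    (fun s h0 h1 => by
      have e2 := (h.lip_grad2 k ζ).line hy x 0 y v h0 h1
      simp only [smul_zero, add_zero, norm_zero, ne_eq, OfNat.ofNat_ne_zero, not_false_eq_true,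
        zero_pow, zero_add, Real.sqrt_sq (norm_nonneg v)] at e2
      rw [← inner_sub_left]
      refine (abs_real_inner_le_norm _ _).trans ?_
      nlinarith [norm_nonneg v])
  simpa [v] using key

lemma inner_jac12 (φ : Vec dx → Vec dy → ℝ) (x u : Vec dx) (y z : Vec dy) :
    ⟪jac12 φ x y z, u⟫ = ⟪z, fderiv ℝ (fun x' => grad2 φ x' y) x u⟫ :=
  ContinuousLinearMap.adjoint_inner_left _ _ _

lemma LowerSmooth.differentiable_grad2 {μ lgy lgxy lgyy cgxy : ℝ}
    (h : D.LowerSmooth μ lgy lgxy lgyy cgxy) (k : Fin K) (ζ : Sg) :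
    Differentiable ℝ (fun p : Vec dx × Vec dy => grad2 (D.gAt k ζ) p.1 p.2) :=
  (h.contDiff_grad2 k ζ).differentiable (by norm_num)

lemma LowerSmooth.differentiable_grad2_right {μ lgy lgxy lgyy cgxy : ℝ}
    (h : D.LowerSmooth μ lgy lgxy lgyy cgxy) (k : Fin K) (ζ : Sg) (x : Vec dx) :
    Differentiable ℝ (fun y => grad2 (D.gAt k ζ) x y) := fun y =>
  (h.differentiable_grad2 k ζ (x, y)).comp (f := fun y => (x, y)) y (by fun_prop)

lemma LowerSmooth.differentiable_grad2_left {μ lgy lgxy lgyy cgxy : ℝ}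
    (h : D.LowerSmooth μ lgy lgxy lgyy cgxy) (k : Fin K) (ζ : Sg) (y : Vec dy) :
    Differentiable ℝ (fun x => grad2 (D.gAt k ζ) x y) := fun x =>
  (h.differentiable_grad2 k ζ (x, y)).comp (f := fun x => (x, y)) x (by fun_prop)

/-- Symmetry of the second derivative in `y`. -/
lemma LowerSmooth.inner_hess22 {μ lgy lgxy lgyy cgxy : ℝ}
    (h : D.LowerSmooth μ lgy lgxy lgyy cgxy) (k : Fin K) (ζ : Sg) (x : Vec dx) (y z v : Vec dy) :
    ⟪hess22 (D.gAt k ζ) x y z, v⟫ = ⟪z, hess22 (D.gAt k ζ) x y v⟫ := by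
  have h1 : ∀ y', HasFDerivAt (fun y' => D.gAt k ζ x y')
      (innerSL ℝ (grad2 (D.gAt k ζ) x y')) y' := fun y' => by
    have e : innerSL ℝ (grad2 (D.gAt k ζ) x y') = fderiv ℝ (fun y' => D.gAt k ζ x y') y' := by
      ext w
      rw [innerSL_apply_apply]
      exact inner_gradient_apply _ _ _
    rw [e]
    exact (h.differentiable k ζ x y').hasFDerivAt
  have h2 : HasFDerivAt (fun y' => innerSL ℝ (grad2 (D.gAt k ζ) x y'))
      ((innerSL ℝ (E := Vec dy)).comp (hess22 (D.gAt k ζ) x y)) y :=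
    (innerSL ℝ (E := Vec dy)).hasFDerivAt.comp y
      (h.differentiable_grad2_right k ζ x y).hasFDerivAt
  have h3 := second_derivative_symmetric h1 h2 z v
  simp only [ContinuousLinearMap.comp_apply, innerSL_apply_apply] at h3
  rw [h3, real_inner_comm]

/-- Expansion of `⟪z, ∇₂ g⟫`, in the form in which it enters the hypergradient. -/
lemma LowerSmooth.taylor_grad2 {μ lgy lgxy lgyy cgxy : ℝ} (hxy : 0 ≤ lgxy) (hyy : 0 ≤ lgyy)
    (h : D.LowerSmooth μ lgy lgxy lgyy cgxy) (k : Fin K) (ζ : Sg) (x x' : Vec dx)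
    (y y' z : Vec dy) :
    |⟪z, grad2 (D.gAt k ζ) x' y'⟫ - ⟪z, grad2 (D.gAt k ζ) x y⟫
        - (⟪jac12 (D.gAt k ζ) x y z, x' - x⟫ + ⟪hess22 (D.gAt k ζ) x y z, y' - y⟫)|
      ≤ ‖z‖ * (lgxy + lgyy) * (‖x' - x‖ ^ 2 + ‖y' - y‖ ^ 2) := by
  set u := x' - x
  set v := y' - y
  have key := abs_increment_sub_le (φ := fun s => ⟪z, grad2 (D.gAt k ζ) (x + s • u) (y + s • v)⟫)
    (φ' := fun s => ⟪jac12 (D.gAt k ζ) (x + s • u) (y + s • v) z, u⟫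
      + ⟪hess22 (D.gAt k ζ) (x + s • u) (y + s • v) z, v⟫)
    (c := ⟪jac12 (D.gAt k ζ) x y z, u⟫ + ⟪hess22 (D.gAt k ζ) x y z, v⟫)
    (M := ‖z‖ * (lgxy + lgyy) * (‖u‖ ^ 2 + ‖v‖ ^ 2))
    (fun s => by
      have h1 := hasDerivAt_line (h.differentiable_grad2 k ζ) x u y v s
      have h2 := (innerSL ℝ z).hasFDerivAt.comp_hasDerivAt s h1
      simp only [innerSL_apply_apply, inner_add_right] at h2
      rw [inner_jac12, h.inner_hess22]
      exact h2)
    (fun s h0 h1 => by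
      have e1 := (h.lip_jac12 k ζ).line hxy x u y v h0 h1
      have e2 := (h.lip_hess22 k ζ).line hyy x u y v h0 h1
      have e3 := (abs_real_inner_le_norm
        ((jac12 (D.gAt k ζ) (x + s • u) (y + s • v) - jac12 (D.gAt k ζ) x y) z) u)
      have e4 := (abs_real_inner_le_norm
        ((hess22 (D.gAt k ζ) (x + s • u) (y + s • v) - hess22 (D.gAt k ζ) x y) z) v)
      have e5 := le_sqrt_add_left ‖u‖ ‖v‖
      have e6 := le_sqrt_add_right ‖u‖ ‖v‖
      have e7 : √(‖u‖ ^ 2 + ‖v‖ ^ 2) ^ 2 = ‖u‖ ^ 2 + ‖v‖ ^ 2 := Real.sq_sqrt (by positivity)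
      rw [← e7]
      set R := √(‖u‖ ^ 2 + ‖v‖ ^ 2)
      have hR : 0 ≤ R := Real.sqrt_nonneg _
      have e8 := (ContinuousLinearMap.le_opNorm
        (jac12 (D.gAt k ζ) (x + s • u) (y + s • v) - jac12 (D.gAt k ζ) x y) z).trans
        (mul_le_mul_of_nonneg_right e1 (norm_nonneg z))
      have e9 := (ContinuousLinearMap.le_opNorm
        (hess22 (D.gAt k ζ) (x + s • u) (y + s • v) - hess22 (D.gAt k ζ) x y) z).trans
        (mul_le_mul_of_nonneg_right e2 (norm_nonneg z))
      have e10 := mul_le_mul e8 e5 (norm_nonneg _) (by positivity)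
      have e11 := mul_le_mul e9 e6 (norm_nonneg _) (by positivity)
      rw [sub_apply, inner_sub_left] at e3 e4
      rw [add_sub_add_comm]
      refine (abs_add_le _ _).trans ?_
      rw [sub_apply] at e10 e11
      nlinarith)
  simpa [u, v] using key

/-- Strong monotonicity of `∇₂ g(x, ·; ζ)`. -/
lemma LowerSmooth.strong_mono {μ lgy lgxy lgyy cgxy : ℝ}
    (h : D.LowerSmooth μ lgy lgxy lgyy cgxy) (k : Fin K) (ζ : Sg) (x : Vec dx) (y y' : Vec dy) :
    μ * ‖y' - y‖ ^ 2 ≤ ⟪grad2 (D.gAt k ζ) x y' - grad2 (D.gAt k ζ) x y, y' - y⟫ := by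
  set v := y' - y
  have h1 : ∀ s, HasDerivAt (fun s : ℝ => ⟪v, grad2 (D.gAt k ζ) x (y + s • v)⟫)
      ⟪v, hess22 (D.gAt k ζ) x (y + s • v) v⟫ s := fun s => by
    have h1 := hasDerivAt_line' (h.differentiable_grad2_right k ζ x) y v s
    exact (innerSL ℝ v).hasFDerivAt.comp_hasDerivAt s h1
  obtain ⟨s, -, hs⟩ := exists_hasDerivAt_eq_slope _ _ (zero_lt_one' ℝ)
    (fun s _ => (h1 s).continuousAt.continuousWithinAt) (fun s _ => h1 s)
  have h2 := h.hess22_lower k ζ x (y + s • v) v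
  rw [hs] at h2
  simp only [one_smul, zero_smul, add_zero, sub_zero, div_one] at h2
  rw [real_inner_comm, inner_sub_right]
  simpa [v] using h2

lemma LowerSmooth.norm_hess22_le {μ lgy lgxy lgyy cgxy : ℝ} (hy : 0 ≤ lgy)
    (h : D.LowerSmooth μ lgy lgxy lgyy cgxy) (k : Fin K) (ζ : Sg) (x : Vec dx) (y : Vec dy) :
    ‖hess22 (D.gAt k ζ) x y‖ ≤ lgy := by
  refine (norm_fderiv_le_of_lip' ℝ hy (Filter.Eventually.of_forall fun y' => ?_))
  have := h.lip_grad2 k ζ x y' x y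
  simpa [Real.sqrt_sq (norm_nonneg _)] using this

end Problem

/-! ### Measurability of the stochastic gradients -/

lemma measurable_of_inner {S : Type*} [MeasurableSpace S] {n : ℕ} {Y : S → Vec n}
    (h : ∀ v, Measurable fun s => ⟪Y s, v⟫) : Measurable Y := by
  have h1 : Measurable fun s => (WithLp.ofLp (Y s) : Fin n → ℝ) := by
    refine measurable_pi_iff.2 fun i => ?_
    have := h (EuclideanSpace.single i 1)
    simpa [EuclideanSpace.inner_single_right] using this
  exact (WithLp.measurable_toLp 2 (Fin n → ℝ)).comp h1

lemma measurable_fderiv_apply_param {S V : Type*} [MeasurableSpace S] {n : ℕ}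
    [NormedAddCommGroup V] [NormedSpace ℝ V] [MeasurableSpace V] [BorelSpace V]
    [SecondCountableTopology V] {φ : S → Vec n → V} (hm : ∀ x, Measurable fun s => φ s x)
    {x : Vec n} (hd : ∀ s, DifferentiableAt ℝ (φ s) x) (v : Vec n) :
    Measurable fun s => fderiv ℝ (φ s) x v := by
  refine measurable_of_tendsto_metrizable
    (f := fun (m : ℕ) s => (m : ℝ) • (φ s (x + (m : ℝ)⁻¹ • v) - φ s x))
    (fun m => ((hm _).sub (hm _)).const_smul (m : ℝ)) ?_
  rw [tendsto_pi_nhds]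
  exact fun s => ((hd s).hasFDerivAt.lim_real v).comp tendsto_natCast_atTop_atTop

lemma measurable_gradient_param {S : Type*} [MeasurableSpace S] {n : ℕ} {φ : S → Vec n → ℝ}
    (hm : ∀ x, Measurable fun s => φ s x) {x : Vec n} (hd : ∀ s, DifferentiableAt ℝ (φ s) x) :
    Measurable fun s => gradient (φ s) x :=
  measurable_of_inner fun v => by
    simp only [inner_gradient_apply]
    exact measurable_fderiv_apply_param hm hd v

/-- A Carathéodory function, continuous in the parameter and measurable in the sample. -/
lemma measurable_uncurry_of_continuous {P S V : Type*} [TopologicalSpace P]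
    [TopologicalSpace.MetrizableSpace P]
    [SecondCountableTopology P] [MeasurableSpace P] [OpensMeasurableSpace P] [MeasurableSpace S]
    [NormedAddCommGroup V] [MeasurableSpace V] [BorelSpace V] {O : P → S → V}
    (hc : ∀ s, Continuous fun w => O w s) (hm : ∀ w, Measurable (O w)) :
    Measurable (Function.uncurry O) :=
  measurable_uncurry_of_continuous_of_measurable hc hm

lemma JointLipschitz.continuous {dx dy : ℕ} {V : Type*} [NormedAddCommGroup V] {L : ℝ}
    {Φ : Vec dx → Vec dy → V} (h : JointLipschitz L Φ) :
    Continuous fun p : Vec dx × Vec dy => Φ p.1 p.2 := by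
  rw [continuous_iff_continuousAt]
  intro p
  rw [ContinuousAt, tendsto_iff_norm_sub_tendsto_zero]
  have h0 : Filter.Tendsto
      (fun q : Vec dx × Vec dy => L * √(‖q.1 - p.1‖ ^ 2 + ‖q.2 - p.2‖ ^ 2)) (nhds p) (nhds 0) := by
    have : Continuous (fun q : Vec dx × Vec dy => L * √(‖q.1 - p.1‖ ^ 2 + ‖q.2 - p.2‖ ^ 2)) := by
      fun_prop
    simpa using this.tendsto p
  exact squeeze_zero (fun _ => norm_nonneg _) (fun q => h q.1 q.2 p.1 p.2) h0

lemma memLp_two_of_lintegral_le {S V : Type*} [MeasurableSpace S] {m : Measure S}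
    [NormedAddCommGroup V] {Y : S → V} (hY : AEStronglyMeasurable Y m) {c : ℝ}
    (h : ∫⁻ s, ‖Y s‖ₑ ^ 2 ∂m ≤ ENNReal.ofReal c) : MemLp Y 2 m := by
  refine ⟨hY, ?_⟩
  rw [eLpNorm_lt_top_iff_lintegral_rpow_enorm_lt_top (by norm_num) (by norm_num)]
  refine lt_of_le_of_lt ?_ (lt_of_le_of_lt h ENNReal.ofReal_lt_top)
  simp

lemma integral_sq_le_of_lintegral_le {S V : Type*} [MeasurableSpace S] {m : Measure S}
    [NormedAddCommGroup V] {Y : S → V} (hY : AEStronglyMeasurable Y m) {c : ℝ} (hc : 0 ≤ c)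
    (h : ∫⁻ s, ‖Y s‖ₑ ^ 2 ∂m ≤ ENNReal.ofReal c) : ∫ s, ‖Y s‖ ^ 2 ∂m ≤ c := by
  rw [integral_eq_lintegral_of_nonneg_ae (f := fun s => ‖Y s‖ ^ 2)
    (Filter.Eventually.of_forall fun s => by positivity) (hY.norm.pow 2)]
  refine ENNReal.toReal_le_of_le_ofReal hc (le_trans (le_of_eq ?_) h)
  refine lintegral_congr fun s => ?_
  rw [ENNReal.ofReal_pow (norm_nonneg _), ofReal_norm]

/-- The mean of a quantity that stays within `M` of `c` is within `M` of `c`. -/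
lemma abs_integral_sub_le {S : Type*} [MeasurableSpace S] {m : Measure S} [IsProbabilityMeasure m]
    {φ : S → ℝ} {M : ℝ} (h : ∀ s, |φ s| ≤ M) : |∫ s, φ s ∂m| ≤ M := by
  have := norm_integral_le_of_norm_le_const (μ := m) (f := φ) (C := M)
    (Filter.Eventually.of_forall h)
  simpa using this

/-- A quadratic error bound determines the gradient. -/
lemma hasGradientAt_of_quadratic {n : ℕ} {φ : Vec n → ℝ} {x g : Vec n} {C : ℝ}
    (h : ∀ x', |φ x' - φ x - ⟪g, x' - x⟫| ≤ C * ‖x' - x‖ ^ 2) : HasGradientAt φ g x := by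
  rw [hasGradientAt_iff_isLittleO]
  have h1 : (fun x' => φ x' - φ x - ⟪g, x' - x⟫) =O[nhds x] fun x' => ‖x' - x‖ ^ 2 := by
    refine Asymptotics.IsBigO.of_bound C (Filter.Eventually.of_forall fun x' => ?_)
    simpa using h x'
  refine h1.trans_isLittleO ?_
  have h2 : (fun v : Vec n => ‖v‖ ^ 2) =o[nhds 0] fun v => v :=
    Asymptotics.isLittleO_norm_pow_id one_lt_two
  have h3 : Filter.Tendsto (fun x' => x' - x) (nhds x) (nhds 0) := by
    have : Continuous fun x' : Vec n => x' - x := by fun_prop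
    simpa using this.tendsto x
  exact h2.comp_tendsto h3

namespace Problem

variable {K dx dy : ℕ} {Sf Sg : Type*} [MeasurableSpace Sf] [MeasurableSpace Sg]
  {D : Problem K dx dy Sf Sg}

section Measurability

variable {lfx lfy cfy μ lgy lgxy lgyy cgxy : ℝ}

lemma WellPosed.measurable_grad1 (hD : D.WellPosed) (h : D.UpperSmooth lfx lfy cfy) (k : Fin K)
    (x : Vec dx) (y : Vec dy) : Measurable fun ξ => grad1 (D.fAt k ξ) x y :=
  measurable_gradient_param (φ := fun ξ x' => D.fAt k ξ x' y) (fun x' => hD.meas_f k x' y)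
    (fun ξ => ((h.contDiff k ξ).differentiable (by norm_num) (x, y)).comp
      (f := fun x' => (x', y)) x (by fun_prop))

lemma WellPosed.measurable_grad2_f (hD : D.WellPosed) (h : D.UpperSmooth lfx lfy cfy) (k : Fin K)
    (x : Vec dx) (y : Vec dy) : Measurable fun ξ => grad2 (D.fAt k ξ) x y :=
  measurable_gradient_param (φ := fun ξ y' => D.fAt k ξ x y') (fun y' => hD.meas_f k x y')
    (fun ξ => ((h.contDiff k ξ).differentiable (by norm_num) (x, y)).comp
      (f := fun y' => (x, y')) y (by fun_prop))

lemma WellPosed.measurable_grad2_g (hD : D.WellPosed) (h : D.LowerSmooth μ lgy lgxy lgyy cgxy)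
    (k : Fin K) (x : Vec dx) (y : Vec dy) : Measurable fun ζ => grad2 (D.gAt k ζ) x y :=
  measurable_gradient_param (φ := fun ζ y' => D.gAt k ζ x y') (fun y' => hD.meas_g k x y')
    (fun ζ => h.differentiable k ζ x y)

lemma WellPosed.measurable_hess22 (hD : D.WellPosed) (h : D.LowerSmooth μ lgy lgxy lgyy cgxy)
    (k : Fin K) (x : Vec dx) (y z : Vec dy) : Measurable fun ζ => hess22 (D.gAt k ζ) x y z :=
  measurable_fderiv_apply_param (φ := fun ζ y' => grad2 (D.gAt k ζ) x y')
    (fun y' => hD.measurable_grad2_g h k x y')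
    (fun ζ => h.differentiable_grad2_right k ζ x y) z

lemma WellPosed.measurable_jac12 (hD : D.WellPosed) (h : D.LowerSmooth μ lgy lgxy lgyy cgxy)
    (k : Fin K) (x : Vec dx) (y z : Vec dy) : Measurable fun ζ => jac12 (D.gAt k ζ) x y z :=
  measurable_of_inner fun u => by
    simp only [inner_jac12]
    exact measurable_const.inner (measurable_fderiv_apply_param
      (φ := fun ζ x' => grad2 (D.gAt k ζ) x' y) (fun x' => hD.measurable_grad2_g h k x' y)
      (fun ζ => h.differentiable_grad2_left k ζ y x) u)

end Measurability

/-! ### Expected gradients -/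

/-- `E_ξ ∇₁ f^{(k)}(x, y; ξ)`. -/
def meanGrad1 (D : Problem K dx dy Sf Sg) (k : Fin K) (x : Vec dx) (y : Vec dy) : Vec dx :=
  ∫ ξ, grad1 (D.fAt k ξ) x y ∂(D.Df k)

/-- `E_ξ ∇₂ f^{(k)}(x, y; ξ)`. -/
def meanGrad2 (D : Problem K dx dy Sf Sg) (k : Fin K) (x : Vec dx) (y : Vec dy) : Vec dy :=
  ∫ ξ, grad2 (D.fAt k ξ) x y ∂(D.Df k)

/-- `E_ζ ∇₂ g^{(k)}(x, y; ζ)`. -/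
def meanGradG (D : Problem K dx dy Sf Sg) (k : Fin K) (x : Vec dx) (y : Vec dy) : Vec dy :=
  ∫ ζ, grad2 (D.gAt k ζ) x y ∂(D.Dg k)

/-- `E_ζ ∇²₁₂ g^{(k)}(x, y; ζ) z`. -/
def meanJac (D : Problem K dx dy Sf Sg) (k : Fin K) (x : Vec dx) (y z : Vec dy) : Vec dx :=
  ∫ ζ, jac12 (D.gAt k ζ) x y z ∂(D.Dg k)

/-- `E_ζ ∇²₂₂ g^{(k)}(x, y; ζ) z`. -/
def meanHess (D : Problem K dx dy Sf Sg) (k : Fin K) (x : Vec dx) (y z : Vec dy) : Vec dy :=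
  ∫ ζ, hess22 (D.gAt k ζ) x y z ∂(D.Dg k)

/-- All standing assumptions on the problem. -/
structure Regular (D : Problem K dx dy Sf Sg)
    (μ lfx lfy cfy lgy lgxy lgyy cgxy σ : ℝ) : Prop where
  well : D.WellPosed
  strong : D.LowerStronglyConvex μ
  upper : D.UpperSmooth lfx lfy cfy
  lower : D.LowerSmooth μ lgy lgxy lgyy cgxy
  var : D.BoundedVariance σ
  μ_pos : 0 < μ
  lfx_pos : 0 < lfx
  lfy_pos : 0 < lfy
  cfy_pos : 0 < cfy
  lgy_pos : 0 < lgy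
  lgxy_pos : 0 < lgxy
  lgyy_pos : 0 < lgyy
  cgxy_pos : 0 < cgxy

namespace Regular

variable {μ lfx lfy cfy lgy lgxy lgyy cgxy σ : ℝ}
  (h : D.Regular μ lfx lfy cfy lgy lgxy lgyy cgxy σ)
include h

lemma integrable_grad1 (k : Fin K) (x : Vec dx) (y : Vec dy) :
    Integrable (fun ξ => grad1 (D.fAt k ξ) x y) (D.Df k) := by
  have := h.well.prob_f k
  have hm := h.well.measurable_grad1 h.upper k x y
  have h1 := memLp_two_of_lintegral_le
    (hm.sub measurable_const).aestronglyMeasurable (h.var.var_grad1_f k x y)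
  have h2 := (h1.integrable (by norm_num)).add (integrable_const (grad1 (D.fFull k) x y))
  refine h2.congr (Filter.Eventually.of_forall fun ξ => ?_)
  simp

lemma integrable_grad2_f (k : Fin K) (x : Vec dx) (y : Vec dy) :
    Integrable (fun ξ => grad2 (D.fAt k ξ) x y) (D.Df k) := by
  have := h.well.prob_f k
  exact Integrable.of_bound (h.well.measurable_grad2_f h.upper k x y).aestronglyMeasurable cfy
    (Filter.Eventually.of_forall fun ξ => h.upper.bound_grad2 k ξ x y)

lemma integrable_grad2_g (k : Fin K) (x : Vec dx) (y : Vec dy) :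
    Integrable (fun ζ => grad2 (D.gAt k ζ) x y) (D.Dg k) := by
  have := h.well.prob_g k
  have hm := h.well.measurable_grad2_g h.lower k x y
  have h1 := memLp_two_of_lintegral_le
    (hm.sub measurable_const).aestronglyMeasurable (h.var.var_grad2_g k x y)
  have h2 := (h1.integrable (by norm_num)).add (integrable_const (grad2 (D.gFull k) x y))
  refine h2.congr (Filter.Eventually.of_forall fun ξ => ?_)
  simp

lemma norm_jac_le (k : Fin K) (ζ : Sg) (x : Vec dx) (y z : Vec dy) :
    ‖jac12 (D.gAt k ζ) x y z‖ ≤ cgxy * ‖z‖ :=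
  (ContinuousLinearMap.le_opNorm _ _).trans (by gcongr; exact h.lower.bound_jac12 k ζ x y)

lemma norm_hess_le (k : Fin K) (ζ : Sg) (x : Vec dx) (y z : Vec dy) :
    ‖hess22 (D.gAt k ζ) x y z‖ ≤ lgy * ‖z‖ :=
  (ContinuousLinearMap.le_opNorm _ _).trans
    (by gcongr; exact h.lower.norm_hess22_le h.lgy_pos.le k ζ x y)

lemma integrable_jac12 (k : Fin K) (x : Vec dx) (y z : Vec dy) :
    Integrable (fun ζ => jac12 (D.gAt k ζ) x y z) (D.Dg k) := by
  have := h.well.prob_g k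
  exact Integrable.of_bound (h.well.measurable_jac12 h.lower k x y z).aestronglyMeasurable _
    (Filter.Eventually.of_forall fun ζ => h.norm_jac_le k ζ x y z)

lemma integrable_hess22 (k : Fin K) (x : Vec dx) (y z : Vec dy) :
    Integrable (fun ζ => hess22 (D.gAt k ζ) x y z) (D.Dg k) := by
  have := h.well.prob_g k
  exact Integrable.of_bound (h.well.measurable_hess22 h.lower k x y z).aestronglyMeasurable _
    (Filter.Eventually.of_forall fun ζ => h.norm_hess_le k ζ x y z)

lemma inner_meanGrad1 (k : Fin K) (x v : Vec dx) (y : Vec dy) :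
    ⟪D.meanGrad1 k x y, v⟫ = ∫ ξ, ⟪grad1 (D.fAt k ξ) x y, v⟫ ∂(D.Df k) := by
  rw [real_inner_comm, meanGrad1, ← integral_inner (h.integrable_grad1 k x y)]
  simp only [real_inner_comm]

lemma inner_meanGrad2 (k : Fin K) (x : Vec dx) (y v : Vec dy) :
    ⟪D.meanGrad2 k x y, v⟫ = ∫ ξ, ⟪grad2 (D.fAt k ξ) x y, v⟫ ∂(D.Df k) := by
  rw [real_inner_comm, meanGrad2, ← integral_inner (h.integrable_grad2_f k x y)]
  simp only [real_inner_comm]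

lemma inner_meanGradG (k : Fin K) (x : Vec dx) (y v : Vec dy) :
    ⟪D.meanGradG k x y, v⟫ = ∫ ζ, ⟪grad2 (D.gAt k ζ) x y, v⟫ ∂(D.Dg k) := by
  rw [real_inner_comm, meanGradG, ← integral_inner (h.integrable_grad2_g k x y)]
  simp only [real_inner_comm]

lemma inner_meanJac (k : Fin K) (x v : Vec dx) (y z : Vec dy) :
    ⟪D.meanJac k x y z, v⟫ = ∫ ζ, ⟪jac12 (D.gAt k ζ) x y z, v⟫ ∂(D.Dg k) := by
  rw [real_inner_comm, meanJac, ← integral_inner (h.integrable_jac12 k x y z)]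
  simp only [real_inner_comm]

lemma inner_meanHess (k : Fin K) (x : Vec dx) (y z v : Vec dy) :
    ⟪D.meanHess k x y z, v⟫ = ∫ ζ, ⟪hess22 (D.gAt k ζ) x y z, v⟫ ∂(D.Dg k) := by
  rw [real_inner_comm, meanHess, ← integral_inner (h.integrable_hess22 k x y z)]
  simp only [real_inner_comm]

lemma taylor_fFull (k : Fin K) (x x' : Vec dx) (y y' : Vec dy) :
    |D.fFull k x' y' - D.fFull k x y
        - (⟪D.meanGrad1 k x y, x' - x⟫ + ⟪D.meanGrad2 k x y, y' - y⟫)|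
      ≤ (lfx + lfy) * (‖x' - x‖ ^ 2 + ‖y' - y‖ ^ 2) := by
  have := h.well.prob_f k
  have h1 := abs_integral_sub_le (m := D.Df k)
    (fun ξ => h.upper.taylor h.lfx_pos.le h.lfy_pos.le k ξ x x' y y')
  have i1 := h.well.int_f k x' y'
  have i2 := h.well.int_f k x y
  have i3 := (h.integrable_grad1 k x y).inner_const (𝕜 := ℝ) (x' - x)
  have i4 := (h.integrable_grad2_f k x y).inner_const (𝕜 := ℝ) (y' - y)
  have i12 : Integrable (fun ξ => D.fAt k ξ x' y' - D.fAt k ξ x y) (D.Df k) := i1.sub i2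
  have i34 : Integrable (fun ξ => ⟪grad1 (D.fAt k ξ) x y, x' - x⟫
      + ⟪grad2 (D.fAt k ξ) x y, y' - y⟫) (D.Df k) := i3.add i4
  rw [integral_sub i12 i34, integral_add i3 i4,
    integral_sub (f := fun ξ => D.fAt k ξ x' y') (g := fun ξ => D.fAt k ξ x y) i1 i2,
    ← h.inner_meanGrad1, ← h.inner_meanGrad2] at h1
  exact h1

lemma taylor_gFull (k : Fin K) (x : Vec dx) (y y' : Vec dy) :
    |D.gFull k x y' - D.gFull k x y - ⟪D.meanGradG k x y, y' - y⟫| ≤ lgy * ‖y' - y‖ ^ 2 := by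
  have := h.well.prob_g k
  have h1 := abs_integral_sub_le (m := D.Dg k)
    (fun ζ => h.lower.taylor h.lgy_pos.le k ζ x y y')
  have i1 := h.well.int_g k x y'
  have i2 := h.well.int_g k x y
  have i3 := (h.integrable_grad2_g k x y).inner_const (𝕜 := ℝ) (y' - y)
  have i12 : Integrable (fun ξ => D.gAt k ξ x y' - D.gAt k ξ x y) (D.Dg k) := i1.sub i2
  rw [integral_sub i12 i3, integral_sub (f := fun ξ => D.gAt k ξ x y')
    (g := fun ξ => D.gAt k ξ x y) i1 i2,
    ← h.inner_meanGradG] at h1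
  exact h1

lemma taylor_meanGradG (k : Fin K) (x x' : Vec dx) (y y' z : Vec dy) :
    |⟪D.meanGradG k x' y', z⟫ - ⟪D.meanGradG k x y, z⟫
        - (⟪D.meanJac k x y z, x' - x⟫ + ⟪D.meanHess k x y z, y' - y⟫)|
      ≤ ‖z‖ * (lgxy + lgyy) * (‖x' - x‖ ^ 2 + ‖y' - y‖ ^ 2) := by
  have := h.well.prob_g k
  have h1 := abs_integral_sub_le (m := D.Dg k)
    (fun ζ => h.lower.taylor_grad2 h.lgxy_pos.le h.lgyy_pos.le k ζ x x' y y' z)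
  simp only [real_inner_comm _ z] at h1
  have i1 := (h.integrable_grad2_g k x' y').inner_const (𝕜 := ℝ) z
  have i2 := (h.integrable_grad2_g k x y).inner_const (𝕜 := ℝ) z
  have i3 := (h.integrable_jac12 k x y z).inner_const (𝕜 := ℝ) (x' - x)
  have i4 := (h.integrable_hess22 k x y z).inner_const (𝕜 := ℝ) (y' - y)
  have i12 : Integrable (fun ζ => ⟪grad2 (D.gAt k ζ) x' y', z⟫
      - ⟪grad2 (D.gAt k ζ) x y, z⟫) (D.Dg k) := i1.sub i2
  have i34 : Integrable (fun ζ => ⟪jac12 (D.gAt k ζ) x y z, x' - x⟫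
      + ⟪hess22 (D.gAt k ζ) x y z, y' - y⟫) (D.Dg k) := i3.add i4
  rw [integral_sub i12 i34, integral_add i3 i4, integral_sub i1 i2,
    ← h.inner_meanGradG, ← h.inner_meanGradG, ← h.inner_meanJac, ← h.inner_meanHess] at h1
  exact h1

lemma grad1_fFull (k : Fin K) (x : Vec dx) (y : Vec dy) :
    grad1 (D.fFull k) x y = D.meanGrad1 k x y :=
  (hasGradientAt_of_quadratic (φ := fun x' => D.fFull k x' y) (C := lfx + lfy) fun x' => by
    simpa using h.taylor_fFull k x x' y y).gradient

lemma grad2_fFull (k : Fin K) (x : Vec dx) (y : Vec dy) :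
    grad2 (D.fFull k) x y = D.meanGrad2 k x y :=
  (hasGradientAt_of_quadratic (φ := fun y' => D.fFull k x y') (C := lfx + lfy) fun y' => by
    simpa using h.taylor_fFull k x x y y').gradient

lemma grad2_gFull (k : Fin K) (x : Vec dx) (y : Vec dy) :
    grad2 (D.gFull k) x y = D.meanGradG k x y :=
  (hasGradientAt_of_quadratic (φ := fun y' => D.gFull k x y') fun y' =>
    h.taylor_gFull k x y y').gradient

lemma meanGradG_strong_mono (k : Fin K) (x : Vec dx) (y y' : Vec dy) :
    μ * ‖y' - y‖ ^ 2 ≤ ⟪D.meanGradG k x y' - D.meanGradG k x y, y' - y⟫ := by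
  have := h.well.prob_g k
  rw [inner_sub_left, h.inner_meanGradG, h.inner_meanGradG, ← integral_sub
    ((h.integrable_grad2_g k x y').inner_const (𝕜 := ℝ) _)
    ((h.integrable_grad2_g k x y).inner_const (𝕜 := ℝ) _)]
  have h1 : ∫ _ζ : Sg, μ * ‖y' - y‖ ^ 2 ∂(D.Dg k) = μ * ‖y' - y‖ ^ 2 := by simp
  rw [← h1]
  refine integral_mono (integrable_const _) (((h.integrable_grad2_g k x y').inner_const _).sub
    ((h.integrable_grad2_g k x y).inner_const _)) fun ζ => ?_
  simp only [← inner_sub_left]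
  exact h.lower.strong_mono k ζ x y y'

lemma meanHess_coercive (k : Fin K) (x : Vec dx) (y z : Vec dy) :
    μ * ‖z‖ ^ 2 ≤ ⟪D.meanHess k x y z, z⟫ := by
  have := h.well.prob_g k
  rw [h.inner_meanHess]
  have h1 : ∫ _ζ : Sg, μ * ‖z‖ ^ 2 ∂(D.Dg k) = μ * ‖z‖ ^ 2 := by simp
  rw [← h1]
  refine integral_mono (integrable_const _) ((h.integrable_hess22 k x y z).inner_const _)
    fun ζ => ?_
  show _ ≤ ⟪_, _⟫
  rw [real_inner_comm]
  exact h.lower.hess22_lower k ζ x y z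

lemma meanHess_sub (k : Fin K) (x : Vec dx) (y z z' : Vec dy) :
    D.meanHess k x y (z - z') = D.meanHess k x y z - D.meanHess k x y z' := by
  unfold meanHess
  rw [← integral_sub (h.integrable_hess22 k x y z) (h.integrable_hess22 k x y z')]
  simp only [map_sub]

lemma norm_meanGrad2_le (k : Fin K) (x : Vec dx) (y : Vec dy) : ‖D.meanGrad2 k x y‖ ≤ cfy := by
  have := h.well.prob_f k
  simpa [meanGrad2] using norm_integral_le_of_norm_le_const (μ := D.Df k) (Filter.Eventually.of_forall
    fun ξ => h.upper.bound_grad2 k ξ x y)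

lemma norm_meanJac_le (k : Fin K) (x : Vec dx) (y z : Vec dy) :
    ‖D.meanJac k x y z‖ ≤ cgxy * ‖z‖ := by
  have := h.well.prob_g k
  simpa [meanJac] using norm_integral_le_of_norm_le_const (μ := D.Dg k) (Filter.Eventually.of_forall
    fun ζ => h.norm_jac_le k ζ x y z)

lemma norm_meanHess_le (k : Fin K) (x : Vec dx) (y z : Vec dy) :
    ‖D.meanHess k x y z‖ ≤ lgy * ‖z‖ := by
  have := h.well.prob_g k
  simpa [meanHess] using norm_integral_le_of_norm_le_const (μ := D.Dg k) (Filter.Eventually.of_forall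
    fun ζ => h.norm_hess_le k ζ x y z)

end Regular

end Problem

/-! ### Stochastic oracles and their means -/

/-- A point `(x, y, z)` at which a worker queries its oracles. -/
abbrev Pt (dx dy : ℕ) : Type := Vec dx × Vec dy × Vec dy

/-- Squared Euclidean distance of two query points (the norm of the product type is the
supremum norm). -/
def dsq {dx dy : ℕ} (w w' : Pt dx dy) : ℝ :=
  ‖w.1 - w'.1‖ ^ 2 + ‖w.2.1 - w'.2.1‖ ^ 2 + ‖w.2.2 - w'.2.2‖ ^ 2

lemma dsq_nonneg {dx dy : ℕ} (w w' : Pt dx dy) : 0 ≤ dsq w w' := by unfold dsq; positivity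

lemma sqrt_xy_le_dsq {dx dy : ℕ} (w w' : Pt dx dy) :
    √(‖w.1 - w'.1‖ ^ 2 + ‖w.2.1 - w'.2.1‖ ^ 2) ≤ √(dsq w w') :=
  Real.sqrt_le_sqrt (by unfold dsq; linarith [sq_nonneg ‖w.2.2 - w'.2.2‖])

lemma norm_z_le_dsq {dx dy : ℕ} (w w' : Pt dx dy) : ‖w.2.2 - w'.2.2‖ ≤ √(dsq w w') :=
  Real.le_sqrt_of_sq_le (by
    unfold dsq; linarith [sq_nonneg ‖w.1 - w'.1‖, sq_nonneg ‖w.2.1 - w'.2.1‖])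

/-- A stochastic oracle `O` with mean `M` on the points `(x, y, z)` with `‖z‖ ≤ r`: it is
`L`-Lipschitz for every sample and has variance at most `v²`. Only the marginal laws of the sample
`(ξ, ζ)` are prescribed, so mean and variance are required for every coupling `Q` of them. -/
structure IsOracle {K dx dy n : ℕ} {Sf Sg : Type*} [MeasurableSpace Sf] [MeasurableSpace Sg]
    (D : Problem K dx dy Sf Sg) (L r v : ℝ) (O : Fin K → Pt dx dy → Sf × Sg → Vec n)
    (M : Fin K → Pt dx dy → Vec n) : Prop where
  meas : ∀ k, Measurable (Function.uncurry (O k))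
  lip : ∀ k q w w', ‖w.2.2‖ ≤ r → ‖w'.2.2‖ ≤ r → ‖O k w q - O k w' q‖ ≤ L * √(dsq w w')
  int : ∀ k w (Q : Measure (Sf × Sg)), Q.map Prod.fst = D.Df k → Q.map Prod.snd = D.Dg k →
    Integrable (O k w) Q
  mean : ∀ k w (Q : Measure (Sf × Sg)), Q.map Prod.fst = D.Df k → Q.map Prod.snd = D.Dg k →
    ∫ q, O k w q ∂Q = M k w
  var : ∀ k w (Q : Measure (Sf × Sg)), Q.map Prod.fst = D.Df k → Q.map Prod.snd = D.Dg k →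
    ‖w.2.2‖ ≤ r → MemLp (fun q => O k w q - M k w) 2 Q ∧ ∫ q, ‖O k w q - M k w‖ ^ 2 ∂Q ≤ v ^ 2

namespace IsOracle

variable {K dx dy n : ℕ} {Sf Sg : Type*} [MeasurableSpace Sf] [MeasurableSpace Sg]
  {D : Problem K dx dy Sf Sg} {L r v : ℝ} {O : Fin K → Pt dx dy → Sf × Sg → Vec n}
  {M : Fin K → Pt dx dy → Vec n}

lemma measurable_mean (h : IsOracle D L r v O M) (hD : D.WellPosed) (k : Fin K) :
    Measurable (M k) := by
  have := hD.prob_f k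
  have := hD.prob_g k
  have h1 : M k = fun w => ∫ q, O k w q ∂((D.Df k).prod (D.Dg k)) := by
    ext1 w
    rw [h.mean k w _ (by simp) (by simp)]
  rw [h1]
  exact ((h.meas k).stronglyMeasurable.integral_prod_right).measurable

lemma mean_lip (h : IsOracle D L r v O M) (hD : D.WellPosed) (k : Fin K) (w w' : Pt dx dy)
    (hw : ‖w.2.2‖ ≤ r) (hw' : ‖w'.2.2‖ ≤ r) : ‖M k w - M k w'‖ ≤ L * √(dsq w w') := by
  have := hD.prob_f k
  have := hD.prob_g k
  set Q := (D.Df k).prod (D.Dg k)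
  have hf : Q.map Prod.fst = D.Df k := by simp [Q]
  have hg : Q.map Prod.snd = D.Dg k := by simp [Q]
  rw [← h.mean k w Q hf hg, ← h.mean k w' Q hf hg,
    ← integral_sub (h.int k w Q hf hg) (h.int k w' Q hf hg)]
  simpa using norm_integral_le_of_norm_le_const (μ := Q)
    (Filter.Eventually.of_forall fun q => h.lip k q w w' hw hw')

end IsOracle

/-- A strongly monotone Lipschitz map has a zero: `a ↦ a - β Ψ(a)` is a contraction for a suitable
`β > 0`. -/
lemma exists_zero_of_strongly_monotone {n : ℕ} {Ψ : Vec n → Vec n} {μ L : ℝ} (hμ : 0 < μ)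
    (hL : 0 < L) (hlip : ∀ a b, ‖Ψ a - Ψ b‖ ≤ L * ‖a - b‖)
    (hmono : ∀ a b, μ * ‖a - b‖ ^ 2 ≤ ⟪Ψ a - Ψ b, a - b⟫) : ∃ a, Ψ a = 0 := by
  set β := μ / L ^ 2 with hβ
  have hβ0 : 0 < β := by positivity
  set q : ℝ := 1 - μ ^ 2 / L ^ 2 with hq
  have hq1 : √q < 1 := by
    rw [Real.sqrt_lt' one_pos]
    have : 0 < μ ^ 2 / L ^ 2 := by positivity
    linarith
  have hc : ContractingWith (√q).toNNReal (fun a => a - β • Ψ a) := by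
    have hs : ((√q).toNNReal : ℝ) = √q := Real.coe_toNNReal _ (Real.sqrt_nonneg q)
    refine ⟨by rw [← NNReal.coe_lt_coe, hs]; exact hq1, LipschitzWith.of_dist_le_mul fun a b => ?_⟩
    rw [dist_eq_norm, dist_eq_norm, hs]
    rw [← Real.sqrt_sq (norm_nonneg (a - b)), ← Real.sqrt_mul' _ (sq_nonneg _)]
    apply Real.le_sqrt_of_sq_le
    have e : a - β • Ψ a - (b - β • Ψ b) = (a - b) - β • (Ψ a - Ψ b) := by module
    rw [e, norm_sub_sq_real, inner_smul_right, norm_smul, Real.norm_of_nonneg hβ0.le]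
    have h1 := hmono a b
    rw [real_inner_comm] at h1
    have h2 : (β * ‖Ψ a - Ψ b‖) ^ 2 ≤ (β * (L * ‖a - b‖)) ^ 2 := by gcongr; exact hlip a b
    have h3 : (β * (L * ‖a - b‖)) ^ 2 = μ ^ 2 / L ^ 2 * ‖a - b‖ ^ 2 := by rw [hβ]; field_simp
    have h4 : β * (μ * ‖a - b‖ ^ 2) = μ ^ 2 / L ^ 2 * ‖a - b‖ ^ 2 := by rw [hβ]; field_simp
    have h5 := mul_le_mul_of_nonneg_left h1 hβ0.le
    rw [hq]
    nlinarith
  obtain ⟨a, ha, -⟩ := hc.exists_fixedPoint 0 (edist_ne_top _ _)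
  refine ⟨a, ?_⟩
  have h1 : a - β • Ψ a = a := ha
  have h2 : β • Ψ a = 0 := by simpa using h1
  exact (smul_eq_zero.1 h2).resolve_left hβ0.ne'

/-- Zeros of strongly monotone maps depend on the map in a Lipschitz way. -/
lemma norm_le_of_strongly_monotone {n : ℕ} {μ c : ℝ} (hμ : 0 < μ) {d e : Vec n}
    (h1 : μ * ‖d‖ ^ 2 ≤ ⟪e, d⟫) (h2 : ‖e‖ ≤ c) : ‖d‖ ≤ c / μ := by
  rw [le_div_iff₀ hμ]
  have h3 := real_inner_le_norm e d
  by_contra hlt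
  push Not at hlt
  have h4 : 0 < ‖d‖ := by
    by_contra h5
    have : ‖d‖ = 0 := le_antisymm (not_lt.1 h5) (norm_nonneg d)
    rw [this, zero_mul] at hlt
    linarith [norm_nonneg e]
  nlinarith [mul_lt_mul_of_pos_left hlt h4, mul_le_mul_of_nonneg_right h2 h4.le]

lemma abs_avg_le {K : ℕ} (hK : 1 ≤ K) {a : Fin K → ℝ} {c : ℝ} (h : ∀ k, |a k| ≤ c) :
    |(1 / (K : ℝ)) * ∑ k, a k| ≤ c := by
  rw [abs_le]
  refine ⟨?_, avg_le hK fun k => (abs_le.1 (h k)).2⟩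
  have := avg_le hK (a := fun k => - a k) (c := c) fun k => by linarith [(abs_le.1 (h k)).1]
  rw [sum_neg_distrib, mul_neg] at this
  linarith

namespace Problem

variable {K dx dy : ℕ} {Sf Sg : Type*} [MeasurableSpace Sf] [MeasurableSpace Sg]

section Coupling

variable {V : Type*} [NormedAddCommGroup V] {Q : Measure (Sf × Sg)} {mf : Measure Sf}
  {mg : Measure Sg}

lemma integrable_fst (hf : Q.map Prod.fst = mf) {φ : Sf → V} (hφ : Integrable φ mf) :
    Integrable (fun q : Sf × Sg => φ q.1) Q :=
  Integrable.comp_measurable (by rwa [hf]) measurable_fst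

lemma integrable_snd (hg : Q.map Prod.snd = mg) {φ : Sg → V} (hφ : Integrable φ mg) :
    Integrable (fun q : Sf × Sg => φ q.2) Q :=
  Integrable.comp_measurable (by rwa [hg]) measurable_snd

lemma integral_fst [NormedSpace ℝ V] (hf : Q.map Prod.fst = mf) {φ : Sf → V}
    (hφ : Integrable φ mf) : ∫ q, φ q.1 ∂Q = ∫ ξ, φ ξ ∂mf := by
  rw [← hf, integral_map measurable_fst.aemeasurable (by rw [hf]; exact hφ.aestronglyMeasurable)]

lemma integral_snd [NormedSpace ℝ V] (hg : Q.map Prod.snd = mg) {φ : Sg → V}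
    (hφ : Integrable φ mg) : ∫ q, φ q.2 ∂Q = ∫ ζ, φ ζ ∂mg := by
  rw [← hg, integral_map measurable_snd.aemeasurable (by rw [hg]; exact hφ.aestronglyMeasurable)]

lemma isProbabilityMeasure_of_map_fst [IsProbabilityMeasure mf] (hf : Q.map Prod.fst = mf) :
    IsProbabilityMeasure Q := by
  refine ⟨?_⟩
  have h1 : (Q.map Prod.fst) Set.univ = 1 := by rw [hf]; exact measure_univ
  rwa [Measure.map_apply measurable_fst MeasurableSet.univ, Set.preimage_univ] at h1

/-- Second moment of a quantity whose square is dominated by `2 A + c`. -/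
lemma memLp_of_sq_le [IsProbabilityMeasure Q] {Y : Sf × Sg → V} {A : Sf × Sg → ℝ} {s c v : ℝ}
    (hY : AEStronglyMeasurable Y Q) (hA : Integrable A Q) (hb : ∀ q, ‖Y q‖ ^ 2 ≤ 2 * A q + c)
    (hs : ∫ q, A q ∂Q ≤ s) (hv : 2 * s + c ≤ v) : MemLp Y 2 Q ∧ ∫ q, ‖Y q‖ ^ 2 ∂Q ≤ v := by
  have h1 : Integrable (fun q => 2 * A q + c) Q := (hA.const_mul 2).add (integrable_const c)
  have h2 : Integrable (fun q => ‖Y q‖ ^ 2) Q :=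
    h1.mono' (hY.norm.pow 2) (Filter.Eventually.of_forall fun q => by
      rw [Real.norm_of_nonneg (by positivity)]; exact hb q)
  refine ⟨(memLp_two_iff_integrable_sq_norm hY).2 h2, (integral_mono h2 h1 hb).trans ?_⟩
  rw [integral_add (hA.const_mul 2) (integrable_const c), integral_const_mul]
  simp
  linarith

end Coupling

/-- The oracle `Ĝ_F^{(k)}`. -/
def oracleF (D : Problem K dx dy Sf Sg) (k : Fin K) (w : Pt dx dy) (q : Sf × Sg) : Vec dx :=
  D.GF k w.1 w.2.1 w.2.2 q.1 q.2

/-- The oracle `∇₂ g^{(k)}`; it ignores the component `z` of the query point. -/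
def oracleG (D : Problem K dx dy Sf Sg) (k : Fin K) (w : Pt dx dy) (q : Sf × Sg) : Vec dy :=
  grad2 (D.gAt k q.2) w.1 w.2.1

/-- The oracle `Ĝ_h^{(k)}`. -/
def oracleH (D : Problem K dx dy Sf Sg) (k : Fin K) (w : Pt dx dy) (q : Sf × Sg) : Vec dy :=
  D.Gh k w.1 w.2.1 w.2.2 q.1 q.2

/-- The mean of `Ĝ_F^{(k)}`. -/
def meanF (D : Problem K dx dy Sf Sg) (k : Fin K) (w : Pt dx dy) : Vec dx :=
  D.meanGrad1 k w.1 w.2.1 - D.meanJac k w.1 w.2.1 w.2.2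

/-- The mean of `∇₂ g^{(k)}` over the samples. -/
def meanG (D : Problem K dx dy Sf Sg) (k : Fin K) (w : Pt dx dy) : Vec dy :=
  D.meanGradG k w.1 w.2.1

/-- The mean of `Ĝ_h^{(k)}`. -/
def meanH (D : Problem K dx dy Sf Sg) (k : Fin K) (w : Pt dx dy) : Vec dy :=
  D.meanHess k w.1 w.2.1 w.2.2 - D.meanGrad2 k w.1 w.2.1

/-- `z*(x)`, the solution of `∇²₂₂ g(x, y*(x)) z = ∇₂ f(x, y*(x))` for the averaged losses. -/
def zStar (D : Problem K dx dy Sf Sg) (x : Vec dx) : Vec dy :=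
  Classical.epsilon (fun z => DecBilevel.mean (fun k => D.meanH k (x, D.yStar x, z)) = 0)

/-- The hypergradient `∇₁ f - ∇²₁₂ g z*` at `(x, y*(x))`, for the averaged losses. -/
def hyperGrad (D : Problem K dx dy Sf Sg) (x : Vec dx) : Vec dx :=
  DecBilevel.mean (fun k => D.meanF k (x, D.yStar x, D.zStar x))

namespace Regular

variable {D : Problem K dx dy Sf Sg} {μ lfx lfy cfy lgy lgxy lgyy cgxy σ : ℝ}
  (h : D.Regular μ lfx lfy cfy lgy lgxy lgyy cgxy σ)
include h

lemma radius_nonneg : 0 ≤ cfy / μ := (div_pos h.cfy_pos h.μ_pos).le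

lemma sq_dev_grad1 (k : Fin K) (x : Vec dx) (y : Vec dy) :
    Integrable (fun ξ => ‖grad1 (D.fAt k ξ) x y - D.meanGrad1 k x y‖ ^ 2) (D.Df k) ∧
      ∫ ξ, ‖grad1 (D.fAt k ξ) x y - D.meanGrad1 k x y‖ ^ 2 ∂(D.Df k) ≤ σ ^ 2 := by
  have hm := ((h.well.measurable_grad1 h.upper k x y).sub
    (measurable_const (a := D.meanGrad1 k x y))).aestronglyMeasurable (μ := D.Df k)
  have h1 := h.var.var_grad1_f k x y
  rw [h.grad1_fFull] at h1
  exact ⟨(memLp_two_iff_integrable_sq_norm hm).1 (memLp_two_of_lintegral_le hm h1),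
    integral_sq_le_of_lintegral_le hm (sq_nonneg σ) h1⟩

lemma sq_dev_grad2_f (k : Fin K) (x : Vec dx) (y : Vec dy) :
    Integrable (fun ξ => ‖grad2 (D.fAt k ξ) x y - D.meanGrad2 k x y‖ ^ 2) (D.Df k) ∧
      ∫ ξ, ‖grad2 (D.fAt k ξ) x y - D.meanGrad2 k x y‖ ^ 2 ∂(D.Df k) ≤ σ ^ 2 := by
  have hm := ((h.well.measurable_grad2_f h.upper k x y).sub
    (measurable_const (a := D.meanGrad2 k x y))).aestronglyMeasurable (μ := D.Df k)
  have h1 := h.var.var_grad2_f k x y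
  rw [h.grad2_fFull] at h1
  exact ⟨(memLp_two_iff_integrable_sq_norm hm).1 (memLp_two_of_lintegral_le hm h1),
    integral_sq_le_of_lintegral_le hm (sq_nonneg σ) h1⟩

lemma sq_dev_grad2_g (k : Fin K) (x : Vec dx) (y : Vec dy) :
    Integrable (fun ζ => ‖grad2 (D.gAt k ζ) x y - D.meanGradG k x y‖ ^ 2) (D.Dg k) ∧
      ∫ ζ, ‖grad2 (D.gAt k ζ) x y - D.meanGradG k x y‖ ^ 2 ∂(D.Dg k) ≤ σ ^ 2 := by
  have hm := ((h.well.measurable_grad2_g h.lower k x y).sub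
    (measurable_const (a := D.meanGradG k x y))).aestronglyMeasurable (μ := D.Dg k)
  have h1 := h.var.var_grad2_g k x y
  rw [h.grad2_gFull] at h1
  exact ⟨(memLp_two_iff_integrable_sq_norm hm).1 (memLp_two_of_lintegral_le hm h1),
    integral_sq_le_of_lintegral_le hm (sq_nonneg σ) h1⟩

lemma isOracle_F {L v : ℝ} (hL : lfx + lgxy * (cfy / μ) + cgxy ≤ L)
    (hv : 2 * σ ^ 2 + 8 * (cgxy * (cfy / μ)) ^ 2 ≤ v ^ 2) :
    IsOracle D L (cfy / μ) v D.oracleF D.meanF where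
  meas k := by
    refine measurable_uncurry_of_continuous (fun q => ?_) (fun w => ?_)
    · refine Continuous.sub ?_ ?_
      · exact (h.upper.lip_grad1 k q.1).continuous.comp
          (f := fun w : Pt dx dy => (w.1, w.2.1)) (by fun_prop)
      · exact ((h.lower.lip_jac12 k q.2).continuous.comp
          (f := fun w : Pt dx dy => (w.1, w.2.1)) (by fun_prop)).clm_apply (by fun_prop)
    · exact ((h.well.measurable_grad1 h.upper k w.1 w.2.1).comp measurable_fst).sub
        ((h.well.measurable_jac12 h.lower k w.1 w.2.1 w.2.2).comp measurable_snd)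
  lip k q w w' hw hw' := by
    have e1 := (h.upper.lip_grad1 k q.1 w.1 w.2.1 w'.1 w'.2.1).trans
      (mul_le_mul_of_nonneg_left (sqrt_xy_le_dsq w w') h.lfx_pos.le)
    have e2 := (h.lower.lip_jac12 k q.2 w.1 w.2.1 w'.1 w'.2.1).trans
      (mul_le_mul_of_nonneg_left (sqrt_xy_le_dsq w w') h.lgxy_pos.le)
    have e3 := (h.norm_jac_le k q.2 w'.1 w'.2.1 (w.2.2 - w'.2.2)).trans
      (mul_le_mul_of_nonneg_left (norm_z_le_dsq w w') h.cgxy_pos.le)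
    have e4 := (ContinuousLinearMap.le_opNorm (jac12 (D.gAt k q.2) w.1 w.2.1
      - jac12 (D.gAt k q.2) w'.1 w'.2.1) w.2.2).trans (mul_le_mul e2 hw (norm_nonneg _)
        (mul_nonneg h.lgxy_pos.le (Real.sqrt_nonneg _)))
    have e5 : D.oracleF k w q - D.oracleF k w' q
        = (grad1 (D.fAt k q.1) w.1 w.2.1 - grad1 (D.fAt k q.1) w'.1 w'.2.1)
          - ((jac12 (D.gAt k q.2) w.1 w.2.1 - jac12 (D.gAt k q.2) w'.1 w'.2.1) w.2.2
            + jac12 (D.gAt k q.2) w'.1 w'.2.1 (w.2.2 - w'.2.2)) := by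
      simp only [oracleF, GF, sub_apply, map_sub]; abel
    rw [e5]
    refine (norm_sub_le _ _).trans ((add_le_add e1 ((norm_add_le _ _).trans
      (add_le_add e4 e3))).trans ?_)
    have := mul_le_mul_of_nonneg_right hL (Real.sqrt_nonneg (dsq w w'))
    linarith
  int k w Q hf hg := (integrable_fst hf (h.integrable_grad1 k w.1 w.2.1)).sub
    (integrable_snd hg (h.integrable_jac12 k w.1 w.2.1 w.2.2))
  mean k w Q hf hg := by
    unfold oracleF GF meanF
    rw [integral_sub (integrable_fst hf (h.integrable_grad1 k w.1 w.2.1))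
      (integrable_snd hg (h.integrable_jac12 k w.1 w.2.1 w.2.2)),
      integral_fst hf (h.integrable_grad1 k w.1 w.2.1),
      integral_snd hg (h.integrable_jac12 k w.1 w.2.1 w.2.2)]
    rfl
  var k w Q hf hg hw := by
    have := h.well.prob_f k
    have := isProbabilityMeasure_of_map_fst hf
    have hm := (integrable_fst hf (h.integrable_grad1 k w.1 w.2.1)).sub
      (integrable_snd hg (h.integrable_jac12 k w.1 w.2.1 w.2.2))
    have hA := h.sq_dev_grad1 k w.1 w.2.1
    refine memLp_of_sq_le (s := σ ^ 2) (c := 8 * (cgxy * (cfy / μ)) ^ 2)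
      (hm.aestronglyMeasurable.sub aestronglyMeasurable_const) (integrable_fst hf hA.1)
      (fun q => ?_) ((integral_fst hf hA.1).trans_le hA.2) hv
    have e1 : D.oracleF k w q - D.meanF k w = (grad1 (D.fAt k q.1) w.1 w.2.1
        - D.meanGrad1 k w.1 w.2.1) - (jac12 (D.gAt k q.2) w.1 w.2.1 w.2.2
        - D.meanJac k w.1 w.2.1 w.2.2) := by
      simp only [oracleF, GF, meanF]; abel
    have e2 : ‖jac12 (D.gAt k q.2) w.1 w.2.1 w.2.2 - D.meanJac k w.1 w.2.1 w.2.2‖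
        ≤ 2 * (cgxy * (cfy / μ)) := by
      have i1 := mul_le_mul_of_nonneg_left hw h.cgxy_pos.le
      refine (norm_sub_le _ _).trans ?_
      linarith [h.norm_jac_le k q.2 w.1 w.2.1 w.2.2, h.norm_meanJac_le k w.1 w.2.1 w.2.2]
    have e3 := pow_le_pow_left₀ (norm_nonneg _) e2 2
    change ‖D.oracleF k w q - D.meanF k w‖ ^ 2 ≤ _
    rw [e1]
    refine (norm_sub_sq_le_two _ _).trans ?_
    linarith

lemma isOracle_G {L v : ℝ} (hL : lgy ≤ L) (hv : 2 * σ ^ 2 ≤ v ^ 2) :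
    IsOracle D L (cfy / μ) v D.oracleG D.meanG where
  meas k := by
    refine measurable_uncurry_of_continuous (fun q => ?_) (fun w => ?_)
    · exact (h.lower.lip_grad2 k q.2).continuous.comp
        (f := fun w : Pt dx dy => (w.1, w.2.1)) (by fun_prop)
    · exact (h.well.measurable_grad2_g h.lower k w.1 w.2.1).comp measurable_snd
  lip k q w w' _ _ :=
    (h.lower.lip_grad2 k q.2 w.1 w.2.1 w'.1 w'.2.1).trans
      (mul_le_mul hL (sqrt_xy_le_dsq w w') (Real.sqrt_nonneg _) (h.lgy_pos.le.trans hL))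
  int k w Q _ hg := integrable_snd hg (h.integrable_grad2_g k w.1 w.2.1)
  mean k w Q _ hg := integral_snd hg (h.integrable_grad2_g k w.1 w.2.1)
  var k w Q hf hg _ := by
    have := h.well.prob_f k
    have := isProbabilityMeasure_of_map_fst hf
    have hm := integrable_snd hg (h.integrable_grad2_g k w.1 w.2.1)
    have hA := h.sq_dev_grad2_g k w.1 w.2.1
    refine memLp_of_sq_le (s := σ ^ 2) (c := 0)
      (hm.aestronglyMeasurable.sub aestronglyMeasurable_const) (integrable_snd hg hA.1)
      (fun q => ?_) ((integral_snd hg hA.1).trans_le hA.2) (by linarith)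
    have : 0 ≤ ‖grad2 (D.gAt k q.2) w.1 w.2.1 - D.meanGradG k w.1 w.2.1‖ ^ 2 := by positivity
    change ‖grad2 (D.gAt k q.2) w.1 w.2.1 - D.meanGradG k w.1 w.2.1‖ ^ 2 ≤ _
    linarith

lemma isOracle_H {L v : ℝ} (hL : lfy + lgyy * (cfy / μ) + lgy ≤ L)
    (hv : 2 * σ ^ 2 + 8 * (lgy * (cfy / μ)) ^ 2 ≤ v ^ 2) :
    IsOracle D L (cfy / μ) v D.oracleH D.meanH where
  meas k := by
    refine measurable_uncurry_of_continuous (fun q => ?_) (fun w => ?_)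
    · refine Continuous.sub ?_ ?_
      rotate_left
      · exact (h.upper.lip_grad2 k q.1).continuous.comp
          (f := fun w : Pt dx dy => (w.1, w.2.1)) (by fun_prop)
      · exact ((h.lower.lip_hess22 k q.2).continuous.comp
          (f := fun w : Pt dx dy => (w.1, w.2.1)) (by fun_prop)).clm_apply (by fun_prop)
    · exact ((h.well.measurable_hess22 h.lower k w.1 w.2.1 w.2.2).comp measurable_snd).sub
        ((h.well.measurable_grad2_f h.upper k w.1 w.2.1).comp measurable_fst)
  lip k q w w' hw hw' := by
    have e1 := (h.upper.lip_grad2 k q.1 w.1 w.2.1 w'.1 w'.2.1).trans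
      (mul_le_mul_of_nonneg_left (sqrt_xy_le_dsq w w') h.lfy_pos.le)
    have e2 := (h.lower.lip_hess22 k q.2 w.1 w.2.1 w'.1 w'.2.1).trans
      (mul_le_mul_of_nonneg_left (sqrt_xy_le_dsq w w') h.lgyy_pos.le)
    have e3 := (h.norm_hess_le k q.2 w'.1 w'.2.1 (w.2.2 - w'.2.2)).trans
      (mul_le_mul_of_nonneg_left (norm_z_le_dsq w w') h.lgy_pos.le)
    have e4 := (ContinuousLinearMap.le_opNorm (hess22 (D.gAt k q.2) w.1 w.2.1
      - hess22 (D.gAt k q.2) w'.1 w'.2.1) w.2.2).trans (mul_le_mul e2 hw (norm_nonneg _)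
        (mul_nonneg h.lgyy_pos.le (Real.sqrt_nonneg _)))
    have e5 : D.oracleH k w q - D.oracleH k w' q
        = -(grad2 (D.fAt k q.1) w.1 w.2.1 - grad2 (D.fAt k q.1) w'.1 w'.2.1)
          + ((hess22 (D.gAt k q.2) w.1 w.2.1 - hess22 (D.gAt k q.2) w'.1 w'.2.1) w.2.2
            + hess22 (D.gAt k q.2) w'.1 w'.2.1 (w.2.2 - w'.2.2)) := by
      simp only [oracleH, Gh, sub_apply, map_sub]; abel
    rw [e5]
    refine (norm_add_le _ _).trans ((add_le_add ((norm_neg _).trans_le e1) ((norm_add_le _ _).trans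
      (add_le_add e4 e3))).trans ?_)
    have := mul_le_mul_of_nonneg_right hL (Real.sqrt_nonneg (dsq w w'))
    linarith
  int k w Q hf hg := (integrable_snd hg (h.integrable_hess22 k w.1 w.2.1 w.2.2)).sub
    (integrable_fst hf (h.integrable_grad2_f k w.1 w.2.1))
  mean k w Q hf hg := by
    unfold oracleH Gh meanH
    rw [integral_sub (integrable_snd hg (h.integrable_hess22 k w.1 w.2.1 w.2.2))
      (integrable_fst hf (h.integrable_grad2_f k w.1 w.2.1)),
      integral_fst hf (h.integrable_grad2_f k w.1 w.2.1),
      integral_snd hg (h.integrable_hess22 k w.1 w.2.1 w.2.2)]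
    rfl
  var k w Q hf hg hw := by
    have := h.well.prob_f k
    have := isProbabilityMeasure_of_map_fst hf
    have hm := (integrable_snd hg (h.integrable_hess22 k w.1 w.2.1 w.2.2)).sub
      (integrable_fst hf (h.integrable_grad2_f k w.1 w.2.1))
    have hA := h.sq_dev_grad2_f k w.1 w.2.1
    refine memLp_of_sq_le (s := σ ^ 2) (c := 8 * (lgy * (cfy / μ)) ^ 2)
      (hm.aestronglyMeasurable.sub aestronglyMeasurable_const) (integrable_fst hf hA.1)
      (fun q => ?_) ((integral_fst hf hA.1).trans_le hA.2) hv
    have e1 : D.oracleH k w q - D.meanH k w = -(grad2 (D.fAt k q.1) w.1 w.2.1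
        - D.meanGrad2 k w.1 w.2.1) + (hess22 (D.gAt k q.2) w.1 w.2.1 w.2.2
        - D.meanHess k w.1 w.2.1 w.2.2) := by
      simp only [oracleH, Gh, meanH]; abel
    have e2 : ‖hess22 (D.gAt k q.2) w.1 w.2.1 w.2.2 - D.meanHess k w.1 w.2.1 w.2.2‖
        ≤ 2 * (lgy * (cfy / μ)) := by
      have i1 := mul_le_mul_of_nonneg_left hw h.lgy_pos.le
      refine (norm_sub_le _ _).trans ?_
      linarith [h.norm_hess_le k q.2 w.1 w.2.1 w.2.2, h.norm_meanHess_le k w.1 w.2.1 w.2.2]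
    have e3 := pow_le_pow_left₀ (norm_nonneg _) e2 2
    change ‖D.oracleH k w q - D.meanH k w‖ ^ 2 ≤ _
    rw [e1]
    refine (norm_add_sq_le_two _ _).trans ?_
    rw [norm_neg]
    linarith


/-! ### Regularity of the bilevel objective -/

lemma gFull_ge (k : Fin K) (x : Vec dx) (y y' : Vec dy) :
    D.gFull k x y + ⟪D.meanGradG k x y, y' - y⟫ + μ / 2 * ‖y' - y‖ ^ 2 ≤ D.gFull k x y' := by
  set d := y' - y with hd
  have hμ := h.μ_pos
  have hl := h.lgy_pos
  have key : ∀ s : ℝ, 0 < s → s < 1 → D.gFull k x y + ⟪D.meanGradG k x y, d⟫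
      + μ / 2 * ‖d‖ ^ 2 - s * ((μ / 2 + lgy) * ‖d‖ ^ 2) ≤ D.gFull k x y' := by
    intro s h0 h1
    have e1 := (h.strong k x).2 (Set.mem_univ y) (Set.mem_univ y')
      (show 0 ≤ 1 - s by linarith) h0.le (show 1 - s + s = 1 by ring)
    have e2 : (1 - s) • y + s • y' = y + s • d := by rw [hd]; module
    have e3 := (abs_le.1 (h.taylor_gFull k x y (y + s • d))).1
    simp only [e2, smul_eq_mul] at e1
    rw [norm_sub_rev, ← hd] at e1
    simp only [add_sub_cancel_left, inner_smul_right, norm_smul, Real.norm_of_nonneg h0.le] at e3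
    have e4 : s * (D.gFull k x y + ⟪D.meanGradG k x y, d⟫ + μ / 2 * ‖d‖ ^ 2
        - s * ((μ / 2 + lgy) * ‖d‖ ^ 2)) ≤ s * D.gFull k x y' := by nlinarith
    exact le_of_mul_le_mul_left e4 h0
  refine le_of_forall_pos_le_add fun ε hε => ?_
  set c := (μ / 2 + lgy) * ‖d‖ ^ 2
  have hc : 0 ≤ c := by positivity
  have h2 := key (min (1 / 2) (ε / (c + 1))) (by positivity)
    (lt_of_le_of_lt (min_le_left _ _) (by norm_num))
  have h3 : min (1 / 2) (ε / (c + 1)) * c ≤ ε := by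
    calc min (1 / 2) (ε / (c + 1)) * c ≤ ε / (c + 1) * c := by gcongr; exact min_le_right _ _
      _ ≤ ε := by rw [div_mul_eq_mul_div, div_le_iff₀ (by linarith)]; nlinarith
  linarith

lemma meanGradG_lip (k : Fin K) (x x' : Vec dx) (y y' : Vec dy) :
    ‖D.meanGradG k x y - D.meanGradG k x' y'‖ ≤ lgy * √(‖x - x'‖ ^ 2 + ‖y - y'‖ ^ 2) := by
  have := h.well.prob_g k
  unfold meanGradG
  rw [← integral_sub (h.integrable_grad2_g k x y) (h.integrable_grad2_g k x' y')]
  simpa using norm_integral_le_of_norm_le_const (μ := D.Dg k)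
    (Filter.Eventually.of_forall fun ζ => h.lower.lip_grad2 k ζ x y x' y')

omit h in
lemma norm_mean_le {n : ℕ} (hK : 1 ≤ K) {X : Fin K → Vec n} {c : ℝ} (hX : ∀ k, ‖X k‖ ≤ c) :
    ‖DecBilevel.mean X‖ ≤ c := by
  have h1 : ‖DecBilevel.mean X‖ ≤ (1 / (K : ℝ)) * ∑ k, ‖X k‖ := by
    unfold DecBilevel.mean
    rw [norm_smul, Real.norm_of_nonneg (by positivity)]
    gcongr
    exact norm_sum_le _ _
  exact h1.trans (avg_le hK hX)

omit h in
lemma mean_sub_le {n : ℕ} (hK : 1 ≤ K) {X Y : Fin K → Vec n} {c : ℝ}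
    (hX : ∀ k, ‖X k - Y k‖ ≤ c) : ‖DecBilevel.mean X - DecBilevel.mean Y‖ ≤ c := by
  rw [← mean_sub]; exact norm_mean_le hK hX

omit h in
lemma le_mean_inner {n : ℕ} (hK : 1 ≤ K) {X : Fin K → Vec n} {d : Vec n} {c : ℝ}
    (hX : ∀ k, c ≤ ⟪X k, d⟫) : c ≤ ⟪DecBilevel.mean X, d⟫ := by
  rw [mean_inner]
  have := avg_le hK (a := fun k => - ⟪X k, d⟫) (c := -c) fun k => neg_le_neg (hX k)
  rw [sum_neg_distrib, mul_neg] at this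
  linarith

lemma mean_meanGradG_mono (hK : 1 ≤ K) (x : Vec dx) (y y' : Vec dy) :
    μ * ‖y' - y‖ ^ 2 ≤ ⟪DecBilevel.mean (fun k => D.meanGradG k x y')
      - DecBilevel.mean (fun k => D.meanGradG k x y), y' - y⟫ := by
  rw [← mean_sub]
  exact le_mean_inner hK fun k => h.meanGradG_strong_mono k x y y'

/-- `y*(x)` is the zero of the averaged gradient `∇₂ g(x, ·)`. -/
lemma mean_meanGradG_yStar (hK : 1 ≤ K) (x : Vec dx) :
    DecBilevel.mean (fun k => D.meanGradG k x (D.yStar x)) = 0 := by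
  obtain ⟨y, hy⟩ := exists_zero_of_strongly_monotone
    (Ψ := fun y => DecBilevel.mean (fun k => D.meanGradG k x y)) h.μ_pos h.lgy_pos
    (fun a b => mean_sub_le hK fun k => by
      simpa [Real.sqrt_sq (norm_nonneg _)] using h.meanGradG_lip k x x a b)
    (fun a b => h.mean_meanGradG_mono hK x b a)
  have hmin : ∀ y', D.gAvg x y + μ / 2 * ‖y' - y‖ ^ 2 ≤ D.gAvg x y' := by
    intro y'
    have e1 : ⟪DecBilevel.mean (fun k => D.meanGradG k x y), y' - y⟫ = 0 := by
      rw [hy, inner_zero_left]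
    rw [mean_inner] at e1
    have e2 := avg_le hK (a := fun k => D.gFull k x y + ⟪D.meanGradG k x y, y' - y⟫
      - D.gFull k x y') (c := -(μ / 2 * ‖y' - y‖ ^ 2)) fun k => by linarith [h.gFull_ge k x y y']
    rw [sum_sub_distrib, sum_add_distrib, mul_sub, mul_add, e1] at e2
    unfold gAvg
    linarith
  have hμ := h.μ_pos
  have hstar : ∀ y', D.gAvg x (D.yStar x) ≤ D.gAvg x y' :=
    Classical.epsilon_spec (p := fun y => ∀ y', D.gAvg x y ≤ D.gAvg x y')
      ⟨y, fun y' => by linarith [hmin y', mul_nonneg (half_pos hμ).le (sq_nonneg ‖y' - y‖)]⟩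
  have h1 := hmin (D.yStar x)
  have h2 := hstar y
  have h3 : ‖D.yStar x - y‖ ^ 2 ≤ 0 := by
    by_contra h4
    push Not at h4
    linarith [mul_pos (half_pos hμ) h4]
  have h4 : D.yStar x = y := by
    have : ‖D.yStar x - y‖ = 0 := by
      have := sq_nonneg ‖D.yStar x - y‖
      exact pow_eq_zero_iff (two_ne_zero) |>.1 (le_antisymm h3 this)
    exact sub_eq_zero.1 (norm_eq_zero.1 this)
  rw [h4]; exact hy

lemma meanH_sub (k : Fin K) (x : Vec dx) (y z z' : Vec dy) :
    D.meanH k (x, y, z) - D.meanH k (x, y, z') = D.meanHess k x y (z - z') := by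
  simp only [meanH, h.meanHess_sub]; abel

lemma mean_meanH_mono (hK : 1 ≤ K) (x : Vec dx) (y z z' : Vec dy) :
    μ * ‖z - z'‖ ^ 2 ≤ ⟪DecBilevel.mean (fun k => D.meanH k (x, y, z))
      - DecBilevel.mean (fun k => D.meanH k (x, y, z')), z - z'⟫ := by
  rw [← mean_sub]
  refine le_mean_inner hK fun k => ?_
  rw [h.meanH_sub]
  exact h.meanHess_coercive k x y (z - z')

lemma mean_meanH_zStar (hK : 1 ≤ K) (x : Vec dx) :
    DecBilevel.mean (fun k => D.meanH k (x, D.yStar x, D.zStar x)) = 0 :=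
  Classical.epsilon_spec (p := fun z => DecBilevel.mean (fun k => D.meanH k (x, D.yStar x, z)) = 0)
    (exists_zero_of_strongly_monotone
      (Ψ := fun z => DecBilevel.mean (fun k => D.meanH k (x, D.yStar x, z))) h.μ_pos h.lgy_pos
      (fun a b => mean_sub_le hK fun k => by
        rw [h.meanH_sub]; exact h.norm_meanHess_le k x _ (a - b))
      (fun a b => h.mean_meanH_mono hK x _ a b))

lemma mean_meanHess_zStar (hK : 1 ≤ K) (x : Vec dx) :
    DecBilevel.mean (fun k => D.meanHess k x (D.yStar x) (D.zStar x))
      = DecBilevel.mean (fun k => D.meanGrad2 k x (D.yStar x)) := by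
  have h1 := h.mean_meanH_zStar hK x
  unfold meanH at h1
  rw [mean_sub] at h1
  exact sub_eq_zero.1 h1

lemma norm_zStar_le (hK : 1 ≤ K) (x : Vec dx) : ‖D.zStar x‖ ≤ cfy / μ := by
  refine norm_le_of_strongly_monotone h.μ_pos
    (e := DecBilevel.mean (fun k => D.meanHess k x (D.yStar x) (D.zStar x)))
    (le_mean_inner hK fun k => h.meanHess_coercive k x _ _) ?_
  rw [h.mean_meanHess_zStar hK]
  exact norm_mean_le hK fun k => h.norm_meanGrad2_le k x _

lemma yStar_lip (hK : 1 ≤ K) (x x' : Vec dx) :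
    ‖D.yStar x - D.yStar x'‖ ≤ lgy / μ * ‖x - x'‖ := by
  rw [div_mul_eq_mul_div]
  refine norm_le_of_strongly_monotone h.μ_pos (h.mean_meanGradG_mono hK x' _ _) ?_
  rw [h.mean_meanGradG_yStar hK x', ← h.mean_meanGradG_yStar hK x]
  refine mean_sub_le hK fun k => ?_
  simpa [Real.sqrt_sq (norm_nonneg _), norm_sub_rev x'] using
    h.meanGradG_lip k x' x (D.yStar x) (D.yStar x)

lemma zStar_lip (hK : 1 ≤ K) (x x' : Vec dx) : ‖D.zStar x - D.zStar x'‖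
      ≤ (lfy + lgyy * (cfy / μ) + lgy) * (1 + lgy / μ) / μ * ‖x - x'‖ := by
  have hl := h.lgy_pos
  have hμ := h.μ_pos
  have h0 : 0 < lfy + lgyy * (cfy / μ) + lgy := by
    have := h.lfy_pos; have := h.lgyy_pos; have := h.cfy_pos; positivity
  rw [div_mul_eq_mul_div]
  refine norm_le_of_strongly_monotone h.μ_pos (h.mean_meanH_mono hK x' (D.yStar x') _ _) ?_
  rw [h.mean_meanH_zStar hK x', ← h.mean_meanH_zStar hK x]
  refine mean_sub_le hK fun k => ?_
  have hO := h.isOracle_H (v := √(2 * σ ^ 2 + 8 * (lgy * (cfy / μ)) ^ 2)) le_rfl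
    (Real.sq_sqrt (by positivity)).ge
  have h1 := hO.mean_lip h.well k (x', D.yStar x', D.zStar x) (x, D.yStar x, D.zStar x)
    (h.norm_zStar_le hK x) (h.norm_zStar_le hK x)
  have h2 : √(dsq (x', D.yStar x', D.zStar x) (x, D.yStar x, D.zStar x))
      ≤ (1 + lgy / μ) * ‖x - x'‖ := by
    refine Real.sqrt_le_iff.2 ⟨by positivity, ?_⟩
    have h3 := pow_le_pow_left₀ (norm_nonneg _) (h.yStar_lip hK x' x) 2
    simp only [dsq, sub_self, norm_zero]
    rw [norm_sub_rev x x']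
    have : 0 ≤ lgy / μ * ‖x' - x‖ ^ 2 := by positivity
    nlinarith
  refine h1.trans ((mul_le_mul_of_nonneg_left h2 h0.le).trans (le_of_eq (by ring)))

/-- First-order expansion of the bilevel objective with the hypergradient. The expansions of `f`
and of `⟪z*, ∇₂ g⟫` are added; the increments of `y*` cancel by the equation defining `z*`. -/
lemma F_expansion (hK : 1 ≤ K) (x x' : Vec dx) :
    |D.F x' - D.F x - ⟪D.hyperGrad x, x' - x⟫|
      ≤ (lfx + lfy + cfy / μ * (lgxy + lgyy)) * (1 + (lgy / μ) ^ 2) * ‖x' - x‖ ^ 2 := by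
  have hx := h.lfx_pos; have hy := h.lfy_pos; have hxy := h.lgxy_pos; have hyy := h.lgyy_pos
  have hr := h.radius_nonneg
  set y := D.yStar x
  set y' := D.yStar x'
  set z := D.zStar x
  set R := ‖x' - x‖ ^ 2 + ‖y' - y‖ ^ 2
  have hR0 : 0 ≤ R := by positivity
  have hR : R ≤ (1 + (lgy / μ) ^ 2) * ‖x' - x‖ ^ 2 := by
    have h3 := pow_le_pow_left₀ (norm_nonneg _) (h.yStar_lip hK x' x) 2
    simp only [R]
    nlinarith
  have hA := abs_avg_le hK (fun k => h.taylor_fFull k x x' y y')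
  have hB := abs_avg_le hK (fun k => h.taylor_meanGradG k x x' y y' z)
  simp only [sum_sub_distrib, sum_add_distrib, mul_sub, mul_add, ← mean_inner] at hA hB
  rw [h.mean_meanGradG_yStar hK x', h.mean_meanGradG_yStar hK x, inner_zero_left,
    h.mean_meanHess_zStar hK x] at hB
  have hC : ⟪D.hyperGrad x, x' - x⟫ = ⟪DecBilevel.mean (fun k => D.meanGrad1 k x y), x' - x⟫
      - ⟪DecBilevel.mean (fun k => D.meanJac k x y z), x' - x⟫ := by
    rw [← inner_sub_left, ← mean_sub]; rfl
  have hz : ‖z‖ * (lgxy + lgyy) * R ≤ cfy / μ * (lgxy + lgyy) * R := by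
    gcongr; exact h.norm_zStar_le hK x
  have hA1 := abs_le.1 hA
  have hB1 := abs_le.1 hB
  have hF : D.F x' - D.F x = 1 / (K : ℝ) * ∑ k, D.fFull k x' y' - 1 / (K : ℝ) * ∑ k, D.fFull k x y :=
    rfl
  have hfin : (lfx + lfy + cfy / μ * (lgxy + lgyy)) * R
      ≤ (lfx + lfy + cfy / μ * (lgxy + lgyy)) * ((1 + (lgy / μ) ^ 2) * ‖x' - x‖ ^ 2) := by
    gcongr
  rw [hF, hC, abs_le]
  simp only [R] at *
  constructor <;> nlinarith [hA1.1, hA1.2, hB1.1, hB1.2]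

end Regular

end Problem

/-! ### Fresh samples are orthogonal to the past -/

section Orthogonality

variable {Ω P S : Type*} [MeasurableSpace Ω] [MeasurableSpace P] [MeasurableSpace S]
  {Pr : Measure Ω} [IsProbabilityMeasure Pr] {q : Ω → P} {ξ : Ω → S} {n : ℕ}

lemma integral_inner_eq_zero_of_indepFun (hq : Measurable q) (hξ : Measurable ξ)
    (hi : IndepFun q ξ Pr) {Φ : P → Vec n} {N : P → S → Vec n} (hΦ : Measurable Φ)
    (hN : Measurable (Function.uncurry N)) (hint : ∀ p, Integrable (N p) (Pr.map ξ))
    (h0 : ∀ p, ∫ s, N p s ∂(Pr.map ξ) = 0)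
    (hI : Integrable (fun ω => ⟪Φ (q ω), N (q ω) (ξ ω)⟫) Pr) :
    ∫ ω, ⟪Φ (q ω), N (q ω) (ξ ω)⟫ ∂Pr = 0 := by
  have := Measure.isProbabilityMeasure_map (μ := Pr) hq.aemeasurable
  have := Measure.isProbabilityMeasure_map (μ := Pr) hξ.aemeasurable
  have hmap := hi.map_prod_eq_prod_map_map hq.aemeasurable hξ.aemeasurable
  let G : P × S → ℝ := fun x => ⟪Φ x.1, N x.1 x.2⟫
  have hG : Measurable G := (hΦ.comp measurable_fst).inner hN
  have hqξ : Measurable fun ω => (q ω, ξ ω) := hq.prodMk hξ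
  have e1 : ∫ ω, ⟪Φ (q ω), N (q ω) (ξ ω)⟫ ∂Pr = ∫ x, G x ∂(Pr.map fun ω => (q ω, ξ ω)) :=
    (integral_map hqξ.aemeasurable hG.aestronglyMeasurable).symm
  have hI' : Integrable G ((Pr.map q).prod (Pr.map ξ)) := by
    rw [← hmap]
    exact (integrable_map_measure hG.aestronglyMeasurable hqξ.aemeasurable).2 hI
  rw [e1, hmap, integral_prod _ hI']
  have e2 : ∀ p, ∫ s, G (p, s) ∂(Pr.map ξ) = 0 := fun p => by
    show ∫ s, ⟪Φ p, N p s⟫ ∂(Pr.map ξ) = 0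
    rw [integral_inner (hint p), h0, inner_zero_right]
  simp only [e2, integral_zero]

lemma lintegral_le_of_indepFun (hq : Measurable q) (hξ : Measurable ξ)
    (hi : IndepFun q ξ Pr) {G : P → S → ENNReal} (hG : Measurable (Function.uncurry G))
    {c : ENNReal} (hc : ∀ p, ∫⁻ s, G p s ∂(Pr.map ξ) ≤ c) : ∫⁻ ω, G (q ω) (ξ ω) ∂Pr ≤ c := by
  have := Measure.isProbabilityMeasure_map (μ := Pr) hq.aemeasurable
  have := Measure.isProbabilityMeasure_map (μ := Pr) hξ.aemeasurable
  have hmap := hi.map_prod_eq_prod_map_map hq.aemeasurable hξ.aemeasurable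
  have e1 : ∫⁻ ω, G (q ω) (ξ ω) ∂Pr
      = ∫⁻ x, Function.uncurry G x ∂(Pr.map fun ω => (q ω, ξ ω)) :=
    (lintegral_map hG (hq.prodMk hξ)).symm
  rw [e1, hmap, lintegral_prod _ hG.aemeasurable]
  calc ∫⁻ p, ∫⁻ s, G p s ∂(Pr.map ξ) ∂(Pr.map q) ≤ ∫⁻ _p, c ∂(Pr.map q) := lintegral_mono hc
    _ = c := by simp

end Orthogonality

lemma integrable_inner_of_memLp {Ω : Type*} [MeasurableSpace Ω] {Pr : Measure Ω} {n : ℕ}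
    {X Y : Ω → Vec n} (hX : MemLp X 2 Pr) (hY : MemLp Y 2 Pr) :
    Integrable (fun ω => ⟪X ω, Y ω⟫) Pr := by
  refine Integrable.mono' ((hX.integrable_norm_pow (by norm_num : 2 ≠ 0)).add
    (hY.integrable_norm_pow (by norm_num : 2 ≠ 0)))
    (hX.aestronglyMeasurable.inner hY.aestronglyMeasurable)
    (Filter.Eventually.of_forall fun ω => ?_)
  refine (abs_real_inner_le_norm _ _).trans ?_
  simp only [Pi.add_apply]
  nlinarith [sq_nonneg (‖X ω‖ - ‖Y ω‖), sq_nonneg ‖X ω‖, sq_nonneg ‖Y ω‖]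

section SubAlgebra

variable {Ω S : Type*} {m : MeasurableSpace Ω} [mΩ : MeasurableSpace Ω] [MeasurableSpace S]
  {Pr : Measure Ω} {ξ : Ω → S} {n : ℕ}

lemma indepFun_id (hi : Indep m (MeasurableSpace.comap ξ inferInstance) Pr) :
    @IndepFun Ω Ω S mΩ m inferInstance id ξ Pr := by
  refine (@IndepFun_iff_Indep Ω Ω S mΩ m _ id ξ Pr).2 ?_
  rw [MeasurableSpace.comap_id]
  exact hi

/-- A vector known at `m` is orthogonal to a centred noise that depends on `m` and on a sample
independent of `m`. -/
lemma integral_inner_eq_zero_of_indep [IsProbabilityMeasure Pr] (hm : m ≤ mΩ) (hξ : Measurable ξ)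
    (hi : Indep m (MeasurableSpace.comap ξ inferInstance) Pr) {Φ : Ω → Vec n}
    {N : Ω → S → Vec n} (hΦ : Measurable[m] Φ)
    (hN : Measurable[m.prod inferInstance] (Function.uncurry N))
    (hint : ∀ ω, Integrable (N ω) (Pr.map ξ)) (h0 : ∀ ω, ∫ s, N ω s ∂(Pr.map ξ) = 0)
    (hΦ2 : MemLp Φ 2 Pr) (hN2 : MemLp (fun ω => N ω (ξ ω)) 2 Pr) :
    ∫ ω, ⟪Φ ω, N ω (ξ ω)⟫ ∂Pr = 0 :=
  @integral_inner_eq_zero_of_indepFun Ω Ω S mΩ m _ Pr _ id ξ n (measurable_id'' hm) hξ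
    (indepFun_id hi) Φ N hΦ hN hint h0 (integrable_inner_of_memLp hΦ2 hN2)

lemma lintegral_le_of_indep [IsProbabilityMeasure Pr] (hm : m ≤ mΩ) (hξ : Measurable ξ)
    (hi : Indep m (MeasurableSpace.comap ξ inferInstance) Pr) {G : Ω → S → ENNReal}
    (hG : Measurable[m.prod inferInstance] (Function.uncurry G)) {c : ENNReal}
    (hc : ∀ ω, ∫⁻ s, G ω s ∂(Pr.map ξ) ≤ c) : ∫⁻ ω, G ω (ξ ω) ∂Pr ≤ c :=
  @lintegral_le_of_indepFun Ω Ω S mΩ m _ Pr _ id ξ (measurable_id'' hm) hξ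
    (indepFun_id hi) G hG c hc

end SubAlgebra

/-- Pythagoras for pairwise orthogonal square-integrable vectors. -/
lemma integral_norm_sq_add_sum {Ω ι : Type*} [MeasurableSpace Ω] {Pr : Measure Ω} {n : ℕ}
    (J : Finset ι) {Φ : Ω → Vec n} {N : ι → Ω → Vec n} (c : ℝ) (hΦ : MemLp Φ 2 Pr)
    (hN : ∀ j ∈ J, MemLp (N j) 2 Pr) (h1 : ∀ j ∈ J, ∫ ω, ⟪Φ ω, N j ω⟫ ∂Pr = 0)
    (h2 : ∀ i ∈ J, ∀ j ∈ J, i ≠ j → ∫ ω, ⟪N i ω, N j ω⟫ ∂Pr = 0) :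
    ∫ ω, ‖Φ ω + c • ∑ j ∈ J, N j ω‖ ^ 2 ∂Pr
      = ∫ ω, ‖Φ ω‖ ^ 2 ∂Pr + c ^ 2 * ∑ j ∈ J, ∫ ω, ‖N j ω‖ ^ 2 ∂Pr := by
  have e : ∀ ω, ‖Φ ω + c • ∑ j ∈ J, N j ω‖ ^ 2 = ‖Φ ω‖ ^ 2 + (2 * c) * ∑ j ∈ J, ⟪Φ ω, N j ω⟫
      + c ^ 2 * ∑ i ∈ J, ∑ j ∈ J, ⟪N i ω, N j ω⟫ := fun ω => by
    rw [norm_add_sq_real, inner_smul_right, inner_sum, norm_smul, mul_pow, Real.norm_eq_abs, sq_abs,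
      ← real_inner_self_eq_norm_sq (∑ j ∈ J, N j ω), sum_inner]
    simp only [inner_sum]
    ring
  have i0 : Integrable (fun ω => ‖Φ ω‖ ^ 2) Pr := hΦ.integrable_norm_pow (by norm_num)
  have i1 : ∀ j ∈ J, Integrable (fun ω => ⟪Φ ω, N j ω⟫) Pr := fun j hj =>
    integrable_inner_of_memLp hΦ (hN j hj)
  have i2 : ∀ i ∈ J, ∀ j ∈ J, Integrable (fun ω => ⟪N i ω, N j ω⟫) Pr := fun i hi j hj =>
    integrable_inner_of_memLp (hN i hi) (hN j hj)
  have i3 : Integrable (fun ω => (2 * c) * ∑ j ∈ J, ⟪Φ ω, N j ω⟫) Pr :=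
    (integrable_finsetSum J i1).const_mul _
  have i4 : Integrable (fun ω => c ^ 2 * ∑ i ∈ J, ∑ j ∈ J, ⟪N i ω, N j ω⟫) Pr :=
    (integrable_finsetSum J fun i hi => integrable_finsetSum J (i2 i hi)).const_mul _
  have i5 : Integrable (fun ω => ‖Φ ω‖ ^ 2 + (2 * c) * ∑ j ∈ J, ⟪Φ ω, N j ω⟫) Pr := i0.add i3
  simp only [e]
  rw [integral_add i5 i4, integral_add i0 i3, integral_const_mul, integral_const_mul,
    integral_finsetSum J i1,
    integral_finsetSum J (fun i hi => integrable_finsetSum J (i2 i hi)),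
    sum_eq_zero h1, mul_zero, add_zero]
  congr 2
  refine sum_congr rfl fun i hi => ?_
  rw [integral_finsetSum J (i2 i hi), sum_eq_single_of_mem i hi
    (fun j hj hji => h2 i hi j hj hji.symm)]
  simp only [real_inner_self_eq_norm_sq]

/-! ### The samples of the past -/

section Sampling

variable {K dx dy : ℕ} {Sf Sg : Type*} [MeasurableSpace Sf] [MeasurableSpace Sg]
  {D : Problem K dx dy Sf Sg} {Ω : Type*}
  {s : ℕ → Fin K → ℕ → Ω → Sf × Sg}

/-- The σ-algebra generated by the samples with index in `A`. -/
abbrev sampleAlg (s : ℕ → Fin K → ℕ → Ω → Sf × Sg) (A : Set (ℕ × Fin K × ℕ)) : MeasurableSpace Ω :=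
  ⨆ i ∈ A, MeasurableSpace.comap (s i.1 i.2.1 i.2.2) inferInstance

/-- The σ-algebra generated by the samples of the iterations before `t`. -/
abbrev past (s : ℕ → Fin K → ℕ → Ω → Sf × Sg) (t : ℕ) : MeasurableSpace Ω :=
  sampleAlg s {i | i.1 < t}

lemma sampleAlg_mono {A B : Set (ℕ × Fin K × ℕ)} (h : A ⊆ B) : sampleAlg s A ≤ sampleAlg s B :=
  biSup_mono h

lemma measurable_sample {A : Set (ℕ × Fin K × ℕ)} {t : ℕ} {k : Fin K} {b : ℕ}
    (h : (t, k, b) ∈ A) : Measurable[sampleAlg s A] (s t k b) := by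
  rw [measurable_iff_comap_le]
  exact le_biSup (fun i : ℕ × Fin K × ℕ =>
    MeasurableSpace.comap (s i.1 i.2.1 i.2.2) inferInstance) h

lemma past_le_sampleAlg_ne (t : ℕ) (k : Fin K) (b : ℕ) :
    past s t ≤ sampleAlg s {i | i ≠ (t, k, b)} :=
  sampleAlg_mono fun i (hi : i.1 < t) he => by
    rw [he] at hi
    exact lt_irrefl t hi

variable [mΩ : MeasurableSpace Ω] {Pr : Measure Ω}

lemma IsSampling.sampleAlg_le (h : IsSampling D Pr s) (A : Set (ℕ × Fin K × ℕ)) :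
    sampleAlg s A ≤ mΩ :=
  iSup₂_le fun i _ => (h.measurable i.1 i.2.1 i.2.2).comap_le

lemma IsSampling.indep_others (h : IsSampling D Pr s) (t : ℕ) (k : Fin K) (b : ℕ) :
    Indep (sampleAlg s {i | i ≠ (t, k, b)})
      (MeasurableSpace.comap (s t k b) inferInstance) Pr := by
  have h1 := indep_iSup_of_disjoint (fun i : ℕ × Fin K × ℕ =>
    (h.measurable i.1 i.2.1 i.2.2).comap_le) ((iIndepFun_iff_iIndep _ _ _).1 h.indep)
    (S := {i | i ≠ (t, k, b)}) (T := {(t, k, b)}) (by simp)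
  simpa [sampleAlg] using h1

lemma IsSampling.map_fst (h : IsSampling D Pr s) (t : ℕ) (k : Fin K) (b : ℕ) :
    (Pr.map (s t k b)).map Prod.fst = D.Df k := by
  rw [Measure.map_map measurable_fst (h.measurable t k b)]; exact h.law_f t k b

lemma IsSampling.map_snd (h : IsSampling D Pr s) (t : ℕ) (k : Fin K) (b : ℕ) :
    (Pr.map (s t k b)).map Prod.snd = D.Dg k := by
  rw [Measure.map_map measurable_snd (h.measurable t k b)]; exact h.law_g t k b

end Sampling

/-! ### The variance-reduced estimators -/

section Storm

variable {K dx dy n : ℕ} {Sf Sg : Type*} [MeasurableSpace Sf] [MeasurableSpace Sg]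
  {D : Problem K dx dy Sf Sg} {L r v : ℝ} {O : Fin K → Pt dx dy → Sf × Sg → Vec n}
  {M : Fin K → Pt dx dy → Vec n}

/-- Deviation of the oracle from its mean at the query point `w`. -/
def odev (O : Fin K → Pt dx dy → Sf × Sg → Vec n) (M : Fin K → Pt dx dy → Vec n) (k : Fin K)
    (w : Pt dx dy) (q : Sf × Sg) : Vec n :=
  O k w q - M k w

/-- The noise that one sample adds to the error of a recursive estimator with weight `a` when the
query point moves from `w` to `w'`. -/
def stormNoise (O : Fin K → Pt dx dy → Sf × Sg → Vec n) (M : Fin K → Pt dx dy → Vec n) (a : ℝ)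
    (k : Fin K) (w w' : Pt dx dy) (q : Sf × Sg) : Vec n :=
  odev O M k w' q - (1 - a) • odev O M k w q

lemma IsOracle.measurable_odev (h : IsOracle D L r v O M) (hD : D.WellPosed) {P : Type*}
    [MeasurableSpace P] {w : P → Pt dx dy} (hw : Measurable w) (k : Fin K) :
    Measurable (Function.uncurry fun p q => odev O M k (w p) q) :=
  ((h.meas k).comp ((hw.comp measurable_fst).prodMk measurable_snd)).sub
    ((h.measurable_mean hD k).comp (hw.comp measurable_fst))

lemma IsOracle.measurable_stormNoise (h : IsOracle D L r v O M) (hD : D.WellPosed) {P : Type*}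
    [MeasurableSpace P] {w w' : P → Pt dx dy} (hw : Measurable w) (hw' : Measurable w') (a : ℝ)
    (k : Fin K) : Measurable (Function.uncurry fun p q => stormNoise O M a k (w p) (w' p) q) :=
  (h.measurable_odev hD hw' k).sub ((h.measurable_odev hD hw k).const_smul (1 - a))

lemma IsOracle.norm_stormNoise_sq_le (h : IsOracle D L r v O M) (hD : D.WellPosed) (a : ℝ)
    (k : Fin K) {w w' : Pt dx dy} (hw : ‖w.2.2‖ ≤ r) (hw' : ‖w'.2.2‖ ≤ r) (q : Sf × Sg) :
    ‖stormNoise O M a k w w' q‖ ^ 2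
      ≤ 8 * L ^ 2 * dsq w w' + 2 * a ^ 2 * ‖odev O M k w q‖ ^ 2 := by
  have e : stormNoise O M a k w w' q
      = (-(O k w q - O k w' q) + (M k w - M k w')) + a • odev O M k w q := by
    simp only [stormNoise, odev]; module
  have h1 := h.lip k q w w' hw hw'
  have h2 := h.mean_lip hD k w w' hw hw'
  have h3 : ‖-(O k w q - O k w' q) + (M k w - M k w')‖ ≤ 2 * (L * √(dsq w w')) :=
    (norm_add_le _ _).trans (by rw [norm_neg]; linarith)
  have h4 := pow_le_pow_left₀ (norm_nonneg _) h3 2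
  have h5 : (2 * (L * √(dsq w w'))) ^ 2 = 4 * L ^ 2 * dsq w w' := by
    rw [mul_pow, mul_pow, Real.sq_sqrt (dsq_nonneg w w')]; ring
  rw [e]
  refine (norm_add_sq_le_two _ _).trans ?_
  rw [norm_smul, mul_pow, Real.norm_eq_abs, sq_abs]
  linarith

variable {Ω : Type*} [mΩ : MeasurableSpace Ω] {Pr : Measure Ω}
  {s : ℕ → Fin K → ℕ → Ω → Sf × Sg}

lemma IsSampling.indep_past (hs : IsSampling D Pr s) (t : ℕ) (k : Fin K) (b : ℕ) :
    Indep (past s t) (MeasurableSpace.comap (s t k b) inferInstance) Pr :=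
  indep_of_indep_of_le_left (hs.indep_others t k b) (past_le_sampleAlg_ne t k b)

lemma IsSampling.measurable_of_past (hs : IsSampling D Pr s) {t : ℕ} {V : Type*}
    [MeasurableSpace V] {X : Ω → V} (hX : Measurable[past s t] X) : Measurable X :=
  hX.mono (hs.sampleAlg_le _) le_rfl

variable [IsProbabilityMeasure Pr]

/-- The deviation of a fresh sample at a query point determined by the past. -/
lemma IsOracle.odev_memLp (h : IsOracle D L r v O M) (hD : D.WellPosed) (hs : IsSampling D Pr s)
    {t : ℕ} {k : Fin K} {w : Ω → Pt dx dy} (hw : Measurable[past s t] w)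
    (hwr : ∀ ω, ‖(w ω).2.2‖ ≤ r) (b : ℕ) :
    MemLp (fun ω => odev O M k (w ω) (s t k b ω)) 2 Pr ∧
      ∫ ω, ‖odev O M k (w ω) (s t k b ω)‖ ^ 2 ∂Pr ≤ v ^ 2 := by
  have hm := @IsOracle.measurable_odev K dx dy n Sf Sg _ _ D L r v O M h hD Ω (past s t) w hw k
  have hm1 : AEStronglyMeasurable (fun ω => odev O M k (w ω) (s t k b ω)) Pr :=
    ((h.measurable_odev hD (hs.measurable_of_past hw) k).comp
      (measurable_id.prodMk (hs.measurable t k b))).aestronglyMeasurable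
  have h1 : ∫⁻ ω, ‖odev O M k (w ω) (s t k b ω)‖ₑ ^ 2 ∂Pr ≤ ENNReal.ofReal (v ^ 2) := by
    refine lintegral_le_of_indep (m := past s t) (G := fun ω q => ‖odev O M k (w ω) q‖ₑ ^ 2)
      (hs.sampleAlg_le _) (hs.measurable t k b) (hs.indep_past t k b)
      ((measurable_enorm.comp hm).pow_const 2) fun ω => ?_
    obtain ⟨h2, h3⟩ := h.var k (w ω) _ (hs.map_fst t k b) (hs.map_snd t k b) (hwr ω)
    have h4 : ∫⁻ q, ‖odev O M k (w ω) q‖ₑ ^ 2 ∂(Pr.map (s t k b))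
        = ENNReal.ofReal (∫ q, ‖O k (w ω) q - M k (w ω)‖ ^ 2 ∂(Pr.map (s t k b))) := by
      rw [ofReal_integral_eq_lintegral_ofReal (h2.integrable_norm_pow (by norm_num : 2 ≠ 0))
        (Filter.Eventually.of_forall fun q => by positivity)]
      refine lintegral_congr fun q => ?_
      rw [ENNReal.ofReal_pow (norm_nonneg _), ofReal_norm]; rfl
    rw [h4]
    exact ENNReal.ofReal_le_ofReal h3
  exact ⟨memLp_two_of_lintegral_le hm1 h1,
    integral_sq_le_of_lintegral_le hm1 (sq_nonneg v) h1⟩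

/-- Query points before and after an update, both determined by the samples before iteration `t`,
in the domain of the oracles and with square-integrable distance. -/
structure IsMove (Pr : Measure Ω) (s : ℕ → Fin K → ℕ → Ω → Sf × Sg) (r : ℝ) (t : ℕ)
    (w w' : Fin K → Ω → Pt dx dy) : Prop where
  meas : ∀ k, Measurable[past s t] (w k)
  meas' : ∀ k, Measurable[past s t] (w' k)
  mem : ∀ k ω, ‖(w k ω).2.2‖ ≤ r
  mem' : ∀ k ω, ‖(w' k ω).2.2‖ ≤ r
  int : ∀ k, Integrable (fun ω => dsq (w k ω) (w' k ω)) Pr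

variable {t : ℕ} {w w' : Fin K → Ω → Pt dx dy}

section Noise

variable (h : IsOracle D L r v O M) (hD : D.WellPosed) (hs : IsSampling D Pr s)
  (hw : IsMove Pr s r t w w')
include h hD hs hw

lemma stormNoise_memLp (a : ℝ) (k : Fin K) (b : ℕ) :
    MemLp (fun ω => stormNoise O M a k (w k ω) (w' k ω) (s t k b ω)) 2 Pr :=
  (h.odev_memLp hD hs (hw.meas' k) (hw.mem' k) b).1.sub
    ((h.odev_memLp hD hs (hw.meas k) (hw.mem k) b).1.const_smul (1 - a))

lemma integral_stormNoise_sq_le (a : ℝ) (k : Fin K) (b : ℕ) :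
    ∫ ω, ‖stormNoise O M a k (w k ω) (w' k ω) (s t k b ω)‖ ^ 2 ∂Pr
      ≤ 8 * L ^ 2 * ∫ ω, dsq (w k ω) (w' k ω) ∂Pr + 2 * a ^ 2 * v ^ 2 := by
  obtain ⟨h1, h2⟩ := h.odev_memLp hD hs (hw.meas k) (hw.mem k) b
  have i1 := (hw.int k).const_mul (8 * L ^ 2)
  have i2 := (h1.integrable_norm_pow (by norm_num : 2 ≠ 0)).const_mul (2 * a ^ 2)
  have h3 := integral_mono ((stormNoise_memLp h hD hs hw a k b).integrable_norm_pow
    (by norm_num : 2 ≠ 0)) (i1.add i2)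
    (fun ω => h.norm_stormNoise_sq_le hD a k (hw.mem k ω) (hw.mem' k ω) (s t k b ω))
  refine h3.trans ?_
  simp only [Pi.add_apply]
  rw [integral_add i1 i2, integral_const_mul, integral_const_mul]
  gcongr

lemma integral_inner_stormNoise {A : Set (ℕ × Fin K × ℕ)} (a : ℝ) (k : Fin K) (b : ℕ)
    (hA : A ⊆ {i | i ≠ (t, k, b)}) {Φ : Ω → Vec n} (hΦ : Measurable[sampleAlg s A] Φ)
    (hΦ2 : MemLp Φ 2 Pr) :
    ∫ ω, ⟪Φ ω, stormNoise O M a k (w k ω) (w' k ω) (s t k b ω)⟫ ∂Pr = 0 := by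
  have := Measure.isProbabilityMeasure_map (μ := Pr) (hs.measurable t k b).aemeasurable
  have hle := past_le_sampleAlg_ne (s := s) t k b
  have hi : ∀ w, Integrable (odev O M k w) (Pr.map (s t k b)) := fun w =>
    (h.int k w _ (hs.map_fst t k b) (hs.map_snd t k b)).sub (integrable_const _)
  have h0 : ∀ w, ∫ q, odev O M k w q ∂(Pr.map (s t k b)) = 0 := fun w => by
    unfold odev
    rw [integral_sub (h.int k w _ (hs.map_fst t k b) (hs.map_snd t k b)) (integrable_const _),
      h.mean k w _ (hs.map_fst t k b) (hs.map_snd t k b)]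
    simp
  refine integral_inner_eq_zero_of_indep (m := sampleAlg s {i | i ≠ (t, k, b)})
    (N := fun ω q => stormNoise O M a k (w k ω) (w' k ω) q) (hs.sampleAlg_le _)
    (hs.measurable t k b) (hs.indep_others t k b) (hΦ.mono (sampleAlg_mono hA) le_rfl) ?_ ?_ ?_
    hΦ2 (stormNoise_memLp h hD hs hw a k b)
  · exact @IsOracle.measurable_stormNoise K dx dy n Sf Sg _ _ D L r v O M h hD Ω
      (sampleAlg s {i | i ≠ (t, k, b)}) _ _ ((hw.meas k).mono hle le_rfl) ((hw.meas' k).mono hle le_rfl) a k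
  · exact fun ω => (hi _).sub ((hi _).smul (1 - a))
  · intro ω
    unfold stormNoise
    rw [integral_sub (f := fun q => odev O M k (w' k ω) q)
      (g := fun q => (1 - a) • odev O M k (w k ω) q) (hi _) ((hi _).smul (1 - a)), integral_smul, h0, h0, smul_zero, sub_zero]

lemma integral_inner_past_stormNoise (a : ℝ) (k : Fin K) (b : ℕ)
    {Φ : Ω → Vec n} (hΦ : Measurable[past s t] Φ) (hΦ2 : MemLp Φ 2 Pr) :
    ∫ ω, ⟪Φ ω, stormNoise O M a k (w k ω) (w' k ω) (s t k b ω)⟫ ∂Pr = 0 :=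
  integral_inner_stormNoise h hD hs hw a k b (fun i (hi : i.1 < t) he => by
    rw [he] at hi; exact lt_irrefl t hi) hΦ hΦ2

lemma integral_inner_stormNoise_stormNoise (a : ℝ) {k k' : Fin K} {b b' : ℕ}
    (hne : (k, b) ≠ (k', b')) :
    ∫ ω, ⟪stormNoise O M a k (w k ω) (w' k ω) (s t k b ω),
      stormNoise O M a k' (w k' ω) (w' k' ω) (s t k' b' ω)⟫ ∂Pr = 0 := by
  refine integral_inner_stormNoise (A := {i | i ≠ (t, k', b')}) h hD hs hw a k' b' le_rfl ?_
    (stormNoise_memLp h hD hs hw a k b)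
  have hle := past_le_sampleAlg_ne (s := s) t k' b'
  have h1 := @IsOracle.measurable_stormNoise K dx dy n Sf Sg _ _ D L r v O M h hD Ω
    (sampleAlg s {i | i ≠ (t, k', b')}) _ _
      ((hw.meas k).mono hle le_rfl) ((hw.meas' k).mono hle le_rfl) a k
  have h2 : Measurable[sampleAlg s {i | i ≠ (t, k', b')}] (s t k b) :=
    measurable_sample (by
      intro he
      simp only [Prod.mk.injEq, true_and] at he
      exact hne (by rw [he.1, he.2]))
  exact h1.comp (Measurable.prodMk (measurable_id) h2)

end Noise

/-- The error of a recursive estimator after an update: `e` is the error before it. -/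
def stormErr (O : Fin K → Pt dx dy → Sf × Sg → Vec n) (M : Fin K → Pt dx dy → Vec n) (a : ℝ)
    (B : ℕ) (w w' : Fin K → Pt dx dy) (e : Fin K → Vec n) (q : Fin K → ℕ → Sf × Sg)
    (k : Fin K) : Vec n :=
  (1 - a) • e k + (1 / (B : ℝ)) • ∑ b ∈ range B, stormNoise O M a k (w k) (w' k) (q k b)

section Step

variable (h : IsOracle D L r v O M) (hD : D.WellPosed) (hs : IsSampling D Pr s)
  (hw : IsMove Pr s r t w w') {a : ℝ} {B : ℕ} {e : Fin K → Ω → Vec n}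
include h hD hs hw

lemma stormErr_memLp (a : ℝ) (B : ℕ) (he2 : ∀ k, MemLp (e k) 2 Pr) (k : Fin K) :
    MemLp (fun ω => stormErr O M a B (fun k => w k ω) (fun k => w' k ω) (fun k => e k ω)
      (fun k b => s t k b ω) k) 2 Pr :=
  ((he2 k).const_smul (1 - a)).add
    ((memLp_finsetSum _ fun b _ => stormNoise_memLp h hD hs hw a k b).const_smul (1 / (B : ℝ)))

/-- Recursion for the mean error of the workers. -/
lemma integral_msq_stormErr_le (ha0 : 0 ≤ a) (ha1 : a ≤ 1) (hB : 1 ≤ B)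
    (he : ∀ k, Measurable[past s t] (e k)) (he2 : ∀ k, MemLp (e k) 2 Pr) :
    ∫ ω, msq (stormErr O M a B (fun k => w k ω) (fun k => w' k ω) (fun k => e k ω)
        (fun k b => s t k b ω)) ∂Pr
      ≤ (1 - a) * ∫ ω, msq (fun k => e k ω) ∂Pr + 1 / (B : ℝ) *
        (8 * L ^ 2 * ∫ ω, (1 / (K : ℝ)) * ∑ k, dsq (w k ω) (w' k ω) ∂Pr + 2 * a ^ 2 * v ^ 2) := by
  have hB0 : (0 : ℝ) < B := by positivity
  have h1 : ∀ k, ∫ ω, ‖stormErr O M a B (fun k => w k ω) (fun k => w' k ω) (fun k => e k ω)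
        (fun k b => s t k b ω) k‖ ^ 2 ∂Pr ≤ (1 - a) * ∫ ω, ‖e k ω‖ ^ 2 ∂Pr + 1 / (B : ℝ) *
        (8 * L ^ 2 * ∫ ω, dsq (w k ω) (w' k ω) ∂Pr + 2 * a ^ 2 * v ^ 2) := by
    intro k
    have e1 := integral_norm_sq_add_sum (range B) (Φ := fun ω => (1 - a) • e k ω)
      (N := fun b ω => stormNoise O M a k (w k ω) (w' k ω) (s t k b ω)) (1 / (B : ℝ))
      ((he2 k).const_smul (1 - a)) (fun b _ => stormNoise_memLp h hD hs hw a k b)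
      (fun b _ => integral_inner_past_stormNoise h hD hs hw a k b ((he k).const_smul (1 - a))
        ((he2 k).const_smul (1 - a)))
      (fun b _ b' _ hne => integral_inner_stormNoise_stormNoise h hD hs hw a
        (by simpa using hne))
    unfold stormErr
    rw [e1]
    have e2 : ∫ ω, ‖(1 - a) • e k ω‖ ^ 2 ∂Pr = (1 - a) ^ 2 * ∫ ω, ‖e k ω‖ ^ 2 ∂Pr := by
      rw [← integral_const_mul]
      simp only [norm_smul, mul_pow, Real.norm_eq_abs, sq_abs]
    have e3 : (0 : ℝ) ≤ ∫ ω, ‖e k ω‖ ^ 2 ∂Pr := integral_nonneg fun ω => by positivity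
    have e4 := sum_le_sum (s := range B) fun b _ => integral_stormNoise_sq_le h hD hs hw a k b
    rw [sum_const, card_range, nsmul_eq_mul] at e4
    rw [e2]
    refine add_le_add (by nlinarith [mul_nonneg ha0 (by linarith : 0 ≤ 1 - a)])
      ((mul_le_mul_of_nonneg_left e4 (by positivity)).trans (le_of_eq ?_))
    field_simp
  have i1 : ∀ k ∈ (univ : Finset (Fin K)), Integrable (fun ω => ‖stormErr O M a B (fun k => w k ω)
      (fun k => w' k ω) (fun k => e k ω) (fun k b => s t k b ω) k‖ ^ 2) Pr := fun k _ =>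
    (stormErr_memLp h hD hs hw a B he2 k).integrable_norm_pow (by norm_num)
  have i2 : ∀ k ∈ (univ : Finset (Fin K)), Integrable (fun ω => ‖e k ω‖ ^ 2) Pr := fun k _ =>
    (he2 k).integrable_norm_pow (by norm_num)
  unfold msq
  rw [integral_const_mul, integral_const_mul, integral_const_mul, integral_finsetSum _ i1,
    integral_finsetSum _ i2, integral_finsetSum _ (fun k _ => hw.int k)]
  rcases Nat.eq_zero_or_pos K with hK | hK
  · subst hK
    simp
    positivity
  have h2 := mul_le_mul_of_nonneg_left (sum_le_sum (s := univ) fun k _ => h1 k)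
    (by positivity : (0 : ℝ) ≤ 1 / K)
  refine h2.trans (le_of_eq ?_)
  have hK0 : (K : ℝ) ≠ 0 := by positivity
  simp only [sum_add_distrib, ← mul_sum, sum_const, card_univ, Fintype.card_fin, nsmul_eq_mul]
  field_simp

/-- Recursion for the error of the average estimator: the noises of the workers are orthogonal,
which gains a factor `1/K`. -/
lemma integral_mean_stormErr_le (hK : 1 ≤ K) (ha0 : 0 ≤ a) (ha1 : a ≤ 1) (hB : 1 ≤ B)
    (he : ∀ k, Measurable[past s t] (e k)) (he2 : ∀ k, MemLp (e k) 2 Pr) :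
    ∫ ω, ‖mean (stormErr O M a B (fun k => w k ω) (fun k => w' k ω) (fun k => e k ω)
        (fun k b => s t k b ω))‖ ^ 2 ∂Pr
      ≤ (1 - a) * ∫ ω, ‖mean (fun k => e k ω)‖ ^ 2 ∂Pr + 1 / ((K : ℝ) * B) *
        (8 * L ^ 2 * ∫ ω, (1 / (K : ℝ)) * ∑ k, dsq (w k ω) (w' k ω) ∂Pr + 2 * a ^ 2 * v ^ 2) := by
  have hB0 : (0 : ℝ) < B := by positivity
  have hK0 : (0 : ℝ) < K := by positivity
  have hm2 : MemLp (fun ω => mean (fun k => e k ω)) 2 Pr :=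
    (memLp_finsetSum _ fun k _ => he2 k).const_smul (1 / (K : ℝ))
  have hm : Measurable[past s t] (fun ω => mean (fun k => e k ω)) :=
    (Finset.measurable_fun_sum (m := past s t) _ fun k _ => he k).const_smul (1 / (K : ℝ))
  have e1 := integral_norm_sq_add_sum (univ ×ˢ range B)
    (Φ := fun ω => (1 - a) • mean (fun k => e k ω))
    (N := fun j ω => stormNoise O M a j.1 (w j.1 ω) (w' j.1 ω) (s t j.1 j.2 ω))
    (1 / ((K : ℝ) * B)) (hm2.const_smul (1 - a))
    (fun j _ => stormNoise_memLp h hD hs hw a j.1 j.2)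
    (fun j _ => integral_inner_past_stormNoise h hD hs hw a j.1 j.2 (hm.const_smul (1 - a))
      (hm2.const_smul (1 - a)))
    (fun j _ j' _ hne => integral_inner_stormNoise_stormNoise h hD hs hw a hne)
  have e0 : ∀ ω, mean (stormErr O M a B (fun k => w k ω) (fun k => w' k ω) (fun k => e k ω)
      (fun k b => s t k b ω)) = (1 - a) • mean (fun k => e k ω) + (1 / ((K : ℝ) * B)) •
        ∑ j ∈ univ ×ˢ range B, stormNoise O M a j.1 (w j.1 ω) (w' j.1 ω) (s t j.1 j.2 ω) := by
    intro ω
    unfold stormErr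
    have e1 : mean (fun k => ∑ b ∈ range B, stormNoise O M a k (w k ω) (w' k ω) (s t k b ω))
      = (1 / (K : ℝ)) • ∑ k, ∑ b ∈ range B, stormNoise O M a k (w k ω) (w' k ω) (s t k b ω) := rfl
    rw [mean_add, mean_smul, mean_smul, sum_product, e1, smul_smul]
    congr 2
    field_simp
  simp only [e0]
  rw [e1]
  have e2 : ∫ ω, ‖(1 - a) • mean (fun k => e k ω)‖ ^ 2 ∂Pr
      = (1 - a) ^ 2 * ∫ ω, ‖mean (fun k => e k ω)‖ ^ 2 ∂Pr := by
    rw [← integral_const_mul]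
    simp only [norm_smul, mul_pow, Real.norm_eq_abs, sq_abs]
  have e3 : (0 : ℝ) ≤ ∫ ω, ‖mean (fun k => e k ω)‖ ^ 2 ∂Pr :=
    integral_nonneg fun ω => by positivity
  have e4 := sum_le_sum (s := univ ×ˢ range B) fun (j : Fin K × ℕ) _ =>
    integral_stormNoise_sq_le h hD hs hw a j.1 j.2
  rw [e2]
  refine add_le_add (by nlinarith [mul_nonneg ha0 (by linarith : 0 ≤ 1 - a)])
      ((mul_le_mul_of_nonneg_left e4 (by positivity)).trans (le_of_eq ?_))
  rw [integral_const_mul, integral_finsetSum _ (fun k _ => hw.int k), sum_product]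
  simp only [sum_add_distrib, ← mul_sum, sum_const, card_univ, Fintype.card_fin, nsmul_eq_mul,
    card_range]
  field_simp

end Step

/-- Mini-batch average of the oracle at the columns of `w`. -/
def batchAvg (O : Fin K → Pt dx dy → Sf × Sg → Vec n) (B : ℕ) (q : Fin K → ℕ → Sf × Sg)
    (w : Fin K → Pt dx dy) (k : Fin K) : Vec n :=
  (1 / (B : ℝ)) • ∑ b ∈ range B, O k (w k) (q k b)

omit [MeasurableSpace Sf] [MeasurableSpace Sg] in
lemma batchAvg_sub_mean {B : ℕ} (hB : 1 ≤ B) (q : Fin K → ℕ → Sf × Sg) (w : Fin K → Pt dx dy)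
    (k : Fin K) : batchAvg O B q w k - M k (w k)
      = (1 / (B : ℝ)) • ∑ b ∈ range B, odev O M k (w k) (q k b) := by
  have hB0 : (B : ℝ) ≠ 0 := by positivity
  simp only [batchAvg, odev, sum_sub_distrib, smul_sub, sum_const, card_range,
    ← Nat.cast_smul_eq_nsmul ℝ, smul_smul, one_div_mul_cancel hB0, one_smul]

omit [MeasurableSpace Sf] [MeasurableSpace Sg] in
/-- The recursive estimator with weight `a` has the error `stormErr`. -/
lemma storm_sub_mean {B : ℕ} (hB : 1 ≤ B) (a : ℝ) (q : Fin K → ℕ → Sf × Sg)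
    (w w' : Fin K → Pt dx dy) (U : Fin K → Vec n) (k : Fin K) :
    (1 - a) • (U k - batchAvg O B q w k) + batchAvg O B q w' k - M k (w' k)
      = stormErr O M a B w w' (fun k => U k - M k (w k)) q k := by
  have h1 := batchAvg_sub_mean (O := O) (M := M) hB q w k
  have h2 := batchAvg_sub_mean (O := O) (M := M) hB q w' k
  have h3 : stormErr O M a B w w' (fun k => U k - M k (w k)) q k
      = (1 - a) • (U k - M k (w k)) + ((batchAvg O B q w' k - M k (w' k))
        - (1 - a) • (batchAvg O B q w k - M k (w k))) := by
    rw [h1, h2, ← smul_comm (1 / (B : ℝ)) (1 - a), ← smul_sub, smul_sum, ← sum_sub_distrib]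
    rfl
  rw [h3]
  module

omit [MeasurableSpace Sf] [MeasurableSpace Sg] in
/-- Increment of the recursive estimator. -/
lemma storm_sub {B : ℕ} (a : ℝ) (q : Fin K → ℕ → Sf × Sg)
    (w w' : Fin K → Pt dx dy) (U : Fin K → Vec n) (k : Fin K) :
    (1 - a) • (U k - batchAvg O B q w k) + batchAvg O B q w' k - U k
      = -(a • (U k - M k (w k))) + (a • (batchAvg O B q w k - M k (w k))
        + (batchAvg O B q w' k - batchAvg O B q w k)) := by
  module

lemma norm_avg_sq_le {B : ℕ} (hB : 1 ≤ B) (X : ℕ → Vec n) :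
    ‖(1 / (B : ℝ)) • ∑ b ∈ range B, X b‖ ^ 2 ≤ (1 / (B : ℝ)) * ∑ b ∈ range B, ‖X b‖ ^ 2 := by
  have h1 := norm_mean_sq_le hB (fun b : Fin B => X b)
  unfold mean msq at h1
  rwa [Fin.sum_univ_eq_sum_range X B, Fin.sum_univ_eq_sum_range (fun b => ‖X b‖ ^ 2) B] at h1

lemma IsOracle.norm_batchAvg_sub_sq_le (h : IsOracle D L r v O M) {B : ℕ} (hB : 1 ≤ B)
    (q : Fin K → ℕ → Sf × Sg) {w w' : Fin K → Pt dx dy} (k : Fin K) (hw : ‖(w k).2.2‖ ≤ r)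
    (hw' : ‖(w' k).2.2‖ ≤ r) : ‖batchAvg O B q w' k - batchAvg O B q w k‖ ^ 2
      ≤ L ^ 2 * dsq (w k) (w' k) := by
  have hB0 : (0 : ℝ) < B := by positivity
  have e : batchAvg O B q w' k - batchAvg O B q w k
      = (1 / (B : ℝ)) • ∑ b ∈ range B, (O k (w' k) (q k b) - O k (w k) (q k b)) := by
    simp only [batchAvg, sum_sub_distrib, smul_sub]
  have h1 : ∀ b ∈ range B, ‖O k (w' k) (q k b) - O k (w k) (q k b)‖ ^ 2
      ≤ L ^ 2 * dsq (w k) (w' k) := fun b _ => by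
    have h2 := h.lip k (q k b) (w k) (w' k) hw hw'
    rw [norm_sub_rev] at h2
    have h3 := pow_le_pow_left₀ (norm_nonneg _) h2 2
    rwa [mul_pow, Real.sq_sqrt (dsq_nonneg _ _)] at h3
  rw [e]
  refine (norm_avg_sq_le hB (fun b => O k (w' k) (q k b) - O k (w k) (q k b))).trans ?_
  have h2 := sum_le_sum h1
  rw [sum_const, card_range, nsmul_eq_mul] at h2
  refine (mul_le_mul_of_nonneg_left h2 (by positivity)).trans (le_of_eq (by field_simp))

section Increment

variable (h : IsOracle D L r v O M) (hD : D.WellPosed) (hs : IsSampling D Pr s)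
  (hw : IsMove Pr s r t w w') {a : ℝ} {B : ℕ} {U : Fin K → Ω → Vec n}
include h hD hs hw

lemma batchAvg_sub_mean_memLp (hB : 1 ≤ B) (k : Fin K) :
    MemLp (fun ω => batchAvg O B (fun k b => s t k b ω) (fun k => w k ω) k - M k (w k ω)) 2 Pr ∧
    ∫ ω, ‖batchAvg O B (fun k b => s t k b ω) (fun k => w k ω) k - M k (w k ω)‖ ^ 2 ∂Pr
      ≤ v ^ 2 := by
  have hB0 : (0 : ℝ) < B := by positivity
  have h0 := fun b => h.odev_memLp (k := k) hD hs (hw.meas k) (hw.mem k) b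
  have h1 : MemLp (fun ω => (1 / (B : ℝ)) • ∑ b ∈ range B, odev O M k (w k ω) (s t k b ω)) 2 Pr :=
    (memLp_finsetSum (range B) fun b _ => (h0 b).1).const_smul (1 / (B : ℝ))
  have e := fun ω => batchAvg_sub_mean (O := O) (M := M) hB (fun k b => s t k b ω)
    (fun k => w k ω) k
  simp only [e]
  refine ⟨h1, ?_⟩
  have i1 : ∀ b ∈ range B, Integrable (fun ω => ‖odev O M k (w k ω) (s t k b ω)‖ ^ 2) Pr :=
    fun b _ => (h0 b).1.integrable_norm_pow (by norm_num)
  have h2 := integral_mono (h1.integrable_norm_pow (by norm_num : 2 ≠ 0))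
    ((integrable_finsetSum _ i1).const_mul (1 / (B : ℝ)))
    (fun ω => norm_avg_sq_le hB fun b => odev O M k (w k ω) (s t k b ω))
  refine h2.trans ?_
  rw [integral_const_mul, integral_finsetSum _ i1]
  have h3 := sum_le_sum (s := range B) fun b _ => (h0 b).2
  rw [sum_const, card_range, nsmul_eq_mul] at h3
  refine (mul_le_mul_of_nonneg_left h3 (by positivity)).trans (le_of_eq (by field_simp))

/-- Second moment of the increment of the recursive estimator. -/
lemma storm_increment (hB : 1 ≤ B) (hU : ∀ k, MemLp (fun ω => U k ω - M k (w k ω)) 2 Pr) :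
    (∀ k, MemLp (fun ω => (1 - a) • (U k ω - batchAvg O B (fun k b => s t k b ω)
      (fun k => w k ω) k) + batchAvg O B (fun k b => s t k b ω) (fun k => w' k ω) k - U k ω) 2 Pr) ∧
    ∫ ω, msq (fun k => (1 - a) • (U k ω - batchAvg O B (fun k b => s t k b ω)
      (fun k => w k ω) k) + batchAvg O B (fun k b => s t k b ω) (fun k => w' k ω) k - U k ω) ∂Pr
      ≤ 3 * a ^ 2 * ∫ ω, msq (fun k => U k ω - M k (w k ω)) ∂Pr + 3 * a ^ 2 * v ^ 2
        + 3 * L ^ 2 * ∫ ω, (1 / (K : ℝ)) * ∑ k, dsq (w k ω) (w' k ω) ∂Pr := by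
  have h0 := fun k => batchAvg_sub_mean_memLp h hD hs hw hB k
  have hmw : ∀ k, Measurable (w k) := fun k => hs.measurable_of_past (hw.meas k)
  have hmw' : ∀ k, Measurable (w' k) := fun k => hs.measurable_of_past (hw.meas' k)
  have hmO : ∀ (x : Fin K → Ω → Pt dx dy), (∀ k, Measurable (x k)) → ∀ k, Measurable
      (fun ω => batchAvg O B (fun k b => s t k b ω) (fun k => x k ω) k) := fun x hx k =>
    (Finset.measurable_fun_sum _ fun b _ => (h.meas k).comp
      ((hx k).prodMk (hs.measurable t k b))).const_smul (1 / (B : ℝ))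
  have hd : ∀ k, MemLp (fun ω => batchAvg O B (fun k b => s t k b ω) (fun k => w' k ω) k
      - batchAvg O B (fun k b => s t k b ω) (fun k => w k ω) k) 2 Pr := fun k => by
    have hm := ((hmO w' hmw' k).sub (hmO w hmw k)).aestronglyMeasurable (μ := Pr)
    refine (memLp_two_iff_integrable_sq_norm hm).2 ?_
    refine ((hw.int k).const_mul (L ^ 2)).mono' (hm.norm.pow 2)
      (Filter.Eventually.of_forall fun ω => ?_)
    rw [Real.norm_of_nonneg (by positivity)]
    exact h.norm_batchAvg_sub_sq_le hB _ k (hw.mem k ω) (hw.mem' k ω)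
  have e := fun k ω => storm_sub (O := O) (M := M) (B := B) a (fun k b => s t k b ω)
    (fun k => w k ω) (fun k => w' k ω) (fun k => U k ω) k
  simp only [e]
  have hmem : ∀ k, MemLp (fun ω => -(a • (U k ω - M k (w k ω)))
      + (a • (batchAvg O B (fun k b => s t k b ω) (fun k => w k ω) k - M k (w k ω))
        + (batchAvg O B (fun k b => s t k b ω) (fun k => w' k ω) k
          - batchAvg O B (fun k b => s t k b ω) (fun k => w k ω) k))) 2 Pr := fun k =>
    ((hU k).const_smul a).neg.add (((h0 k).1.const_smul a).add (hd k))
  refine ⟨hmem, ?_⟩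
  have h1 : ∀ k, ∫ ω, ‖-(a • (U k ω - M k (w k ω)))
      + (a • (batchAvg O B (fun k b => s t k b ω) (fun k => w k ω) k - M k (w k ω))
        + (batchAvg O B (fun k b => s t k b ω) (fun k => w' k ω) k
          - batchAvg O B (fun k b => s t k b ω) (fun k => w k ω) k))‖ ^ 2 ∂Pr
      ≤ 3 * a ^ 2 * ∫ ω, ‖U k ω - M k (w k ω)‖ ^ 2 ∂Pr + 3 * a ^ 2 * v ^ 2
        + 3 * L ^ 2 * ∫ ω, dsq (w k ω) (w' k ω) ∂Pr := by
    intro k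
    have i1 := ((hU k).integrable_norm_pow (by norm_num : 2 ≠ 0)).const_mul (3 * a ^ 2)
    have i2 := ((h0 k).1.integrable_norm_pow (by norm_num : 2 ≠ 0)).const_mul (3 * a ^ 2)
    have i3 := (hw.int k).const_mul (3 * L ^ 2)
    have h2 := integral_mono ((hmem k).integrable_norm_pow (by norm_num : 2 ≠ 0))
      ((i1.add i2).add i3) (fun ω => ?_)
    · refine h2.trans ?_
      simp only [Pi.add_apply]
      rw [integral_add (by exact i1.add i2) i3, integral_add i1 i2, integral_const_mul,
        integral_const_mul, integral_const_mul]
      gcongr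
      exact (h0 k).2
    · simp only [Pi.add_apply]
      have e1 := h.norm_batchAvg_sub_sq_le hB (fun k b => s t k b ω) (w := fun k => w k ω)
        (w' := fun k => w' k ω) k (hw.mem k ω) (hw.mem' k ω)
      set x := U k ω - M k (w k ω)
      set y := batchAvg O B (fun k b => s t k b ω) (fun k => w k ω) k - M k (w k ω)
      set z := batchAvg O B (fun k b => s t k b ω) (fun k => w' k ω) k
          - batchAvg O B (fun k b => s t k b ω) (fun k => w k ω) k
      have e2 : ‖-(a • x) + (a • y + z)‖ ≤ |a| * ‖x‖ + (|a| * ‖y‖ + ‖z‖) := by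
        refine (norm_add_le _ _).trans (add_le_add (le_of_eq ?_) ((norm_add_le _ _).trans
          (le_of_eq ?_)))
        · rw [norm_neg, norm_smul, Real.norm_eq_abs]
        · rw [norm_smul, Real.norm_eq_abs]
      have e3 := pow_le_pow_left₀ (norm_nonneg _) e2 2
      have e4 := sq_abs a
      rw [← e4]
      nlinarith [sq_nonneg (|a| * ‖x‖ - |a| * ‖y‖), sq_nonneg (|a| * ‖x‖ - ‖z‖),
        sq_nonneg (|a| * ‖y‖ - ‖z‖)]
  unfold msq
  rw [integral_const_mul, integral_const_mul, integral_const_mul,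
    integral_finsetSum _ (fun k _ => (hmem k).integrable_norm_pow (by norm_num)),
    integral_finsetSum _ (fun k _ => (hU k).integrable_norm_pow (by norm_num)),
    integral_finsetSum _ (fun k _ => hw.int k)]
  rcases Nat.eq_zero_or_pos K with hK | hK
  · subst hK
    simp
    positivity
  have h2 := mul_le_mul_of_nonneg_left (sum_le_sum (s := univ) fun k _ => h1 k)
    (by positivity : (0 : ℝ) ≤ 1 / K)
  refine h2.trans (le_of_eq ?_)
  have hK0 : (K : ℝ) ≠ 0 := by positivity
  simp only [sum_add_distrib, ← mul_sum, sum_const, card_univ, Fintype.card_fin, nsmul_eq_mul]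
  field_simp

end Increment

end Storm

/-! ### The landscape of the averaged problem -/

/-- The properties of the averaged problem on which the analysis of the algorithm rests, with a
single constant `L` and on the ball `‖z‖ ≤ r`: Lipschitz mean oracles, strong monotonicity of the
two inner problems around their Lipschitz solution maps, and a first-order expansion of `F`. -/
structure Problem.Landscape {K dx dy : ℕ} {Sf Sg : Type*} [MeasurableSpace Sf] [MeasurableSpace Sg]
    (D : Problem K dx dy Sf Sg) (L r : ℝ) : Prop where
  one_le : 1 ≤ L
  radius_nonneg : 0 ≤ r
  lipF : ∀ k w w', ‖w.2.2‖ ≤ r → ‖w'.2.2‖ ≤ r → ‖D.meanF k w - D.meanF k w'‖ ≤ L * √(dsq w w')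
  lipG : ∀ k w w', ‖w.2.2‖ ≤ r → ‖w'.2.2‖ ≤ r → ‖D.meanG k w - D.meanG k w'‖ ≤ L * √(dsq w w')
  lipH : ∀ k w w', ‖w.2.2‖ ≤ r → ‖w'.2.2‖ ≤ r → ‖D.meanH k w - D.meanH k w'‖ ≤ L * √(dsq w w')
  norm_zStar_le : ∀ x, ‖D.zStar x‖ ≤ r
  y_zero : ∀ x z, mean (fun k => D.meanG k (x, D.yStar x, z)) = 0
  z_zero : ∀ x, mean (fun k => D.meanH k (x, D.yStar x, D.zStar x)) = 0
  y_mono : ∀ x y z, 1 / L * ‖y - D.yStar x‖ ^ 2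
    ≤ ⟪mean (fun k => D.meanG k (x, y, z)), y - D.yStar x⟫
  z_mono : ∀ x z, 1 / L * ‖z - D.zStar x‖ ^ 2
    ≤ ⟪mean (fun k => D.meanH k (x, D.yStar x, z)), z - D.zStar x⟫
  y_lip : ∀ x x', ‖D.yStar x - D.yStar x'‖ ≤ L * ‖x - x'‖
  z_lip : ∀ x x', ‖D.zStar x - D.zStar x'‖ ≤ L * ‖x - x'‖
  expansion : ∀ x x', |D.F x' - D.F x - ⟪D.hyperGrad x, x' - x⟫| ≤ L * ‖x' - x‖ ^ 2

/-! ### One iteration of the algorithm -/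

lemma avg_dsq {K dx dy : ℕ} (w w' : Fin K → Pt dx dy) :
    (1 / (K : ℝ)) * ∑ k, dsq (w k) (w' k) = msq (fun k => (w k).1 - (w' k).1)
      + msq (fun k => (w k).2.1 - (w' k).2.1) + msq (fun k => (w k).2.2 - (w' k).2.2) := by
  simp only [dsq, msq, sum_add_distrib]; ring

/-- Averages of Lipschitz maps at two families of points. -/
lemma norm_mean_sub_sq_le {K dx dy n : ℕ} (hK : 1 ≤ K) {M : Fin K → Pt dx dy → Vec n} {L r : ℝ}
    (hM : ∀ k w w', ‖w.2.2‖ ≤ r → ‖w'.2.2‖ ≤ r → ‖M k w - M k w'‖ ≤ L * √(dsq w w'))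
    {w w' : Fin K → Pt dx dy} (hw : ∀ k, ‖(w k).2.2‖ ≤ r) (hw' : ∀ k, ‖(w' k).2.2‖ ≤ r) :
    ‖mean (fun k => M k (w k)) - mean (fun k => M k (w' k))‖ ^ 2
      ≤ L ^ 2 * (msq (fun k => (w k).1 - (w' k).1)
      + msq (fun k => (w k).2.1 - (w' k).2.1) + msq (fun k => (w k).2.2 - (w' k).2.2)) := by
  rw [← mean_sub, ← avg_dsq, mul_left_comm, mul_sum]
  refine (norm_mean_sq_le hK _).trans ?_
  unfold msq
  gcongr with k
  have := pow_le_pow_left₀ (norm_nonneg _) (hM k (w k) (w' k) (hw k) (hw' k)) 2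
  rwa [mul_pow, Real.sq_sqrt (dsq_nonneg _ _)] at this

/-- An inexact gradient step for a strongly monotone map. -/
lemma norm_step_sq_le {n : ℕ} {L β : ℝ} (hL : 1 ≤ L) (hβ : 0 ≤ β) (hβL : 4 * L ^ 3 * β ≤ 1)
    {a A e : Vec n} (hm : 1 / L * ‖a‖ ^ 2 ≤ ⟪A, a⟫) (hl : ‖A‖ ≤ L * ‖a‖) :
    ‖a - β • (A + e)‖ ^ 2 ≤ (1 - β / L) * ‖a‖ ^ 2 + 4 * L * β * ‖e‖ ^ 2 := by
  have hL0 : 0 < L := by linarith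
  have h1 : ‖A + e‖ ^ 2 ≤ 2 * (L ^ 2 * ‖a‖ ^ 2) + 2 * ‖e‖ ^ 2 := by
    have := pow_le_pow_left₀ (norm_nonneg _) hl 2
    rw [mul_pow] at this
    linarith [norm_add_sq_le_two A e]
  have h2 : -⟪e, a⟫ ≤ 1 / (4 * L) * ‖a‖ ^ 2 + L * ‖e‖ ^ 2 := by
    have h3 := neg_le_of_abs_le (abs_real_inner_le_norm e a)
    have h4 : 0 ≤ (1 / L) * (1 / 2 * ‖a‖ - L * ‖e‖) ^ 2 := by positivity
    have h5 : (1 / L) * (1 / 2 * ‖a‖ - L * ‖e‖) ^ 2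
        = 1 / (4 * L) * ‖a‖ ^ 2 - ‖e‖ * ‖a‖ + L * ‖e‖ ^ 2 := by field_simp; ring
    linarith
  have h6 : 2 * β * L ^ 2 ≤ 1 / (2 * L) := by
    rw [le_div_iff₀ (by positivity)]; nlinarith
  have h7 : β ≤ L := by
    have : 1 ≤ L ^ 3 := one_le_pow₀ hL
    nlinarith
  have h8 : (1 : ℝ) / (2 * L) = 1 / L * (1 / 2) := by field_simp
  have h9 : (1 : ℝ) / (4 * L) = 1 / L * (1 / 4) := by field_simp
  have h10 : β / L = β * (1 / L) := by ring
  rw [norm_sub_sq_real, inner_smul_right, norm_smul, mul_pow, Real.norm_of_nonneg hβ,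
    real_inner_comm, inner_add_left, h10]
  rw [h8] at h6
  rw [h9] at h2
  set i := 1 / L
  have k1 := mul_le_mul_of_nonneg_left h1 (mul_nonneg hβ hβ)
  have k2 := mul_le_mul_of_nonneg_left h2 hβ
  have k3 := mul_le_mul_of_nonneg_left hm hβ
  have k4 := mul_le_mul_of_nonneg_left h6 (mul_nonneg hβ (sq_nonneg ‖a‖))
  have k5 := mul_le_mul_of_nonneg_left h7 (mul_nonneg hβ (sq_nonneg ‖e‖))
  nlinarith

/-- Moving the target of a contraction. -/
lemma drift_le {θ R c S δ : ℝ} (h0 : 0 < θ) (h1 : θ ≤ 1) (hR : 0 ≤ R) (hc : 0 ≤ c)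
    (hδ : 0 ≤ δ) (hS : S ≤ (1 - θ) * R + c) :
    (1 + θ / 2) * S + (1 + 1 / (θ / 2)) * δ ≤ (1 - θ / 2) * R + 3 / 2 * c + 3 / θ * δ := by
  have e1 : 1 + 1 / (θ / 2) ≤ 3 / θ := by
    rw [show (1 : ℝ) / (θ / 2) = 2 / θ by field_simp,
      show (3 : ℝ) / θ = 1 / θ + 2 / θ by ring]
    have : 1 ≤ 1 / θ := by rw [le_div_iff₀ h0]; linarith
    linarith
  have e2 := mul_le_mul_of_nonneg_right e1 hδ
  have e3 := mul_le_mul_of_nonneg_left hS (by linarith : 0 ≤ 1 + θ / 2)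
  nlinarith [mul_nonneg (sq_nonneg θ) hR]

section Step

variable {K dx dy : ℕ} {Sf Sg : Type*} [MeasurableSpace Sf] [MeasurableSpace Sg]

/-- The query points of a state. -/
def State.pt (S : State K dx dy) (k : Fin K) : Pt dx dy := (S.X k, S.Y k, S.Z k)

/-- Error of the estimator `U`. -/
def State.errU (D : Problem K dx dy Sf Sg) (S : State K dx dy) (k : Fin K) : Vec dx :=
  S.U k - D.meanF k (S.pt k)

/-- Error of the estimator `V`. -/
def State.errV (D : Problem K dx dy Sf Sg) (S : State K dx dy) (k : Fin K) : Vec dy :=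
  S.V k - D.meanG k (S.pt k)

/-- Error of the estimator `W`. -/
def State.errW (D : Problem K dx dy Sf Sg) (S : State K dx dy) (k : Fin K) : Vec dy :=
  S.W k - D.meanH k (S.pt k)

/-- Squared distance of `ȳ` to `y*(x̄)`. -/
def State.gapY (D : Problem K dx dy Sf Sg) (S : State K dx dy) : ℝ :=
  ‖mean S.Y - D.yStar (mean S.X)‖ ^ 2

/-- Mean squared distance of the columns of `Z` to `z*(x̄)`. -/
def State.gapZ (D : Problem K dx dy Sf Sg) (S : State K dx dy) : ℝ :=
  msq (fun k => S.Z k - D.zStar (mean S.X))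

/-- Invariants of the iteration: the averages of the trackers are the averages of the estimators,
and `Z` stays in the ball. -/
structure State.Inv (S : State K dx dy) (r : ℝ) : Prop where
  P : mean S.P = mean S.U
  Q : mean S.Q = mean S.V
  R : mean S.R = mean S.W
  Z : ∀ k, ‖S.Z k‖ ≤ r

variable {D : Problem K dx dy Sf Sg} {E : Matrix (Fin K) (Fin K) ℝ} {lam : ℝ} {p : Params}

lemma norm_relax_le {n : ℕ} {a b : Vec n} {η r : ℝ} (h0 : 0 ≤ η) (h1 : η ≤ 1) (ha : ‖a‖ ≤ r)
    (hb : ‖b‖ ≤ r) : ‖a + η • (b - a)‖ ≤ r := by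
  have e : a + η • (b - a) = (1 - η) • a + η • b := by module
  rw [e]
  refine (norm_add_le _ _).trans ?_
  rw [norm_smul, norm_smul, Real.norm_of_nonneg h0, Real.norm_of_nonneg (by linarith)]
  nlinarith

lemma inv_stepState (hE : IsGossip E lam) (hp : p.Valid) (hη : p.η ≤ 1) (hr : 0 ≤ p.radius)
    (B : ℕ) (q : Fin K → ℕ → Sf × Sg) {S : State K dx dy} (hS : S.Inv p.radius) :
    (stepState D E p B q S).Inv p.radius where
  P := by
    show mean (fun k => mix E S.P k + (stepState D E p B q S).U k - S.U k) = _
    rw [mean_sub, mean_add, hE.mean_mix, hS.P]; abel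
  Q := by
    show mean (fun k => mix E S.Q k + (stepState D E p B q S).V k - S.V k) = _
    rw [mean_sub, mean_add, hE.mean_mix, hS.Q]; abel
  R := by
    show mean (fun k => mix E S.R k + (stepState D E p B q S).W k - S.W k) = _
    rw [mean_sub, mean_add, hE.mean_mix, hS.R]; abel
  Z := fun k => norm_relax_le hp.η_pos.le hη (hS.Z k) (norm_ballProj_le hr _)

/-- Contraction of the consensus error, for a relaxed gossip step followed by a nonexpansive map. -/
lemma dev_relaxed_gossip_le {n : ℕ} (hE : IsGossip E lam) (hK : 1 ≤ K) {η : ℝ} (h0 : 0 ≤ η)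
    (h1 : η ≤ 1) (X P : Fin K → Vec n) (β : ℝ) {φ : Vec n → Vec n}
    (hφ : ∀ a b, ‖φ a - φ b‖ ≤ ‖a - b‖) :
    dev (fun k => X k + η • (φ (mix E X k - β • P k) - X k))
      ≤ (1 - η * (1 - lam)) * dev X + 2 * η / (1 - lam) * β ^ 2 * dev P := by
  have e1 := dev_convex X (fun k => φ (mix E X k - β • P k)) h0 h1
  have e2 := (dev_comp_le hK (fun k => mix E X k - β • P k) hφ).trans
    (hE.dev_mix_sub_smul hK X P β)
  have e3 := mul_le_mul_of_nonneg_left e2 h0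
  refine e1.trans ((add_le_add_right e3 _).trans (le_of_eq ?_))
  ring

/-- Size of a relaxed gossip step. -/
lemma msq_relaxed_gossip_le {n : ℕ} (hE : IsGossip E lam) (hK : 1 ≤ K) {η : ℝ}
    (X P : Fin K → Vec n) (β : ℝ) {φ : Vec n → Vec n}
    (hφ : ∀ a b, ‖φ a - φ b‖ ≤ ‖a - b‖) (hX : ∀ k, φ (X k) = X k) :
    msq (fun k => X k - (X k + η • (φ (mix E X k - β • P k) - X k)))
      ≤ η ^ 2 * (8 * dev X + 2 * β ^ 2 * (‖mean P‖ ^ 2 + dev P)) := by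
  have e1 : msq (fun k => X k - (X k + η • (φ (mix E X k - β • P k) - X k)))
      = η ^ 2 * msq (fun k => φ (mix E X k - β • P k) - X k) := by
    rw [← msq_smul, ← msq_neg]
    congr 1; ext1 k; abel
  have e2 := msq_mono (X := fun k => φ (mix E X k - β • P k) - X k)
    (Y := fun k => mix E X k - β • P k - X k) (c := 1) fun k => by
      rw [one_mul]
      gcongr
      conv_lhs => rw [← hX k]
      exact hφ _ _
  rw [one_mul] at e2
  have e3 := hE.msq_step_le hK X P β
  rw [msq_eq hK P] at e3
  rw [e1]
  gcongr
  linarith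

/-- Contraction of the consensus error of a tracker. -/
lemma dev_tracker_le {n : ℕ} (hE : IsGossip E lam) (hK : 1 ≤ K) (P U U' : Fin K → Vec n) :
    dev (fun k => mix E P k + U' k - U k)
      ≤ lam * dev P + 2 / (1 - lam) * msq (fun k => U' k - U k) := by
  have e1 := hE.dev_mix_add hK P (fun k => U' k - U k)
  have e2 : 0 ≤ 2 / (1 - lam) := div_nonneg (by norm_num) (by linarith [hE.gap])
  have e3 := mul_le_mul_of_nonneg_left (dev_le_msq hK (fun k => U' k - U k)) e2
  simp only [add_sub_assoc]
  linarith

section Recursions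

variable {L : ℝ} (hD : D.Landscape L p.radius) (hK : 1 ≤ K) (hE : IsGossip E lam) (hp : p.Valid)
  (hη : p.η ≤ 1) {S : State K dx dy} (hS : S.Inv p.radius)

include hK hS in
lemma norm_mean_Z_le : ‖mean S.Z‖ ≤ p.radius := Problem.Regular.norm_mean_le hK hS.Z

include hD hK hS in
/-- Distance of `Ū` to the hypergradient. -/
lemma norm_hyperGrad_sub_sq_le :
    ‖D.hyperGrad (mean S.X) - mean S.U‖ ^ 2 ≤ 2 * ‖mean (S.errU D)‖ ^ 2
      + 2 * L ^ 2 * (dev S.X + dev S.Y + S.gapY D + S.gapZ D) := by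
  have e1 := norm_mean_sub_sq_le hK hD.lipF (w := S.pt)
    (w' := fun _ => (mean S.X, D.yStar (mean S.X), D.zStar (mean S.X))) hS.Z
    (fun _ => hD.norm_zStar_le _)
  have e2 : msq (fun k => S.Y k - D.yStar (mean S.X)) = S.gapY D + dev S.Y :=
    msq_sub_const hK S.Y _
  have e3 : D.hyperGrad (mean S.X) - mean S.U = -(mean (S.errU D)
      + (mean (fun k => D.meanF k (S.pt k)) - D.hyperGrad (mean S.X))) := by
    have : mean (S.errU D) = mean S.U - mean (fun k => D.meanF k (S.pt k)) := mean_sub _ _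
    rw [this]; abel
  have e4 := norm_add_sq_le_two (mean (S.errU D))
    (mean (fun k => D.meanF k (S.pt k)) - D.hyperGrad (mean S.X))
  change ‖mean (fun k => D.meanF k (S.pt k)) - D.hyperGrad (mean S.X)‖ ^ 2 ≤ L ^ 2 *
    (dev S.X + msq (fun k => S.Y k - D.yStar (mean S.X)) + S.gapZ D) at e1
  rw [e2] at e1
  rw [e3, norm_neg]
  linarith

include hD hK hS in
lemma norm_mean_V_sq_le : ‖mean S.V‖ ^ 2 ≤ 2 * ‖mean (S.errV D)‖ ^ 2
    + 2 * L ^ 2 * (dev S.X + dev S.Y + S.gapY D) := by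
  have e1 := norm_mean_sub_sq_le hK hD.lipG (w := S.pt)
    (w' := fun k => (mean S.X, D.yStar (mean S.X), S.Z k)) hS.Z hS.Z
  have e2 : msq (fun k => S.Y k - D.yStar (mean S.X)) = S.gapY D + dev S.Y :=
    msq_sub_const hK S.Y _
  have e0 : mean (fun k => D.meanG k (mean S.X, D.yStar (mean S.X), S.Z k)) = 0 :=
    hD.y_zero (mean S.X) 0
  have e5 : msq (fun k => S.Z k - S.Z k) = 0 := by simp [msq]
  have e3 : mean S.V = mean (S.errV D) + mean (fun k => D.meanG k (S.pt k)) := by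
    have : mean (S.errV D) = mean S.V - mean (fun k => D.meanG k (S.pt k)) := mean_sub _ _
    rw [this]; abel
  have e4 := norm_add_sq_le_two (mean (S.errV D)) (mean (fun k => D.meanG k (S.pt k)))
  change ‖mean (fun k => D.meanG k (S.pt k))
    - mean (fun k => D.meanG k (mean S.X, D.yStar (mean S.X), S.Z k))‖ ^ 2 ≤ L ^ 2 *
    (dev S.X + msq (fun k => S.Y k - D.yStar (mean S.X)) + msq (fun k => S.Z k - S.Z k)) at e1
  rw [e2, e0, e5, sub_zero, add_zero] at e1
  rw [e3]
  linarith

include hD hK hS in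
lemma norm_mean_W_sq_le : ‖mean S.W‖ ^ 2 ≤ 2 * ‖mean (S.errW D)‖ ^ 2
    + 2 * L ^ 2 * (dev S.X + dev S.Y + S.gapY D + S.gapZ D) := by
  have e1 := norm_mean_sub_sq_le hK hD.lipH (w := S.pt)
    (w' := fun k => (mean S.X, D.yStar (mean S.X), D.zStar (mean S.X))) hS.Z
    (fun _ => hD.norm_zStar_le _)
  have e2 : msq (fun k => S.Y k - D.yStar (mean S.X)) = S.gapY D + dev S.Y :=
    msq_sub_const hK S.Y _
  have e3 : mean S.W = mean (S.errW D) + mean (fun k => D.meanH k (S.pt k)) := by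
    have : mean (S.errW D) = mean S.W - mean (fun k => D.meanH k (S.pt k)) := mean_sub _ _
    rw [this]; abel
  have e4 := norm_add_sq_le_two (mean (S.errW D)) (mean (fun k => D.meanH k (S.pt k)))
  change ‖mean (fun k => D.meanH k (S.pt k))
    - mean (fun k => D.meanH k (mean S.X, D.yStar (mean S.X), D.zStar (mean S.X)))‖ ^ 2 ≤ L ^ 2 *
    (dev S.X + msq (fun k => S.Y k - D.yStar (mean S.X)) + S.gapZ D) at e1
  rw [e2, hD.z_zero, sub_zero] at e1
  rw [e3]
  linarith

variable (B : ℕ) (q : Fin K → ℕ → Sf × Sg)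

include hE hS in
/-- The average iterate moves along the average estimator. -/
lemma mean_X_stepState : mean (stepState D E p B q S).X = mean S.X - (p.η * p.β₁) • mean S.U := by
  show mean (fun k => S.X k + p.η • ((mix E S.X k - p.β₁ • S.P k) - S.X k)) = _
  rw [mean_add, mean_smul, mean_sub, mean_sub, mean_smul, hE.mean_mix, hS.P]
  module

include hE hS in
lemma mean_Y_stepState : mean (stepState D E p B q S).Y = mean S.Y - (p.η * p.β₂) • mean S.V := by
  show mean (fun k => S.Y k + p.η • ((mix E S.Y k - p.β₂ • S.Q k) - S.Y k)) = _
  rw [mean_add, mean_smul, mean_sub, mean_sub, mean_smul, hE.mean_mix, hS.Q]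
  module

include hD hE hp hη hS in
/-- Descent of the objective along the average iterate. -/
lemma F_stepState_le (hβ : 4 * L * p.β₁ ≤ 1) :
    D.F (mean (stepState D E p B q S).X) + p.η * p.β₁ * (1 / 2 * ‖D.hyperGrad (mean S.X)‖ ^ 2
        + 1 / 4 * ‖mean S.U‖ ^ 2) ≤ D.F (mean S.X)
      + p.η * p.β₁ * (1 / 2 * ‖D.hyperGrad (mean S.X) - mean S.U‖ ^ 2) := by
  have e1 := (abs_le.1 (hD.expansion (mean S.X) (mean (stepState D E p B q S).X))).2
  have hb := hp.β₁_pos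
  have hη0 := hp.η_pos
  have hL := hD.one_le
  rw [mean_X_stepState hE hS B q] at e1 ⊢
  set x := mean S.X
  set u := mean S.U
  set g := D.hyperGrad x
  have e2 : x - (p.η * p.β₁) • u - x = -((p.η * p.β₁) • u) := by abel
  rw [e2, inner_neg_right, inner_smul_right, norm_neg, norm_smul, mul_pow, Real.norm_eq_abs,
    sq_abs] at e1
  have e3 := norm_sub_sq_real g u
  have e4 : L * ((p.η * p.β₁) ^ 2 * ‖u‖ ^ 2) ≤ p.η * p.β₁ * (1 / 4 * ‖u‖ ^ 2) := by
    have h1 : L * (p.η * p.β₁) ≤ 1 / 4 := by nlinarith [mul_pos hb (by linarith : 0 < L)]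
    have h2 := mul_le_mul_of_nonneg_right h1
      (mul_nonneg (mul_pos hη0 hb).le (sq_nonneg ‖u‖))
    nlinarith
  rw [e3]
  nlinarith

include hE hp hS in
lemma norm_drift_sq_le {T : Vec dx → Vec dy} (hT : ∀ x x', ‖T x - T x'‖ ≤ L * ‖x - x'‖) :
    ‖T (mean S.X) - T (mean (stepState D E p B q S).X)‖ ^ 2
      ≤ L ^ 2 * (p.η * p.β₁) ^ 2 * ‖mean S.U‖ ^ 2 := by
  have h1 := hT (mean S.X) (mean (stepState D E p B q S).X)
  have h2 : mean S.X - mean (stepState D E p B q S).X = (p.η * p.β₁) • mean S.U := by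
    rw [mean_X_stepState hE hS B q]; abel
  rw [h2, norm_smul, Real.norm_of_nonneg (mul_pos hp.η_pos hp.β₁_pos).le] at h1
  have h3 := pow_le_pow_left₀ (norm_nonneg _) h1 2
  linarith

include hD hK hE hp hη hS in
/-- Recursion for the distance of `ȳ` to `y*(x̄)`. -/
lemma gapY_stepState_le (hβ : 4 * L ^ 3 * p.β₂ ≤ 1) :
    (stepState D E p B q S).gapY D ≤ (1 - p.η * p.β₂ / L / 2) * S.gapY D
      + 12 * L * (p.η * p.β₂) * (‖mean (S.errV D)‖ ^ 2 + L ^ 2 * (dev S.X + dev S.Y))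
      + 3 * L ^ 3 * (p.η * p.β₁ ^ 2 / p.β₂) * ‖mean S.U‖ ^ 2 := by
  have hL := hD.one_le
  have hL0 : 0 < L := by linarith
  have hη0 := hp.η_pos
  have hb := hp.β₂_pos
  have hL3 : 1 ≤ L ^ 3 := one_le_pow₀ hL
  set x := mean S.X with hx
  set a := mean S.Y - D.yStar x with ha
  set A := mean (fun k => D.meanG k (x, mean S.Y, mean S.Z)) with hA
  set e := mean S.V - A with he
  have h1 := norm_step_sq_le hL hb.le hβ (a := a) (A := A) (e := e)
    (hD.y_mono x (mean S.Y) (mean S.Z)) (by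
      have := norm_mean_sub_sq_le hK hD.lipG (w := fun _ => (x, mean S.Y, mean S.Z))
        (w' := fun _ => (x, D.yStar x, mean S.Z)) (fun _ => norm_mean_Z_le hK hS)
        (fun _ => norm_mean_Z_le hK hS)
      rw [hD.y_zero x (mean S.Z), sub_zero, msq_const hK, msq_const hK, msq_const hK] at this
      simp only [sub_self, norm_zero] at this
      refine le_of_sq_le_sq ?_ (by positivity)
      rw [mul_pow]
      linarith)
  have h2 : ‖e‖ ^ 2 ≤ 2 * ‖mean (S.errV D)‖ ^ 2 + 2 * L ^ 2 * (dev S.X + dev S.Y) := by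
    have e1 := norm_mean_sub_sq_le hK hD.lipG (w := S.pt)
      (w' := fun k => (x, mean S.Y, S.Z k)) hS.Z hS.Z
    have e5 : msq (fun k => S.Z k - S.Z k) = 0 := by simp [msq]
    change ‖mean (fun k => D.meanG k (S.pt k)) - A‖ ^ 2 ≤ L ^ 2 *
      (dev S.X + dev S.Y + msq (fun k => S.Z k - S.Z k)) at e1
    have e3 : e = mean (S.errV D) + (mean (fun k => D.meanG k (S.pt k)) - A) := by
      have : mean (S.errV D) = mean S.V - mean (fun k => D.meanG k (S.pt k)) := mean_sub _ _
      rw [this, he]; abel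
    rw [e5, add_zero] at e1
    rw [e3]
    linarith [norm_add_sq_le_two (mean (S.errV D)) (mean (fun k => D.meanG k (S.pt k)) - A)]
  have h3 := norm_sq_convex a (a - p.β₂ • (A + e)) hη0.le hη
  have h4 : mean (stepState D E p B q S).Y - D.yStar x = a + p.η • (a - p.β₂ • (A + e) - a) := by
    rw [mean_Y_stepState hE hS B q, he, ha]; module
  have h5 := norm_drift_sq_le (D := D) hE hp hS B q hD.y_lip
  set θ := p.η * p.β₂ / L with hθ
  have hθ0 : 0 < θ := by positivity
  have hb1 : p.β₂ ≤ 1 := by nlinarith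
  have hθ1 : θ ≤ 1 := by
    rw [hθ, div_le_one hL0]; nlinarith
  set S' := stepState D E p B q S
  have h6 := norm_add_sq_young (mean S'.Y - D.yStar x) (D.yStar x - D.yStar (mean S'.X))
    (s := θ / 2) (by positivity)
  have h7 : ‖mean S'.Y - D.yStar x‖ ^ 2 ≤ (1 - θ) * ‖a‖ ^ 2
      + 8 * L * (p.η * p.β₂) * (‖mean (S.errV D)‖ ^ 2 + L ^ 2 * (dev S.X + dev S.Y)) := by
    rw [h4]
    refine h3.trans ?_
    have i1 := mul_le_mul_of_nonneg_left h1 hη0.le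
    have i2 := mul_le_mul_of_nonneg_left h2 (by positivity : 0 ≤ 4 * L * (p.η * p.β₂))
    have i3 : p.η * (p.β₂ / L) = θ := by rw [hθ]; ring
    nlinarith
  have h8 := drift_le hθ0 hθ1 (sq_nonneg ‖a‖) (by have := dev_nonneg S.X; have := dev_nonneg S.Y
                                                  positivity)
    (sq_nonneg ‖D.yStar x - D.yStar (mean S'.X)‖) h7
  have h9 : S'.gapY D = ‖mean S'.Y - D.yStar x + (D.yStar x - D.yStar (mean S'.X))‖ ^ 2 := by
    rw [State.gapY]; congr 2; abel
  have h10 : 3 / θ * ‖D.yStar x - D.yStar (mean S'.X)‖ ^ 2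
      ≤ 3 * L ^ 3 * (p.η * p.β₁ ^ 2 / p.β₂) * ‖mean S.U‖ ^ 2 := by
    refine (mul_le_mul_of_nonneg_left h5 (by positivity)).trans (le_of_eq ?_)
    rw [hθ]; field_simp
  have h11 : S.gapY D = ‖a‖ ^ 2 := rfl
  rw [h9, h11]
  linarith

omit hD hK hE hp hη hS in
/-- Combination of the contraction of the mean with the contraction of the deviation: the share
`8L³β·z` of the deviation `z` in the error bound is absorbed by the spectral gap. -/
lemma gapZ_combine {L b l a' d' a z n c e r : ℝ} (hL : 1 ≤ L) (hb : 0 ≤ b)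
    (hβ : 9 * L ^ 3 * b ≤ 1 - l) (hz : 0 ≤ z) (h1 : a' ≤ (1 - b / L) * a + 4 * L * b * e)
    (h2 : e ≤ 2 * n + 2 * L ^ 2 * (c + z)) (h5 : d' ≤ l * z + r) :
    a' + d' ≤ (1 - b / L) * (a + z) + 8 * L * b * (n + L ^ 2 * c) + r := by
  have hL0 : 0 < L := by linarith
  have i2 := mul_le_mul_of_nonneg_left h2 (by positivity : 0 ≤ 4 * L * b)
  have i3 : l + 8 * L ^ 3 * b ≤ 1 - b / L := by
    have : b / L ≤ L ^ 3 * b := by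
      rw [div_le_iff₀ hL0]
      have : 1 ≤ L ^ 4 := one_le_pow₀ hL
      nlinarith
    linarith
  have i4 := mul_le_mul_of_nonneg_right i3 hz
  linarith

include hD hK hE hp hη hS in
/-- Recursion for the distance of `Z` to `z*(x̄)`. The projection is nonexpansive and fixes `z*`,
so it is harmless for the mean square over the workers; the consensus error that this quantity
contains is absorbed by the contraction of the gossip step. -/
lemma gapZ_stepState_le (hβ : 9 * L ^ 3 * p.β₃ ≤ 1 - lam) :
    (stepState D E p B q S).gapZ D ≤ (1 - p.η * p.β₃ / L / 2) * S.gapZ D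
      + 12 * L * (p.η * p.β₃) * (‖mean (S.errW D)‖ ^ 2
        + L ^ 2 * (dev S.X + dev S.Y + S.gapY D))
      + 3 * p.η * p.β₃ ^ 2 / (1 - lam) * dev S.R
      + 3 * L ^ 3 * (p.η * p.β₁ ^ 2 / p.β₃) * ‖mean S.U‖ ^ 2 := by
  have hL := hD.one_le
  have hL0 : 0 < L := by linarith
  have hη0 := hp.η_pos
  have hb := hp.β₃_pos
  have hL3 : 1 ≤ L ^ 3 := one_le_pow₀ hL
  have hlam := hE.lam_nonneg hK
  have hρ : 0 < 1 - lam := by linarith [hE.gap]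
  have hβ' : 4 * L ^ 3 * p.β₃ ≤ 1 := by nlinarith [mul_pos (by positivity : 0 < L ^ 3) hb]
  set x := mean S.X with hx
  set ζ := D.zStar x with hζ
  set a := mean S.Z - ζ with ha
  set A := mean (fun k => D.meanH k (x, D.yStar x, mean S.Z)) with hA
  set e := mean S.W - A with he
  have hr := hD.radius_nonneg
  have h1 := norm_step_sq_le hL hb.le hβ' (a := a) (A := A) (e := e)
    (hD.z_mono x (mean S.Z)) (by
      have := norm_mean_sub_sq_le hK hD.lipH (w := fun _ => (x, D.yStar x, mean S.Z))
        (w' := fun _ => (x, D.yStar x, ζ)) (fun _ => norm_mean_Z_le hK hS)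
        (fun _ => hD.norm_zStar_le x)
      rw [hD.z_zero x, sub_zero, msq_const hK, msq_const hK, msq_const hK] at this
      simp only [sub_self, norm_zero] at this
      refine le_of_sq_le_sq ?_ (by positivity)
      rw [mul_pow]
      linarith)
  have h2 : ‖e‖ ^ 2 ≤ 2 * ‖mean (S.errW D)‖ ^ 2
      + 2 * L ^ 2 * (dev S.X + dev S.Y + S.gapY D + dev S.Z) := by
    have e1 := norm_mean_sub_sq_le hK hD.lipH (w := S.pt)
      (w' := fun k => (x, D.yStar x, mean S.Z)) hS.Z (fun _ => norm_mean_Z_le hK hS)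
    have e2 : msq (fun k => S.Y k - D.yStar (mean S.X)) = S.gapY D + dev S.Y :=
      msq_sub_const hK S.Y _
    change ‖mean (fun k => D.meanH k (S.pt k)) - A‖ ^ 2 ≤ L ^ 2 *
      (dev S.X + msq (fun k => S.Y k - D.yStar (mean S.X)) + dev S.Z) at e1
    have e3 : e = mean (S.errW D) + (mean (fun k => D.meanH k (S.pt k)) - A) := by
      have : mean (S.errW D) = mean S.W - mean (fun k => D.meanH k (S.pt k)) := mean_sub _ _
      rw [this, he]; abel
    rw [e2] at e1
    rw [e3]
    linarith [norm_add_sq_le_two (mean (S.errW D)) (mean (fun k => D.meanH k (S.pt k)) - A)]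
  set V : Fin K → Vec dy := fun k => mix E S.Z k - p.β₃ • S.R k with hV
  set S' := stepState D E p B q S with hS'
  have hfix : ballProj p.radius ζ = ζ := ballProj_of_le (hD.norm_zStar_le x)
  have h3 : msq (fun k => ballProj p.radius (V k) - ζ) ≤ msq (fun k => V k - ζ) := by
    have := msq_mono (X := fun k => ballProj p.radius (V k) - ζ) (Y := fun k => V k - ζ) (c := 1)
      fun k => by
        rw [one_mul]
        have hne := ballProj_nonexpansive hr (V k) ζ
        rw [hfix] at hne
        gcongr
    rwa [one_mul] at this
  have h4 : msq (fun k => V k - ζ) = ‖a - p.β₃ • (A + e)‖ ^ 2 + dev V := by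
    rw [msq_sub_const hK]
    congr 3
    rw [hV, mean_sub, mean_smul, hE.mean_mix, hS.R, he, ha]; module
  have h5 := hE.dev_mix_sub_smul hK S.Z S.R p.β₃
  have hgap : S.gapZ D = ‖a‖ ^ 2 + dev S.Z := msq_sub_const hK S.Z ζ
  have h6 := msq_convex (fun k => S.Z k - ζ) (fun k => ballProj p.radius (V k) - ζ) hη0.le hη
  have h7 : msq (fun k => S'.Z k - ζ) ≤ (1 - p.η) * S.gapZ D
      + p.η * msq (fun k => ballProj p.radius (V k) - ζ) := by
    refine le_trans (le_of_eq ?_) h6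
    congr 1; ext1 k
    show S.Z k + p.η • (ballProj p.radius (V k) - S.Z k) - ζ = _
    module
  set θ := p.η * p.β₃ / L with hθ
  have hθ0 : 0 < θ := by positivity
  have hb1 : p.β₃ ≤ 1 := by nlinarith
  have hθ1 : θ ≤ 1 := by
    rw [hθ, div_le_one hL0]; nlinarith
  set n := ‖mean (S.errW D)‖ ^ 2
  set c := dev S.X + dev S.Y + S.gapY D with hc
  have hc0 : 0 ≤ c := by
    have := dev_nonneg S.X; have := dev_nonneg S.Y
    have : 0 ≤ S.gapY D := sq_nonneg _
    positivity
  have hdZ := dev_nonneg S.Z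
  have hdR := dev_nonneg S.R
  have h8 : msq (fun k => V k - ζ) ≤ (1 - p.β₃ / L) * S.gapZ D
      + 8 * L * p.β₃ * (n + L ^ 2 * c) + 2 / (1 - lam) * (p.β₃ ^ 2 * dev S.R) := by
    rw [h4, hgap]
    have h2' : ‖e‖ ^ 2 ≤ 2 * n + 2 * L ^ 2 * (c + dev S.Z) := h2
    exact gapZ_combine hL hb.le hβ hdZ h1 h2' h5
  have h9 : msq (fun k => S'.Z k - ζ) ≤ (1 - θ) * S.gapZ D
      + p.η * (8 * L * p.β₃ * (n + L ^ 2 * c) + 2 / (1 - lam) * (p.β₃ ^ 2 * dev S.R)) := by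
    refine h7.trans ((add_le_add_right (mul_le_mul_of_nonneg_left (h3.trans h8) hη0.le)
      ((1 - p.η) * S.gapZ D)).trans (le_of_eq ?_))
    rw [hθ]; ring
  have hn0 : 0 ≤ n := sq_nonneg _
  have hpos : 0 ≤ p.η * (8 * L * p.β₃ * (n + L ^ 2 * c)
      + 2 / (1 - lam) * (p.β₃ ^ 2 * dev S.R)) :=
    mul_nonneg hη0.le (add_nonneg
      (mul_nonneg (by positivity) (add_nonneg hn0 (mul_nonneg (by positivity) hc0)))
      (mul_nonneg (div_nonneg zero_le_two hρ.le) (mul_nonneg (sq_nonneg _) hdR)))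
  have h10 := drift_le (R := S.gapZ D) hθ0 hθ1 (msq_nonneg _) hpos
    (sq_nonneg ‖ζ - D.zStar (mean S'.X)‖) h9
  have h11 := msq_add_young (fun k => S'.Z k - ζ) (fun _ => ζ - D.zStar (mean S'.X))
    (s := θ / 2) (by positivity)
  rw [msq_const hK] at h11
  have h12 : S'.gapZ D = msq (fun k => S'.Z k - ζ + (ζ - D.zStar (mean S'.X))) := by
    rw [State.gapZ]; congr 1; ext1 k; abel
  have h13 := norm_drift_sq_le (D := D) hE hp hS B q hD.z_lip
  have h14 : 3 / θ * ‖ζ - D.zStar (mean S'.X)‖ ^ 2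
      ≤ 3 * L ^ 3 * (p.η * p.β₁ ^ 2 / p.β₃) * ‖mean S.U‖ ^ 2 := by
    refine (mul_le_mul_of_nonneg_left h13 (by positivity)).trans (le_of_eq ?_)
    rw [hθ]; field_simp
  have h15 : 3 / 2 * (p.η * (8 * L * p.β₃ * (n + L ^ 2 * c)
      + 2 / (1 - lam) * (p.β₃ ^ 2 * dev S.R))) = 12 * L * (p.η * p.β₃) * (n + L ^ 2 * c)
      + 3 * p.η * p.β₃ ^ 2 / (1 - lam) * dev S.R := by
    field_simp; ring
  rw [h15] at h10
  rw [h12]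
  linarith

end Recursions

end Step

/-! ### Measurability and moments along a run -/

section Moments

variable {Ω : Type*} [mΩ : MeasurableSpace Ω] {Pr : Measure Ω} {K n : ℕ}

lemma memLp_mean {X : Fin K → Ω → Vec n} (hX : ∀ k, MemLp (X k) 2 Pr) :
    MemLp (fun ω => mean (fun k => X k ω)) 2 Pr :=
  (memLp_finsetSum _ fun k _ => hX k).const_smul (1 / (K : ℝ))

lemma memLp_mix {X : Fin K → Ω → Vec n} (hX : ∀ k, MemLp (X k) 2 Pr)
    (E : Matrix (Fin K) (Fin K) ℝ) (k : Fin K) :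
    MemLp (fun ω => mix E (fun k => X k ω) k) 2 Pr :=
  memLp_finsetSum _ fun j _ => (hX j).const_smul (E j k)

omit mΩ in
lemma measurable_mix {m : MeasurableSpace Ω} {X : Fin K → Ω → Vec n}
    (hX : ∀ k, Measurable (X k)) (E : Matrix (Fin K) (Fin K) ℝ) (k : Fin K) :
    Measurable (fun ω => mix E (fun k => X k ω) k) :=
  Finset.measurable_fun_sum _ fun j _ => (hX j).const_smul (E j k)

lemma integrable_msq {X : Fin K → Ω → Vec n} (hX : ∀ k, MemLp (X k) 2 Pr) :
    Integrable (fun ω => msq (fun k => X k ω)) Pr :=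
  (integrable_finsetSum _ fun k _ => (hX k).integrable_norm_pow (by norm_num)).const_mul _

lemma integrable_dev {X : Fin K → Ω → Vec n} (hX : ∀ k, MemLp (X k) 2 Pr) :
    Integrable (fun ω => dev (fun k => X k ω)) Pr :=
  integrable_msq (X := fun k ω => X k ω - mean (fun k => X k ω))
    fun k => (hX k).sub (memLp_mean hX)

lemma integrable_norm_mean_sq {X : Fin K → Ω → Vec n} (hX : ∀ k, MemLp (X k) 2 Pr) :
    Integrable (fun ω => ‖mean (fun k => X k ω)‖ ^ 2) Pr :=
  (memLp_mean hX).integrable_norm_pow (by norm_num)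

/-- The image of a square-integrable vector under a Lipschitz map. -/
lemma memLp_lipschitz [IsFiniteMeasure Pr] {n' : ℕ} {T : Vec n → Vec n'} {L : ℝ}
    (hT : ∀ x x', ‖T x - T x'‖ ≤ L * ‖x - x'‖) {X : Ω → Vec n} (hX : MemLp X 2 Pr) :
    MemLp (fun ω => T (X ω)) 2 Pr := by
  have hc : LipschitzWith (Real.toNNReal L) T := LipschitzWith.of_dist_le_mul fun a b => by
    rw [dist_eq_norm, dist_eq_norm]
    refine (hT a b).trans (mul_le_mul_of_nonneg_right (Real.le_coe_toNNReal L) (norm_nonneg _))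
  have h1 : MemLp (fun ω => T (X ω) - T 0) 2 Pr :=
    hX.of_le_mul ((hc.continuous.comp_aestronglyMeasurable hX.aestronglyMeasurable).sub
      aestronglyMeasurable_const) (Filter.Eventually.of_forall fun ω => by
        simpa using hT (X ω) 0)
  have h2 := h1.add (memLp_const (T 0))
  refine h2.congr_norm (hc.continuous.comp_aestronglyMeasurable hX.aestronglyMeasurable)
    (Filter.Eventually.of_forall fun ω => by simp)

/-- Expectation of an upper bound that is a linear combination. -/
lemma integral_le_sum {m : ℕ} (c : Fin m → ℝ) (g : Fin m → Ω → ℝ) {f : Ω → ℝ}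
    (hf : Integrable f Pr) (hg : ∀ i, Integrable (g i) Pr)
    (h : ∀ ω, f ω ≤ ∑ i, c i * g i ω) : ∫ ω, f ω ∂Pr ≤ ∑ i, c i * ∫ ω, g i ω ∂Pr := by
  have hi := fun i (_ : i ∈ univ) => (hg i).const_mul (c i)
  refine (integral_mono hf (integrable_finsetSum univ hi) h).trans (le_of_eq ?_)
  rw [integral_finsetSum univ hi]
  simp only [integral_const_mul]

/-- One relaxed gossip step followed by a nonexpansive map has second moments. -/
lemma memLp_relaxed_gossip [IsFiniteMeasure Pr] (E : Matrix (Fin K) (Fin K) ℝ) (η β : ℝ)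
    {X P : Fin K → Ω → Vec n}
    (hX : ∀ k, MemLp (X k) 2 Pr) (hP : ∀ k, MemLp (P k) 2 Pr) {φ : Vec n → Vec n}
    (hφ : ∀ a b, ‖φ a - φ b‖ ≤ ‖a - b‖) (k : Fin K) :
    MemLp (fun ω => X k ω + η • (φ (mix E (fun k => X k ω) k - β • P k ω) - X k ω)) 2 Pr :=
  (hX k).add ((MemLp.sub (memLp_lipschitz (L := 1) (fun a b => by simpa using hφ a b)
    ((memLp_mix hX E k).sub ((hP k).const_smul β))) (hX k)).const_smul η)

omit mΩ in
lemma measurable_relaxed_gossip {m : MeasurableSpace Ω} (E : Matrix (Fin K) (Fin K) ℝ) (η β : ℝ)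
    {X P : Fin K → Ω → Vec n} (hX : ∀ k, Measurable (X k)) (hP : ∀ k, Measurable (P k))
    {φ : Vec n → Vec n} (hφ : Continuous φ) (k : Fin K) :
    Measurable (fun ω => X k ω + η • (φ (mix E (fun k => X k ω) k - β • P k ω) - X k ω)) :=
  (hX k).add (((hφ.measurable.comp ((measurable_mix hX E k).sub ((hP k).const_smul β))).sub
    (hX k)).const_smul η)

end Moments

section Estimator

variable {K dx dy n : ℕ} {Sf Sg : Type*} [MeasurableSpace Sf] [MeasurableSpace Sg]
  {D : Problem K dx dy Sf Sg} {L r v : ℝ} {O : Fin K → Pt dx dy → Sf × Sg → Vec n}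
  {M : Fin K → Pt dx dy → Vec n} {Ω : Type*} [mΩ : MeasurableSpace Ω] {Pr : Measure Ω}
  {s : ℕ → Fin K → ℕ → Ω → Sf × Sg}

omit mΩ in
lemma past_mono {t t' : ℕ} (h : t ≤ t') : past s t ≤ past s t' :=
  sampleAlg_mono fun _ hi => lt_of_lt_of_le hi h

/-- An estimator `U` of the means `M` at the query points `w`, and its tracker `P`, after
iteration `t`: both are known after this iteration and have second moments. -/
structure EstReg (Pr : Measure Ω) (s : ℕ → Fin K → ℕ → Ω → Sf × Sg) (t : ℕ)
    (M : Fin K → Pt dx dy → Vec n) (w : Fin K → Ω → Pt dx dy) (U P : Fin K → Ω → Vec n) :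
    Prop where
  measU : ∀ k, Measurable[past s (t + 1)] (U k)
  measP : ∀ k, Measurable[past s (t + 1)] (P k)
  memP : ∀ k, MemLp (P k) 2 Pr
  memE : ∀ k, MemLp (fun ω => U k ω - M k (w k ω)) 2 Pr

omit mΩ in
lemma IsOracle.measurable_batchAvg (h : IsOracle D L r v O M) {t : ℕ} {w : Fin K → Ω → Pt dx dy}
    (hw : ∀ k, Measurable[past s (t + 1)] (w k)) (B : ℕ) (k : Fin K) :
    Measurable[past s (t + 1)]
      (fun ω => batchAvg O B (fun k b => s t k b ω) (fun k => w k ω) k) :=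
  (Finset.measurable_fun_sum (m := past s (t + 1)) _ fun b _ => (h.meas k).comp
    ((hw k).prodMk (measurable_sample (by simp)))).const_smul (1 / (B : ℝ))

variable (h : IsOracle D L r v O M) (hD : D.WellPosed) (hs : IsSampling D Pr s)
  [IsProbabilityMeasure Pr] {B : ℕ} (hB : 1 ≤ B)

section Init

variable {w0 : Pt dx dy} (hw0 : ‖w0.2.2‖ ≤ r)
include h hD hs hB hw0

omit h hD hs hB in
lemma isMove_const : IsMove Pr s r 0 (fun (_ : Fin K) (_ : Ω) => w0) (fun _ _ => w0) where
  meas _ := @measurable_const _ _ _ (past s 0) _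
  meas' _ := @measurable_const _ _ _ (past s 0) _
  mem _ _ := hw0
  mem' _ _ := hw0
  int _ := integrable_const _

lemma estReg_init : EstReg Pr s 0 M (fun _ _ => w0)
    (fun k ω => batchAvg O B (fun k b => s 0 k b ω) (fun _ => w0) k)
    (fun k ω => batchAvg O B (fun k b => s 0 k b ω) (fun _ => w0) k) := by
  have hm := fun k => h.measurable_batchAvg (s := s) (t := 0) (w := fun _ _ => w0)
    (fun _ => @measurable_const _ _ _ (past s 1) _) B k
  have he := fun k =>
    (batchAvg_sub_mean_memLp h hD hs (isMove_const hw0) hB k).1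
  refine ⟨hm, hm, fun k => ?_, he⟩
  have := (he k).add (memLp_const (M k w0))
  convert this using 1
  ext1 ω
  simp

/-- The error of the first estimator. -/
lemma integral_init_err_le (hK : 1 ≤ K) :
    ∫ ω, msq (fun k => batchAvg O B (fun k b => s 0 k b ω) (fun _ => w0) k - M k w0) ∂Pr
      ≤ 2 * v ^ 2 ∧
    ∫ ω, ‖mean (fun k => batchAvg O B (fun k b => s 0 k b ω) (fun _ => w0) k - M k w0)‖ ^ 2 ∂Pr
      ≤ 2 * v ^ 2 / (K * B) := by
  have hw : IsMove Pr s r 0 (fun (_ : Fin K) (_ : Ω) => w0) (fun _ _ => w0) := isMove_const hw0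
  have e : ∀ ω k, batchAvg O B (fun k b => s 0 k b ω) (fun _ => w0) k - M k w0
      = stormErr O M 1 B (fun _ => w0) (fun _ => w0) (fun _ => 0) (fun k b => s 0 k b ω) k := by
    intro ω k
    rw [batchAvg_sub_mean hB]
    simp [stormErr, stormNoise]
  have hz : ∀ k : Fin K, Measurable[past s 0] (fun _ : Ω => (0 : Vec n)) :=
    fun _ => @measurable_const _ _ _ (past s 0) _
  have e1 := integral_msq_stormErr_le h hD hs hw (a := 1) (B := B) (e := fun _ _ => 0)
    zero_le_one le_rfl hB hz (fun _ => MemLp.zero)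
  have e2 := integral_mean_stormErr_le h hD hs hw (a := 1) (B := B) (e := fun _ _ => 0) hK
    zero_le_one le_rfl hB hz (fun _ => MemLp.zero)
  have hd : dsq w0 w0 = 0 := by simp [dsq]
  simp only [hd, sum_const_zero, mul_zero, integral_zero, sub_self, zero_mul, zero_add] at e1 e2
  have hB' : (1 : ℝ) ≤ B := by exact_mod_cast hB
  simp only [e]
  refine ⟨e1.trans ?_, e2.trans (le_of_eq (by ring))⟩
  have : 1 / (B : ℝ) ≤ 1 := by rw [div_le_one (by linarith)]; exact hB'
  nlinarith [sq_nonneg v]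

/-- The second moment of the first tracker. -/
lemma integral_init_tracker_le (hK : 1 ≤ K) :
    ∫ ω, dev (fun k => batchAvg O B (fun k b => s 0 k b ω) (fun _ => w0) k) ∂Pr
      ≤ 4 * v ^ 2 + 2 * msq (fun k => M k w0) := by
  have he := (estReg_init h hD hs hB hw0)
  have h1 := integral_le_sum (Pr := Pr) ![2, 2] ![fun ω => msq (fun k =>
    batchAvg O B (fun k b => s 0 k b ω) (fun _ => w0) k - M k w0), fun _ => msq (fun k => M k w0)]
    (integrable_dev he.memP) (by
      intro i; fin_cases i
      · exact integrable_msq he.memE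
      · exact integrable_const _) (fun ω => by
      simp only [Fin.sum_univ_two, Matrix.cons_val_zero, Matrix.cons_val_one]
      refine (dev_le_msq hK _).trans ?_
      have := msq_add_le_two (fun k => batchAvg O B (fun k b => s 0 k b ω) (fun _ => w0) k
        - M k w0) (fun k => M k w0)
      simpa using this)
  simp only [Fin.sum_univ_two, Matrix.cons_val_zero, Matrix.cons_val_one, integral_const,
    probReal_univ, one_smul] at h1
  linarith [(integral_init_err_le h hD hs hB hw0 hK).1]

end Init

section Step

variable {t : ℕ} {w w' : Fin K → Ω → Pt dx dy} (hw : IsMove Pr s r (t + 1) w w')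
  {U P U' P' : Fin K → Ω → Vec n} (hr : EstReg Pr s t M w U P) {a : ℝ}
  (hU' : ∀ k ω, U' k ω = (1 - a) • (U k ω - batchAvg O B (fun k b => s (t + 1) k b ω)
      (fun k => w k ω) k) + batchAvg O B (fun k b => s (t + 1) k b ω) (fun k => w' k ω) k)
  {E : Matrix (Fin K) (Fin K) ℝ} (hP' : ∀ k ω, P' k ω = mix E (fun k => P k ω) k + U' k ω - U k ω)
include h hD hs hB hw hr hU' hP'

lemma estReg_step : EstReg Pr s (t + 1) M w' U' P' := by
  have hle : past s (t + 1) ≤ past s (t + 1 + 1) := past_mono (Nat.le_succ _)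
  have hm : ∀ k, Measurable[past s (t + 1 + 1)] (U' k) := fun k => by
    rw [funext (hU' k)]
    exact ((((hr.measU k).mono hle le_rfl).sub (h.measurable_batchAvg
      (fun k => (hw.meas k).mono hle le_rfl) B k)).const_smul (1 - a)).add
      (h.measurable_batchAvg (fun k => (hw.meas' k).mono hle le_rfl) B k)
  refine ⟨hm, fun k => ?_, fun k => ?_, fun k => ?_⟩
  · rw [funext (hP' k)]
    exact ((measurable_mix (fun k => (hr.measP k).mono hle le_rfl) E k).add (hm k)).sub
      ((hr.measU k).mono hle le_rfl)
  · have h1 := (storm_increment h hD hs hw (a := a) (B := B) hB hr.memE).1 k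
    rw [funext (hP' k)]
    simp only [add_sub_assoc, hU']
    simp only [add_sub_assoc] at h1
    exact (memLp_mix hr.memP E k).add h1
  · have h1 := stormErr_memLp h hD hs hw a B hr.memE k
    simp only [hU']
    have e := fun ω => storm_sub_mean (O := O) (M := M) hB a (fun k b => s (t + 1) k b ω)
      (fun k => w k ω) (fun k => w' k ω) (fun k => U k ω) k
    simp only [e]
    exact h1

omit hs hB hU' hP' [IsProbabilityMeasure Pr] in
lemma measurable_err (k : Fin K) : Measurable[past s (t + 1)] (fun ω => U k ω - M k (w k ω)) :=
  (hr.measU k).sub ((h.measurable_mean hD k).comp (hw.meas k))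

/-- Recursions for the error of the average estimator, for the mean error of the workers, and for
the deviation of the tracker. -/
lemma estimator_recursion (hK : 1 ≤ K) (ha0 : 0 ≤ a) (ha1 : a ≤ 1) {lam : ℝ}
    (hE : IsGossip E lam) {d : ℝ}
    (hd : ∫ ω, (1 / (K : ℝ)) * ∑ k, dsq (w k ω) (w' k ω) ∂Pr ≤ d) :
    ∫ ω, ‖mean (fun k => U' k ω - M k (w' k ω))‖ ^ 2 ∂Pr
      ≤ (1 - a) * ∫ ω, ‖mean (fun k => U k ω - M k (w k ω))‖ ^ 2 ∂Pr
        + 1 / K * (8 * L ^ 2 * d + 2 * a ^ 2 * v ^ 2) ∧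
    ∫ ω, msq (fun k => U' k ω - M k (w' k ω)) ∂Pr
      ≤ (1 - a) * ∫ ω, msq (fun k => U k ω - M k (w k ω)) ∂Pr
        + (8 * L ^ 2 * d + 2 * a ^ 2 * v ^ 2) ∧
    ∫ ω, dev (fun k => P' k ω) ∂Pr ≤ lam * ∫ ω, dev (fun k => P k ω) ∂Pr
      + 2 / (1 - lam) * (3 * a ^ 2 * ∫ ω, msq (fun k => U k ω - M k (w k ω)) ∂Pr
        + 3 * a ^ 2 * v ^ 2 + 3 * L ^ 2 * d) := by
  have hme := measurable_err h hD hw hr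
  have e := fun ω k => storm_sub_mean (O := O) (M := M) hB a (fun k b => s (t + 1) k b ω)
      (fun k => w k ω) (fun k => w' k ω) (fun k => U k ω) k
  have hB' : (1 : ℝ) ≤ B := by exact_mod_cast hB
  have hK' : (1 : ℝ) ≤ K := by exact_mod_cast hK
  have hd0 : 0 ≤ d := (integral_nonneg fun ω => mul_nonneg (by positivity)
    (sum_nonneg fun k _ => dsq_nonneg _ _)).trans hd
  have hd' : 8 * L ^ 2 * ∫ ω, (1 / (K : ℝ)) * ∑ k, dsq (w k ω) (w' k ω) ∂Pr + 2 * a ^ 2 * v ^ 2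
      ≤ 8 * L ^ 2 * d + 2 * a ^ 2 * v ^ 2 := by gcongr
  have hn : 0 ≤ 8 * L ^ 2 * d + 2 * a ^ 2 * v ^ 2 := by positivity
  refine ⟨?_, ?_, ?_⟩
  · have h1 := integral_mean_stormErr_le h hD hs hw hK ha0 ha1 hB hme hr.memE
    simp only [hU', e]
    refine h1.trans (add_le_add_right ?_ _)
    refine (mul_le_mul_of_nonneg_left hd' (by positivity)).trans
      (mul_le_mul_of_nonneg_right ?_ hn)
    exact one_div_le_one_div_of_le (by linarith) (le_mul_of_one_le_right (by linarith) hB')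
  · have h1 := integral_msq_stormErr_le h hD hs hw ha0 ha1 hB hme hr.memE
    simp only [hU', e]
    refine h1.trans (add_le_add_right ?_ _)
    refine (mul_le_mul_of_nonneg_left hd' (by positivity)).trans ?_
    have : 1 / (B : ℝ) ≤ 1 := by rw [div_le_one (by linarith)]; exact hB'
    nlinarith
  · have hρ : 0 < 1 - lam := by linarith [hE.gap]
    have h2 := storm_increment h hD hs hw (a := a) (B := B) hB hr.memE
    have h1 := integral_le_sum (Pr := Pr) ![lam, 2 / (1 - lam)]
      ![fun ω => dev (fun k => P k ω), fun ω => msq (fun k => U' k ω - U k ω)]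
      (f := fun ω => dev (fun k => P' k ω))
      (integrable_dev (estReg_step h hD hs hB hw hr hU' hP').memP) (by
        intro i; fin_cases i
        · exact integrable_dev hr.memP
        · refine integrable_msq (X := fun k ω => U' k ω - U k ω) fun k => ?_
          simp only [hU']
          exact h2.1 k) (fun ω => by
        simp only [Fin.sum_univ_two, Matrix.cons_val_zero, Matrix.cons_val_one, hP']
        exact dev_tracker_le hE hK _ _ _)
    simp only [Fin.sum_univ_two, Matrix.cons_val_zero, Matrix.cons_val_one] at h1
    refine h1.trans (add_le_add_right (mul_le_mul_of_nonneg_left ?_ (by positivity)) _)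
    simp only [hU']
    refine h2.2.trans ?_
    gcongr

end Step

end Estimator

/-! ### Recursions for the moments of a run -/

section Run

variable {K dx dy : ℕ} {Sf Sg : Type*} [MeasurableSpace Sf] [MeasurableSpace Sg]
  {D : Problem K dx dy Sf Sg} {L v : ℝ} {p : Params}
  {Ω : Type*} [mΩ : MeasurableSpace Ω] {Pr : Measure Ω}
  {s : ℕ → Fin K → ℕ → Ω → Sf × Sg}

/-- A landscape with constant `L` together with stochastic oracles for the three means, which are
`L`-Lipschitz on the ball of radius `r` and have variance at most `v²` there. -/
structure Problem.Model (D : Problem K dx dy Sf Sg) (L r v : ℝ) : Prop where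
  well : D.WellPosed
  land : D.Landscape L r
  F : IsOracle D L r v D.oracleF D.meanF
  G : IsOracle D L r v D.oracleG D.meanG
  H : IsOracle D L r v D.oracleH D.meanH

/-- Adaptedness and second moments of a random state after iteration `t`. -/
structure StateReg (Pr : Measure Ω) (s : ℕ → Fin K → ℕ → Ω → Sf × Sg) (t : ℕ)
    (D : Problem K dx dy Sf Sg) (r : ℝ) (S : Ω → State K dx dy) : Prop where
  measX : ∀ k, Measurable[past s t] (fun ω => (S ω).X k)
  measY : ∀ k, Measurable[past s t] (fun ω => (S ω).Y k)
  measZ : ∀ k, Measurable[past s t] (fun ω => (S ω).Z k)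
  memX : ∀ k, MemLp (fun ω => (S ω).X k) 2 Pr
  memY : ∀ k, MemLp (fun ω => (S ω).Y k) 2 Pr
  memZ : ∀ k, MemLp (fun ω => (S ω).Z k) 2 Pr
  U : EstReg Pr s t D.meanF (fun k ω => (S ω).pt k) (fun k ω => (S ω).U k) (fun k ω => (S ω).P k)
  V : EstReg Pr s t D.meanG (fun k ω => (S ω).pt k) (fun k ω => (S ω).V k) (fun k ω => (S ω).Q k)
  W : EstReg Pr s t D.meanH (fun k ω => (S ω).pt k) (fun k ω => (S ω).W k) (fun k ω => (S ω).R k)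
  inv : ∀ ω, (S ω).Inv r

variable [IsProbabilityMeasure Pr] (hm : D.Model L p.radius v) (hs : IsSampling D Pr s)
  (hp : p.Valid)

include hm hs hp in
lemma stateReg_init {x0 : Vec dx} {y0 z0 : Vec dy} (hz : ‖z0‖ ≤ p.radius) :
    StateReg Pr s 0 D p.radius (fun ω => initState D p x0 y0 z0 (fun k b => s 0 k b ω)) where
  measX _ := @measurable_const _ _ _ (past s 0) _
  measY _ := @measurable_const _ _ _ (past s 0) _
  measZ _ := @measurable_const _ _ _ (past s 0) _
  memX _ := memLp_const _
  memY _ := memLp_const _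
  memZ _ := memLp_const _
  U := estReg_init hm.F hm.well hs (B := p.batch 0) hp.B0_pos (w0 := (x0, y0, z0)) hz
  V := estReg_init hm.G hm.well hs (B := p.batch 0) hp.B0_pos (w0 := (x0, y0, z0)) hz
  W := estReg_init hm.H hm.well hs (B := p.batch 0) hp.B0_pos (w0 := (x0, y0, z0)) hz
  inv _ := ⟨rfl, rfl, rfl, fun _ => hz⟩

variable {E : Matrix (Fin K) (Fin K) ℝ} {lam : ℝ} (hE : IsGossip E lam) (hη : p.η ≤ 1)
  {B : ℕ} (hB : 1 ≤ B) {t : ℕ} {S S' : Ω → State K dx dy}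
  (hS' : ∀ ω, S' ω = stepState D E p B (fun k b => s (t + 1) k b ω) (S ω))
  (hS : StateReg Pr s t D p.radius S)

section Iterates
include hm hp hE hη hS' hS

omit hp hE hη in
lemma memLp_step : (∀ k, MemLp (fun ω => (S' ω).X k) 2 Pr) ∧
    (∀ k, MemLp (fun ω => (S' ω).Y k) 2 Pr) ∧ ∀ k, MemLp (fun ω => (S' ω).Z k) 2 Pr := by
  simp only [hS']
  exact ⟨memLp_relaxed_gossip E p.η p.β₁ hS.memX hS.U.memP (φ := id) (fun _ _ => le_rfl),
    memLp_relaxed_gossip E p.η p.β₂ hS.memY hS.V.memP (φ := id) (fun _ _ => le_rfl),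
    memLp_relaxed_gossip E p.η p.β₃ hS.memZ hS.W.memP
      (ballProj_nonexpansive hm.land.radius_nonneg)⟩

omit [IsProbabilityMeasure Pr] hp hE hη in
lemma measurable_step : (∀ k, Measurable[past s (t + 1)] (fun ω => (S' ω).X k)) ∧
    (∀ k, Measurable[past s (t + 1)] (fun ω => (S' ω).Y k)) ∧
    ∀ k, Measurable[past s (t + 1)] (fun ω => (S' ω).Z k) := by
  have hle : past s t ≤ past s (t + 1) := past_mono (Nat.le_succ _)
  simp only [hS']
  exact ⟨measurable_relaxed_gossip E p.η p.β₁ (fun k => (hS.measX k).mono hle le_rfl)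
      hS.U.measP (φ := id) continuous_id,
    measurable_relaxed_gossip E p.η p.β₂ (fun k => (hS.measY k).mono hle le_rfl)
      hS.V.measP (φ := id) continuous_id,
    measurable_relaxed_gossip E p.η p.β₃ (fun k => (hS.measZ k).mono hle le_rfl)
      hS.W.measP (continuous_ballProj hm.land.radius_nonneg)⟩

omit [IsProbabilityMeasure Pr] in
lemma inv_step (ω : Ω) : (S' ω).Inv p.radius := by
  rw [hS']
  exact inv_stepState hE hp hη hm.land.radius_nonneg B _ (hS.inv ω)

lemma isMove_step : IsMove Pr s p.radius (t + 1) (fun k ω => (S ω).pt k)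
    (fun k ω => (S' ω).pt k) := by
  have hle : past s t ≤ past s (t + 1) := past_mono (Nat.le_succ _)
  obtain ⟨h1, h2, h3⟩ := measurable_step hm hS' hS
  obtain ⟨i1, i2, i3⟩ := memLp_step hm hS' hS
  refine ⟨fun k => ?_, fun k => ?_, fun k ω => (hS.inv ω).Z k,
    fun k ω => (inv_step hm hp hE hη hS' hS ω).Z k, fun k => ?_⟩
  · exact (((hS.measX k).mono hle le_rfl).prodMk
      (((hS.measY k).mono hle le_rfl).prodMk ((hS.measZ k).mono hle le_rfl)))
  · exact (h1 k).prodMk ((h2 k).prodMk (h3 k))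
  · exact ((((hS.memX k).sub (i1 k)).integrable_norm_pow (by norm_num : 2 ≠ 0)).add
      (((hS.memY k).sub (i2 k)).integrable_norm_pow (by norm_num : 2 ≠ 0))).add
      (((hS.memZ k).sub (i3 k)).integrable_norm_pow (by norm_num : 2 ≠ 0))

include hs hB

lemma stateReg_step : StateReg Pr s (t + 1) D p.radius S' := by
  have hw := isMove_step hm hp hE hη hS' hS
  obtain ⟨h1, h2, h3⟩ := measurable_step hm hS' hS
  obtain ⟨i1, i2, i3⟩ := memLp_step hm hS' hS
  exact ⟨h1, h2, h3, i1, i2, i3,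
    estReg_step hm.F hm.well hs hB hw hS.U (a := p.α₁ * p.η ^ 2) (E := E)
      (fun k ω => by simp only [hS']; rfl) (fun k ω => by simp only [hS']; rfl),
    estReg_step hm.G hm.well hs hB hw hS.V (a := p.α₂ * p.η ^ 2) (E := E)
      (fun k ω => by simp only [hS']; rfl) (fun k ω => by simp only [hS']; rfl),
    estReg_step hm.H hm.well hs hB hw hS.W (a := p.α₃ * p.η ^ 2) (E := E)
      (fun k ω => by simp only [hS']; rfl) (fun k ω => by simp only [hS']; rfl),
    inv_step hm hp hE hη hS' hS⟩

end Iterates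

/-! ### Second moments and their recursions -/

/-- The second moments that the analysis follows: deviations of the iterates, distances to the
inner solutions, errors of the average estimators, mean errors of the workers, deviations of the
trackers, and the size of the average search direction `Ū`. -/
structure Moments where
  kx : ℝ
  ky : ℝ
  kz : ℝ
  gy : ℝ
  gz : ℝ
  nF : ℝ
  nG : ℝ
  nH : ℝ
  eF : ℝ
  eG : ℝ
  eH : ℝ
  pP : ℝ
  pQ : ℝ
  pR : ℝ
  u : ℝ

/-- The moments of a random state. -/
def moments (Pr : Measure Ω) (D : Problem K dx dy Sf Sg) (S : Ω → State K dx dy) : Moments where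
  kx := ∫ ω, dev (S ω).X ∂Pr
  ky := ∫ ω, dev (S ω).Y ∂Pr
  kz := ∫ ω, dev (S ω).Z ∂Pr
  gy := ∫ ω, (S ω).gapY D ∂Pr
  gz := ∫ ω, (S ω).gapZ D ∂Pr
  nF := ∫ ω, ‖mean ((S ω).errU D)‖ ^ 2 ∂Pr
  nG := ∫ ω, ‖mean ((S ω).errV D)‖ ^ 2 ∂Pr
  nH := ∫ ω, ‖mean ((S ω).errW D)‖ ^ 2 ∂Pr
  eF := ∫ ω, msq ((S ω).errU D) ∂Pr
  eG := ∫ ω, msq ((S ω).errV D) ∂Pr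
  eH := ∫ ω, msq ((S ω).errW D) ∂Pr
  pP := ∫ ω, dev (S ω).P ∂Pr
  pQ := ∫ ω, dev (S ω).Q ∂Pr
  pR := ∫ ω, dev (S ω).R ∂Pr
  u := ∫ ω, ‖mean (S ω).U‖ ^ 2 ∂Pr

/-- All moments are nonnegative. -/
structure Moments.Nonneg (m : Moments) : Prop where
  kx : 0 ≤ m.kx
  ky : 0 ≤ m.ky
  kz : 0 ≤ m.kz
  gy : 0 ≤ m.gy
  gz : 0 ≤ m.gz
  nF : 0 ≤ m.nF
  nG : 0 ≤ m.nG
  nH : 0 ≤ m.nH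
  eF : 0 ≤ m.eF
  eG : 0 ≤ m.eG
  eH : 0 ≤ m.eH
  pP : 0 ≤ m.pP
  pQ : 0 ≤ m.pQ
  pR : 0 ≤ m.pR
  u : 0 ≤ m.u

omit [IsProbabilityMeasure Pr] in
lemma moments_nonneg : (moments Pr D S).Nonneg where
  kx := integral_nonneg fun _ => dev_nonneg _
  ky := integral_nonneg fun _ => dev_nonneg _
  kz := integral_nonneg fun _ => dev_nonneg _
  gy := integral_nonneg fun _ => sq_nonneg _
  gz := integral_nonneg fun _ => msq_nonneg _
  nF := integral_nonneg fun _ => sq_nonneg _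
  nG := integral_nonneg fun _ => sq_nonneg _
  nH := integral_nonneg fun _ => sq_nonneg _
  eF := integral_nonneg fun _ => msq_nonneg _
  eG := integral_nonneg fun _ => msq_nonneg _
  eH := integral_nonneg fun _ => msq_nonneg _
  pP := integral_nonneg fun _ => dev_nonneg _
  pQ := integral_nonneg fun _ => dev_nonneg _
  pR := integral_nonneg fun _ => dev_nonneg _
  u := integral_nonneg fun _ => sq_nonneg _

/-- Bound for the mean squared displacement of the iterates in one iteration. -/
def Moments.move (m : Moments) (p : Params) (L : ℝ) : ℝ :=
  p.η ^ 2 * (8 * (m.kx + m.ky + m.kz) + 2 * p.β₁ ^ 2 * (m.u + m.pP)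
    + 2 * p.β₂ ^ 2 * (2 * m.nG + 2 * L ^ 2 * (m.kx + m.ky + m.gy) + m.pQ)
    + 2 * p.β₃ ^ 2 * (2 * m.nH + 2 * L ^ 2 * (m.kx + m.ky + m.gy + m.gz) + m.pR))

/-- The recursions that one iteration imposes on the moments. -/
structure Moments.Step (p : Params) (L v lam : ℝ) (K : ℕ) (m m' : Moments) : Prop where
  kx : m'.kx ≤ (1 - p.η * (1 - lam)) * m.kx + 2 * p.η / (1 - lam) * p.β₁ ^ 2 * m.pP
  ky : m'.ky ≤ (1 - p.η * (1 - lam)) * m.ky + 2 * p.η / (1 - lam) * p.β₂ ^ 2 * m.pQ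
  kz : m'.kz ≤ (1 - p.η * (1 - lam)) * m.kz + 2 * p.η / (1 - lam) * p.β₃ ^ 2 * m.pR
  gy : m'.gy ≤ (1 - p.η * p.β₂ / L / 2) * m.gy
    + 12 * L * (p.η * p.β₂) * (m.nG + L ^ 2 * (m.kx + m.ky))
    + 3 * L ^ 3 * (p.η * p.β₁ ^ 2 / p.β₂) * m.u
  gz : m'.gz ≤ (1 - p.η * p.β₃ / L / 2) * m.gz
    + 12 * L * (p.η * p.β₃) * (m.nH + L ^ 2 * (m.kx + m.ky + m.gy))
    + 3 * p.η * p.β₃ ^ 2 / (1 - lam) * m.pR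
    + 3 * L ^ 3 * (p.η * p.β₁ ^ 2 / p.β₃) * m.u
  nF : m'.nF ≤ (1 - p.α₁ * p.η ^ 2) * m.nF
    + 1 / K * (8 * L ^ 2 * m.move p L + 2 * (p.α₁ * p.η ^ 2) ^ 2 * v ^ 2)
  nG : m'.nG ≤ (1 - p.α₂ * p.η ^ 2) * m.nG
    + 1 / K * (8 * L ^ 2 * m.move p L + 2 * (p.α₂ * p.η ^ 2) ^ 2 * v ^ 2)
  nH : m'.nH ≤ (1 - p.α₃ * p.η ^ 2) * m.nH
    + 1 / K * (8 * L ^ 2 * m.move p L + 2 * (p.α₃ * p.η ^ 2) ^ 2 * v ^ 2)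
  eF : m'.eF ≤ (1 - p.α₁ * p.η ^ 2) * m.eF
    + (8 * L ^ 2 * m.move p L + 2 * (p.α₁ * p.η ^ 2) ^ 2 * v ^ 2)
  eG : m'.eG ≤ (1 - p.α₂ * p.η ^ 2) * m.eG
    + (8 * L ^ 2 * m.move p L + 2 * (p.α₂ * p.η ^ 2) ^ 2 * v ^ 2)
  eH : m'.eH ≤ (1 - p.α₃ * p.η ^ 2) * m.eH
    + (8 * L ^ 2 * m.move p L + 2 * (p.α₃ * p.η ^ 2) ^ 2 * v ^ 2)
  pP : m'.pP ≤ lam * m.pP + 2 / (1 - lam) * (3 * (p.α₁ * p.η ^ 2) ^ 2 * m.eF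
    + 3 * (p.α₁ * p.η ^ 2) ^ 2 * v ^ 2 + 3 * L ^ 2 * m.move p L)
  pQ : m'.pQ ≤ lam * m.pQ + 2 / (1 - lam) * (3 * (p.α₂ * p.η ^ 2) ^ 2 * m.eG
    + 3 * (p.α₂ * p.η ^ 2) ^ 2 * v ^ 2 + 3 * L ^ 2 * m.move p L)
  pR : m'.pR ≤ lam * m.pR + 2 / (1 - lam) * (3 * (p.α₃ * p.η ^ 2) ^ 2 * m.eH
    + 3 * (p.α₃ * p.η ^ 2) ^ 2 * v ^ 2 + 3 * L ^ 2 * m.move p L)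

section Integrable
include hm hS

omit [IsProbabilityMeasure Pr] hm in
lemma StateReg.memLp_mean_U : MemLp (fun ω => mean (S ω).U) 2 Pr := by
  simp only [← (hS.inv _).P]
  exact memLp_mean hS.U.memP

lemma StateReg.memLp_yStar : MemLp (fun ω => D.yStar (mean (S ω).X)) 2 Pr :=
  memLp_lipschitz hm.land.y_lip (memLp_mean hS.memX)

lemma StateReg.memLp_zStar : MemLp (fun ω => D.zStar (mean (S ω).X)) 2 Pr :=
  memLp_lipschitz hm.land.z_lip (memLp_mean hS.memX)

lemma StateReg.integrable_gapY : Integrable (fun ω => (S ω).gapY D) Pr :=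
  ((memLp_mean hS.memY).sub (hS.memLp_yStar hm)).integrable_norm_pow (by norm_num)

lemma StateReg.integrable_gapZ : Integrable (fun ω => (S ω).gapZ D) Pr :=
  integrable_msq (X := fun k ω => (S ω).Z k - D.zStar (mean (S ω).X))
    fun k => (hS.memZ k).sub (hS.memLp_zStar hm)

omit [IsProbabilityMeasure Pr] hm in
lemma StateReg.integrable_u : Integrable (fun ω => ‖mean (S ω).U‖ ^ 2) Pr :=
  hS.memLp_mean_U.integrable_norm_pow (by norm_num)

end Integrable

end Run

section Run

variable {K dx dy : ℕ} {Sf Sg : Type*} [MeasurableSpace Sf] [MeasurableSpace Sg]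
  {D : Problem K dx dy Sf Sg} {L v : ℝ} {p : Params}
  {Ω : Type*} [mΩ : MeasurableSpace Ω] {Pr : Measure Ω} [IsProbabilityMeasure Pr]
  {s : ℕ → Fin K → ℕ → Ω → Sf × Sg} (hm : D.Model L p.radius v) (hs : IsSampling D Pr s)
  (hp : p.Valid) {E : Matrix (Fin K) (Fin K) ℝ} {lam : ℝ} (hE : IsGossip E lam) (hK : 1 ≤ K)
  (hη : p.η ≤ 1) {B : ℕ} (hB : 1 ≤ B) {t : ℕ} {S S' : Ω → State K dx dy}
  (hS' : ∀ ω, S' ω = stepState D E p B (fun k b => s (t + 1) k b ω) (S ω))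
  (hS : StateReg Pr s t D p.radius S)

include hm hp hE hK hη hS' hS

lemma integral_dev_step :
    (moments Pr D S').kx ≤ (1 - p.η * (1 - lam)) * (moments Pr D S).kx
      + 2 * p.η / (1 - lam) * p.β₁ ^ 2 * (moments Pr D S).pP ∧
    (moments Pr D S').ky ≤ (1 - p.η * (1 - lam)) * (moments Pr D S).ky
      + 2 * p.η / (1 - lam) * p.β₂ ^ 2 * (moments Pr D S).pQ ∧
    (moments Pr D S').kz ≤ (1 - p.η * (1 - lam)) * (moments Pr D S).kz
      + 2 * p.η / (1 - lam) * p.β₃ ^ 2 * (moments Pr D S).pR := by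
  obtain ⟨i1, i2, i3⟩ := memLp_step hm hS' hS
  have key : ∀ {n : ℕ} (X P X' : Fin K → Ω → Vec n) (β : ℝ) (φ : Vec n → Vec n),
      (∀ k, MemLp (X k) 2 Pr) → (∀ k, MemLp (P k) 2 Pr) → (∀ k, MemLp (X' k) 2 Pr) →
      (∀ a b, ‖φ a - φ b‖ ≤ ‖a - b‖) →
      (∀ k ω, X' k ω = X k ω + p.η • (φ (mix E (fun k => X k ω) k - β • P k ω) - X k ω)) →
      ∫ ω, dev (fun k => X' k ω) ∂Pr ≤ (1 - p.η * (1 - lam)) * ∫ ω, dev (fun k => X k ω) ∂Pr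
        + 2 * p.η / (1 - lam) * β ^ 2 * ∫ ω, dev (fun k => P k ω) ∂Pr := by
    intro n X P X' β φ hX hP hX' hφ he
    have h1 := integral_le_sum (Pr := Pr) ![1 - p.η * (1 - lam), 2 * p.η / (1 - lam) * β ^ 2]
      ![fun ω => dev (fun k => X k ω), fun ω => dev (fun k => P k ω)]
      (f := fun ω => dev (fun k => X' k ω)) (integrable_dev hX') (by
        intro i; fin_cases i
        · exact integrable_dev hX
        · exact integrable_dev hP) (fun ω => by
        simp only [Fin.sum_univ_two, Matrix.cons_val_zero, Matrix.cons_val_one, he]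
        exact dev_relaxed_gossip_le hE hK hp.η_pos.le hη _ _ β hφ)
    simpa only [Fin.sum_univ_two, Matrix.cons_val_zero, Matrix.cons_val_one] using h1
  exact ⟨key (fun k ω => (S ω).X k) (fun k ω => (S ω).P k) (fun k ω => (S' ω).X k) p.β₁ id
      hS.memX hS.U.memP i1 (fun _ _ => le_rfl) (fun k ω => by rw [hS']; rfl),
    key (fun k ω => (S ω).Y k) (fun k ω => (S ω).Q k) (fun k ω => (S' ω).Y k) p.β₂ id
      hS.memY hS.V.memP i2 (fun _ _ => le_rfl) (fun k ω => by rw [hS']; rfl),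
    key (fun k ω => (S ω).Z k) (fun k ω => (S ω).R k) (fun k ω => (S' ω).Z k) p.β₃ _
      hS.memZ hS.W.memP i3 (ballProj_nonexpansive hm.land.radius_nonneg)
      (fun k ω => by rw [hS']; rfl)⟩

lemma integral_gapY_step (hβ : 4 * L ^ 3 * p.β₂ ≤ 1) (hY' : Integrable (fun ω => (S' ω).gapY D) Pr) :
    (moments Pr D S').gy ≤ (1 - p.η * p.β₂ / L / 2) * (moments Pr D S).gy
    + 12 * L * (p.η * p.β₂) * ((moments Pr D S).nG + L ^ 2 * ((moments Pr D S).kx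
      + (moments Pr D S).ky)) + 3 * L ^ 3 * (p.η * p.β₁ ^ 2 / p.β₂) * (moments Pr D S).u := by
  have h1 := integral_le_sum (Pr := Pr) ![1 - p.η * p.β₂ / L / 2, 12 * L * (p.η * p.β₂),
      12 * L * (p.η * p.β₂) * L ^ 2, 12 * L * (p.η * p.β₂) * L ^ 2,
      3 * L ^ 3 * (p.η * p.β₁ ^ 2 / p.β₂)]
    ![fun ω => (S ω).gapY D, fun ω => ‖mean ((S ω).errV D)‖ ^ 2, fun ω => dev (S ω).X,
      fun ω => dev (S ω).Y, fun ω => ‖mean (S ω).U‖ ^ 2] hY' (by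
      intro i; fin_cases i
      · exact hS.integrable_gapY hm
      · exact integrable_norm_mean_sq hS.V.memE
      · exact integrable_dev hS.memX
      · exact integrable_dev hS.memY
      · exact hS.integrable_u) (fun ω => by
      rw [hS']
      refine (gapY_stepState_le hm.land hK hE hp hη (hS.inv ω) B _ hβ).trans (le_of_eq ?_)
      simp [Fin.sum_univ_five]
      ring)
  refine h1.trans (le_of_eq ?_)
  simp [Fin.sum_univ_five, moments]
  ring

lemma integral_gapZ_step (hβ : 9 * L ^ 3 * p.β₃ ≤ 1 - lam)
    (hZ' : Integrable (fun ω => (S' ω).gapZ D) Pr) :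
    (moments Pr D S').gz ≤ (1 - p.η * p.β₃ / L / 2) * (moments Pr D S).gz
    + 12 * L * (p.η * p.β₃) * ((moments Pr D S).nH + L ^ 2 * ((moments Pr D S).kx
      + (moments Pr D S).ky + (moments Pr D S).gy))
    + 3 * p.η * p.β₃ ^ 2 / (1 - lam) * (moments Pr D S).pR
    + 3 * L ^ 3 * (p.η * p.β₁ ^ 2 / p.β₃) * (moments Pr D S).u := by
  have h1 := integral_le_sum (Pr := Pr) ![1 - p.η * p.β₃ / L / 2, 12 * L * (p.η * p.β₃),
      12 * L * (p.η * p.β₃) * L ^ 2, 12 * L * (p.η * p.β₃) * L ^ 2, 12 * L * (p.η * p.β₃) * L ^ 2,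
      3 * p.η * p.β₃ ^ 2 / (1 - lam), 3 * L ^ 3 * (p.η * p.β₁ ^ 2 / p.β₃)]
    ![fun ω => (S ω).gapZ D, fun ω => ‖mean ((S ω).errW D)‖ ^ 2, fun ω => dev (S ω).X,
      fun ω => dev (S ω).Y, fun ω => (S ω).gapY D, fun ω => dev (S ω).R,
      fun ω => ‖mean (S ω).U‖ ^ 2] hZ' (by
      intro i; fin_cases i
      · exact hS.integrable_gapZ hm
      · exact integrable_norm_mean_sq hS.W.memE
      · exact integrable_dev hS.memX
      · exact integrable_dev hS.memY
      · exact hS.integrable_gapY hm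
      · exact integrable_dev hS.W.memP
      · exact hS.integrable_u) (fun ω => by
      rw [hS']
      refine (gapZ_stepState_le hm.land hK hE hp hη (hS.inv ω) B _ hβ).trans (le_of_eq ?_)
      simp [Fin.sum_univ_seven]
      ring)
  refine h1.trans (le_of_eq ?_)
  simp [Fin.sum_univ_seven, moments]
  ring

omit [IsProbabilityMeasure Pr] hp hη in
/-- Mean squared displacement of the columns in one iteration. The average estimators `V̄` and `W̄`
vanish at the solutions of the inner problems up to their errors, so they are bounded by the inner
gaps and the consensus errors. -/
lemma msq_move_le (ω : Ω) : (1 / (K : ℝ)) * ∑ k, dsq ((S ω).pt k) ((S' ω).pt k)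
    ≤ p.η ^ 2 * (8 * (dev (S ω).X + dev (S ω).Y + dev (S ω).Z)
      + 2 * p.β₁ ^ 2 * (‖mean (S ω).U‖ ^ 2 + dev (S ω).P)
      + 2 * p.β₂ ^ 2 * (2 * ‖mean ((S ω).errV D)‖ ^ 2
        + 2 * L ^ 2 * (dev (S ω).X + dev (S ω).Y + (S ω).gapY D) + dev (S ω).Q)
      + 2 * p.β₃ ^ 2 * (2 * ‖mean ((S ω).errW D)‖ ^ 2
        + 2 * L ^ 2 * (dev (S ω).X + dev (S ω).Y + (S ω).gapY D + (S ω).gapZ D)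
        + dev (S ω).R)) := by
  have hI := hS.inv ω
  have h1 := msq_relaxed_gossip_le hE hK (η := p.η) (S ω).X (S ω).P p.β₁ (φ := id)
    (fun _ _ => le_rfl) (fun _ => rfl)
  have h2 := msq_relaxed_gossip_le hE hK (η := p.η) (S ω).Y (S ω).Q p.β₂ (φ := id)
    (fun _ _ => le_rfl) (fun _ => rfl)
  have h3 := msq_relaxed_gossip_le hE hK (η := p.η) (S ω).Z (S ω).R p.β₃
    (φ := ballProj p.radius) (ballProj_nonexpansive hm.land.radius_nonneg)
    (fun k => ballProj_of_le (hI.Z k))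
  rw [hI.P] at h1
  rw [hI.Q] at h2
  rw [hI.R] at h3
  have h4 := mul_le_mul_of_nonneg_left (norm_mean_V_sq_le hm.land hK hI)
    (by positivity : 0 ≤ p.η ^ 2 * (2 * p.β₂ ^ 2))
  have h5 := mul_le_mul_of_nonneg_left (norm_mean_W_sq_le hm.land hK hI)
    (by positivity : 0 ≤ p.η ^ 2 * (2 * p.β₃ ^ 2))
  rw [avg_dsq, hS']
  refine (add_le_add (add_le_add h1 h2) h3).trans ?_
  linarith

lemma integral_move_le : ∫ ω, (1 / (K : ℝ)) * ∑ k, dsq ((S ω).pt k) ((S' ω).pt k) ∂Pr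
    ≤ (moments Pr D S).move p L := by
  have hw := isMove_step hm hp hE hη hS' hS
  have h1 := integral_le_sum (Pr := Pr) ![p.η ^ 2 * (8 + 4 * L ^ 2 * (p.β₂ ^ 2 + p.β₃ ^ 2)),
      p.η ^ 2 * (8 + 4 * L ^ 2 * (p.β₂ ^ 2 + p.β₃ ^ 2)), p.η ^ 2 * 8, p.η ^ 2 * (2 * p.β₁ ^ 2),
      p.η ^ 2 * (2 * p.β₁ ^ 2), p.η ^ 2 * (4 * p.β₂ ^ 2), p.η ^ 2 * (2 * p.β₂ ^ 2),
      p.η ^ 2 * (4 * p.β₃ ^ 2), p.η ^ 2 * (2 * p.β₃ ^ 2),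
      p.η ^ 2 * (4 * L ^ 2 * (p.β₂ ^ 2 + p.β₃ ^ 2)), p.η ^ 2 * (4 * L ^ 2 * p.β₃ ^ 2)]
    ![fun ω => dev (S ω).X, fun ω => dev (S ω).Y, fun ω => dev (S ω).Z,
      fun ω => ‖mean (S ω).U‖ ^ 2, fun ω => dev (S ω).P,
      fun ω => ‖mean ((S ω).errV D)‖ ^ 2, fun ω => dev (S ω).Q,
      fun ω => ‖mean ((S ω).errW D)‖ ^ 2, fun ω => dev (S ω).R,
      fun ω => (S ω).gapY D, fun ω => (S ω).gapZ D]
    ((integrable_finsetSum univ fun k _ => hw.int k).const_mul (1 / (K : ℝ))) (by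
      intro i; fin_cases i
      · exact integrable_dev hS.memX
      · exact integrable_dev hS.memY
      · exact integrable_dev hS.memZ
      · exact hS.integrable_u
      · exact integrable_dev hS.U.memP
      · exact integrable_norm_mean_sq hS.V.memE
      · exact integrable_dev hS.V.memP
      · exact integrable_norm_mean_sq hS.W.memE
      · exact integrable_dev hS.W.memP
      · exact hS.integrable_gapY hm
      · exact hS.integrable_gapZ hm) (fun ω => by
      refine (msq_move_le hm hE hK hS' hS ω).trans (le_of_eq ?_)
      simp [Fin.sum_univ_succ]
      ring)
  refine h1.trans (le_of_eq ?_)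
  simp [Fin.sum_univ_succ, moments, Moments.move]
  ring

include hs hB in
/-- One iteration obeys the moment recursions. -/
lemma moments_step (hβ₂ : 4 * L ^ 3 * p.β₂ ≤ 1) (hβ₃ : 9 * L ^ 3 * p.β₃ ≤ 1 - lam) :
    Moments.Step p L v lam K (moments Pr D S) (moments Pr D S') := by
  have hS1 := stateReg_step hm hs hp hE hη hB hS' hS
  have hw := isMove_step hm hp hE hη hS' hS
  have hd := integral_move_le hm hp hE hK hη hS' hS
  obtain ⟨d1, d2, d3⟩ := integral_dev_step hm hp hE hK hη hS' hS
  obtain ⟨u1, u2, u3⟩ := estimator_recursion hm.F hm.well hs hB hw hS.U (U' := fun k ω => (S' ω).U k)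
    (P' := fun k ω => (S' ω).P k) (a := p.α₁ * p.η ^ 2) (E := E)
    (fun k ω => by simp only [hS']; rfl) (fun k ω => by simp only [hS']; rfl) hK
    (mul_pos hp.α₁_pos (pow_pos hp.η_pos 2)).le hp.α₁_lt.le hE hd
  obtain ⟨v1, v2, v3⟩ := estimator_recursion hm.G hm.well hs hB hw hS.V (U' := fun k ω => (S' ω).V k)
    (P' := fun k ω => (S' ω).Q k) (a := p.α₂ * p.η ^ 2) (E := E)
    (fun k ω => by simp only [hS']; rfl) (fun k ω => by simp only [hS']; rfl) hK
    (mul_pos hp.α₂_pos (pow_pos hp.η_pos 2)).le hp.α₂_lt.le hE hd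
  obtain ⟨w1, w2, w3⟩ := estimator_recursion hm.H hm.well hs hB hw hS.W (U' := fun k ω => (S' ω).W k)
    (P' := fun k ω => (S' ω).R k) (a := p.α₃ * p.η ^ 2) (E := E)
    (fun k ω => by simp only [hS']; rfl) (fun k ω => by simp only [hS']; rfl) hK
    (mul_pos hp.α₃_pos (pow_pos hp.η_pos 2)).le hp.α₃_lt.le hE hd
  exact ⟨d1, d2, d3, integral_gapY_step hm hp hE hK hη hS' hS hβ₂ (hS1.integrable_gapY hm),
    integral_gapZ_step hm hp hE hK hη hS' hS hβ₃ (hS1.integrable_gapZ hm),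
    u1, v1, w1, u2, v2, w2, u3, v3, w3⟩

omit hp hE hη hS' in
/-- The hypergradient at the average iterate is square integrable. -/
lemma integrable_hyperGrad_sq :
    Integrable (fun ω => ‖D.hyperGrad (mean (S ω).X)‖ ^ 2) Pr := by
  have hX : AEStronglyMeasurable (fun ω => mean (S ω).X) Pr :=
    (memLp_mean hS.memX).aestronglyMeasurable
  have hh : Measurable D.hyperGrad := by
    have hc : ∀ {T : Vec dx → Vec dy}, (∀ x x', ‖T x - T x'‖ ≤ L * ‖x - x'‖) → Measurable T :=
      fun hT => (LipschitzWith.of_dist_le_mul (K := Real.toNNReal L) fun a b => by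
        rw [dist_eq_norm, dist_eq_norm]
        exact (hT a b).trans (mul_le_mul_of_nonneg_right (Real.le_coe_toNNReal L)
          (norm_nonneg _))).continuous.measurable
    refine (Finset.measurable_fun_sum _ fun k _ => ?_).const_smul (1 / (K : ℝ))
    exact (hm.F.measurable_mean hm.well k).comp
      (measurable_id.prodMk ((hc hm.land.y_lip).prodMk (hc hm.land.z_lip)))
  have hmeas : AEStronglyMeasurable (fun ω => D.hyperGrad (mean (S ω).X)) Pr :=
    (hh.comp_aemeasurable hX.aemeasurable).aestronglyMeasurable
  refine Integrable.mono' (((hS.integrable_u).const_mul 2).add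
    (((integrable_norm_mean_sq hS.U.memE).const_mul 4).add
    (((((integrable_dev hS.memX).add (integrable_dev hS.memY)).add (hS.integrable_gapY hm)).add
      (hS.integrable_gapZ hm)).const_mul (4 * L ^ 2)))) (hmeas.norm.pow 2)
    (Filter.Eventually.of_forall fun ω => ?_)
  have h1 := norm_hyperGrad_sub_sq_le hm.land hK (hS.inv ω)
  have h2 := norm_add_sq_le_two (mean (S ω).U) (D.hyperGrad (mean (S ω).X) - mean (S ω).U)
  rw [add_sub_cancel] at h2
  rw [Real.norm_of_nonneg (by positivity)]
  change ‖D.hyperGrad (mean (S ω).X)‖ ^ 2 ≤ 2 * ‖mean (S ω).U‖ ^ 2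
    + (4 * ‖mean ((S ω).errU D)‖ ^ 2 + 4 * L ^ 2 * (dev (S ω).X + dev (S ω).Y + (S ω).gapY D
      + (S ω).gapZ D))
  linarith

end Run

/-! ### The whole run -/

section Descent

variable {K dx dy : ℕ} {Sf Sg : Type*} [MeasurableSpace Sf] [MeasurableSpace Sg]
  {D : Problem K dx dy Sf Sg} {L v : ℝ} {p : Params}
  {Ω : Type*} [mΩ : MeasurableSpace Ω] {Pr : Measure Ω} [IsProbabilityMeasure Pr]
  {s : ℕ → Fin K → ℕ → Ω → Sf × Sg} (hm : D.Model L p.radius v) (hs : IsSampling D Pr s)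
  (hp : p.Valid) {E : Matrix (Fin K) (Fin K) ℝ} {lam : ℝ} (hE : IsGossip E lam) (hK : 1 ≤ K)
  (hη : p.η ≤ 1) {x0 : Vec dx} {y0 z0 : Vec dy} (hz : ‖z0‖ ≤ p.radius)

include hm hs hp hE hη hz in
lemma stateReg_run (t : ℕ) :
    StateReg Pr s t D p.radius (fun ω => run D E p x0 y0 z0 (fun t k b => s t k b ω) t) := by
  induction t with
  | zero => exact stateReg_init hm hs hp hz
  | succ t ih =>
    exact stateReg_step hm hs hp hE hη (B := p.batch (t + 1)) (by
      simpa [Params.batch] using hp.B1_pos) (fun ω => rfl) ih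

include hm hp hE hK hη hz in
/-- Telescoped descent along one run. -/
lemma descent_run (hβ : 4 * L * p.β₁ ≤ 1) (q : ℕ → Fin K → ℕ → Sf × Sg) {Δ : ℝ}
    (hΔ : ∀ x, D.F x0 - D.F x ≤ Δ) (T : ℕ) :
    ∑ t ∈ range T, (1 / 2 * ‖D.hyperGrad (mean (run D E p x0 y0 z0 q t).X)‖ ^ 2
      + 1 / 4 * ‖mean (run D E p x0 y0 z0 q t).U‖ ^ 2) ≤ Δ / (p.η * p.β₁)
      + ∑ t ∈ range T, (‖mean ((run D E p x0 y0 z0 q t).errU D)‖ ^ 2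
        + L ^ 2 * (dev (run D E p x0 y0 z0 q t).X + dev (run D E p x0 y0 z0 q t).Y
          + (run D E p x0 y0 z0 q t).gapY D + (run D E p x0 y0 z0 q t).gapZ D)) := by
  have hc : 0 < p.η * p.β₁ := mul_pos hp.η_pos hp.β₁_pos
  have hinv : ∀ t, (run D E p x0 y0 z0 q t).Inv p.radius := by
    intro t
    induction t with
    | zero => exact ⟨rfl, rfl, rfl, fun _ => hz⟩
    | succ t ih => exact inv_stepState hE hp hη hm.land.radius_nonneg _ _ ih
  have h1 : D.F (mean (run D E p x0 y0 z0 q T).X) + p.η * p.β₁ * ∑ t ∈ range T,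
      (1 / 2 * ‖D.hyperGrad (mean (run D E p x0 y0 z0 q t).X)‖ ^ 2
      + 1 / 4 * ‖mean (run D E p x0 y0 z0 q t).U‖ ^ 2) ≤ D.F x0
      + p.η * p.β₁ * ∑ t ∈ range T, (‖mean ((run D E p x0 y0 z0 q t).errU D)‖ ^ 2
        + L ^ 2 * (dev (run D E p x0 y0 z0 q t).X + dev (run D E p x0 y0 z0 q t).Y
          + (run D E p x0 y0 z0 q t).gapY D + (run D E p x0 y0 z0 q t).gapZ D)) := by
    induction T with
    | zero =>
      have : mean (run D E p x0 y0 z0 q 0).X = x0 := mean_const hK x0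
      simp [this]
    | succ T ih =>
      rw [sum_range_succ, sum_range_succ, mul_add, mul_add]
      have e1 := F_stepState_le hm.land hE hp hη (hinv T) (p.batch (T + 1)) (q (T + 1)) hβ
      have e2 := mul_le_mul_of_nonneg_left (norm_hyperGrad_sub_sq_le hm.land hK (hinv T)) hc.le
      change D.F (mean (stepState D E p (p.batch (T + 1)) (q (T + 1))
        (run D E p x0 y0 z0 q T)).X) + _ ≤ _
      linarith
  have h2 := hΔ (mean (run D E p x0 y0 z0 q T).X)
  refine le_of_mul_le_mul_left ?_ hc
  rw [mul_add (p.η * p.β₁) (Δ / _), mul_div_cancel₀ _ hc.ne']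
  linarith

include hm hs hp hE hK hη hz in
/-- The descent inequality in expectation. -/
lemma integral_descent (hβ : 4 * L * p.β₁ ≤ 1) {Δ : ℝ} (hΔ : ∀ x, D.F x0 - D.F x ≤ Δ) (T : ℕ)
    {m : ℕ → Moments} (hM : ∀ t, m t = moments Pr D
      (fun ω => run D E p x0 y0 z0 (fun t k b => s t k b ω) t)) :
    ∑ t ∈ range T, (1 / 2 * ∫ ω, ‖D.hyperGrad (mean
        (run D E p x0 y0 z0 (fun t k b => s t k b ω) t).X)‖ ^ 2 ∂Pr + 1 / 4 * (m t).u)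
      ≤ Δ / (p.η * p.β₁) + ∑ t ∈ range T, ((m t).nF
        + L ^ 2 * ((m t).kx + (m t).ky + (m t).gy + (m t).gz)) := by
  have hS := fun t => stateReg_run hm hs hp hE hη (x0 := x0) (y0 := y0) hz t
  have i1 := fun t => integrable_hyperGrad_sq hm hK (hS t)
  have i2 := fun t => (hS t).integrable_u
  have i3 := fun t => integrable_norm_mean_sq (hS t).U.memE
  have i4 := fun t => integrable_dev (hS t).memX
  have i5 := fun t => integrable_dev (hS t).memY
  have i6 := fun t => (hS t).integrable_gapY hm
  have i7 := fun t => (hS t).integrable_gapZ hm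
  have j1 := fun t => ((i1 t).const_mul (1 / 2)).add ((i2 t).const_mul (1 / 4))
  have j3 := fun t => (((i4 t).add (i5 t)).add (i6 t)).add (i7 t)
  have j2 := fun t => (i3 t).add ((j3 t).const_mul (L ^ 2))
  have k2 := integrable_finsetSum (range T) fun t _ => j2 t
  have h1 := integral_mono (integrable_finsetSum (range T) fun t _ => j1 t)
    ((integrable_const (Δ / (p.η * p.β₁))).add k2)
    (fun ω => by
      simp only [Pi.add_apply]
      exact descent_run hm hp hE hK hη hz hβ (fun t k b => s t k b ω) hΔ T)
  rw [integral_finsetSum _ fun t _ => j1 t, integral_add' (integrable_const _) k2,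
    integral_finsetSum _ fun t _ => j2 t] at h1
  simp only [integral_const, probReal_univ, one_smul] at h1
  refine le_trans (le_of_eq ?_) (h1.trans (le_of_eq ?_))
  · refine sum_congr rfl fun t _ => ?_
    rw [integral_add' ((i1 t).const_mul _) ((i2 t).const_mul _), integral_const_mul,
      integral_const_mul, hM]
    rfl
  · congr 1
    refine sum_congr rfl fun t _ => ?_
    rw [integral_add' (i3 t) ((j3 t).const_mul _), integral_const_mul,
      integral_add' (((i4 t).add (i5 t)).add (i6 t)) (i7 t),
      integral_add' ((i4 t).add (i5 t)) (i6 t), integral_add' (i4 t) (i5 t), hM]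
    rfl

/-- The moments of the initial state, when the inner gaps and the mean oracles at the initial
point are bounded by `a`. -/
structure Moments.Start (m : Moments) (v a : ℝ) (K B : ℕ) : Prop where
  kx : m.kx = 0
  ky : m.ky = 0
  kz : m.kz = 0
  gy : m.gy ≤ a
  gz : m.gz ≤ a
  nF : m.nF ≤ 2 * v ^ 2 / (K * B)
  nG : m.nG ≤ 2 * v ^ 2 / (K * B)
  nH : m.nH ≤ 2 * v ^ 2 / (K * B)
  eF : m.eF ≤ 2 * v ^ 2
  eG : m.eG ≤ 2 * v ^ 2
  eH : m.eH ≤ 2 * v ^ 2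
  pP : m.pP ≤ 4 * v ^ 2 + 2 * a
  pQ : m.pQ ≤ 4 * v ^ 2 + 2 * a
  pR : m.pR ≤ 4 * v ^ 2 + 2 * a

include hm hs hp hK hz in
lemma moments_start {a : ℝ} (hy : ‖y0 - D.yStar x0‖ ^ 2 ≤ a) (hzz : ‖z0 - D.zStar x0‖ ^ 2 ≤ a)
    (hF : msq (fun k => D.meanF k (x0, y0, z0)) ≤ a)
    (hG : msq (fun k => D.meanG k (x0, y0, z0)) ≤ a)
    (hH : msq (fun k => D.meanH k (x0, y0, z0)) ≤ a) :
    (moments Pr D (fun ω => run D E p x0 y0 z0 (fun t k b => s t k b ω) 0)).Start v a K p.B0 := by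
  have f1 := integral_init_err_le hm.F hm.well hs hp.B0_pos (w0 := (x0, y0, z0)) hz hK
  have g1 := integral_init_err_le hm.G hm.well hs hp.B0_pos (w0 := (x0, y0, z0)) hz hK
  have h1 := integral_init_err_le hm.H hm.well hs hp.B0_pos (w0 := (x0, y0, z0)) hz hK
  have f2 := integral_init_tracker_le hm.F hm.well hs hp.B0_pos (w0 := (x0, y0, z0)) hz hK
  have g2 := integral_init_tracker_le hm.G hm.well hs hp.B0_pos (w0 := (x0, y0, z0)) hz hK
  have h2 := integral_init_tracker_le hm.H hm.well hs hp.B0_pos (w0 := (x0, y0, z0)) hz hK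
  refine ⟨?_, ?_, ?_, ?_, ?_, f1.2, g1.2, h1.2, f1.1, g1.1, h1.1, ?_, ?_, ?_⟩
  · change ∫ ω, dev (fun _ : Fin K => x0) ∂Pr = 0
    simp [dev_const hK]
  · change ∫ ω, dev (fun _ : Fin K => y0) ∂Pr = 0
    simp [dev_const hK]
  · change ∫ ω, dev (fun _ : Fin K => z0) ∂Pr = 0
    simp [dev_const hK]
  · change ∫ ω, ‖mean (fun _ : Fin K => y0) - D.yStar (mean (fun _ : Fin K => x0))‖ ^ 2 ∂Pr ≤ a
    simpa [mean_const hK] using hy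
  · change ∫ ω, msq (fun _ : Fin K => z0 - D.zStar (mean (fun _ : Fin K => x0))) ∂Pr ≤ a
    simpa [mean_const hK, msq_const hK] using hzz
  · exact f2.trans (by linarith)
  · exact g2.trans (by linarith)
  · exact h2.trans (by linarith)

end Descent

/-! ### Summation of the recursions and the small-gain argument -/

/-- Summing a contraction with disturbance `b` over the first `T` iterations. -/
lemma sum_le_of_contraction {θ : ℝ} {s b : ℕ → ℝ} (hs : ∀ t, 0 ≤ s t)
    (h : ∀ t, s (t + 1) ≤ (1 - θ) * s t + b t) (T : ℕ) :
    θ * ∑ t ∈ range T, s t ≤ s 0 + ∑ t ∈ range T, b t := by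
  have h1 : θ * ∑ t ∈ range T, s t + s T ≤ s 0 + ∑ t ∈ range T, b t := by
    induction T with
    | zero => simp
    | succ T ih => rw [sum_range_succ, sum_range_succ, mul_add]; linarith [h T]
  linarith [hs T]

/-- The small-gain argument for the summed moments: `H` is the sum of the squared hypergradients,
`U` of the squared search directions, `N` of the errors of the average estimators, `k` of the
consensus errors, `Gy` and `Gz` of the inner gaps, `Q` of the scaled tracker deviations, `D` of the
scaled displacements. All loops gain a factor of order `c² L¹⁰` and are closed by the choice
of `c`. -/
lemma small_gain {L c H U N k Gy Gz Q D I n G : ℝ} (hL : 1 ≤ L) (hc : c = 1 / (2000 * L ^ 10))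
    (hU : 0 ≤ U) (hN : 0 ≤ N) (hk : 0 ≤ k) (hQ : 0 ≤ Q)
    (hD : 0 ≤ D) (hI : 0 ≤ I) (hn : 0 ≤ n) (hG : 0 ≤ G)
    (h1 : k ≤ 2 * c ^ 2 * Q) (h2 : Q ≤ G + 162 * L ^ 2 * D) (h3 : N ≤ n + 24 * L ^ 2 * D)
    (h4 : D ≤ 18 * c ^ 2 * Q + 2 * c ^ 2 * U + 4 * c ^ 2 * N + 8 * c ^ 2 * L ^ 2 * (k + Gy + Gz))
    (h5 : Gy ≤ I + 24 * L ^ 2 * N + 24 * L ^ 4 * k + 6 * L ^ 4 * c ^ 2 * U)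
    (h6 : Gz ≤ I + 24 * L ^ 2 * N + 24 * L ^ 4 * k + 24 * L ^ 4 * Gy + 6 * L * c * Q
      + 6 * L ^ 4 * c ^ 2 * U)
    (h7 : 1 / 2 * H + 1 / 4 * U ≤ I + N + L ^ 2 * (k + Gy + Gz)) :
    H ≤ 1400 * L ^ 8 * (I + n + G) := by
  have hL0 : 0 < L := by linarith
  have hc0 : 0 < c := by rw [hc]; positivity
  have hcL : c * L ^ 10 = 1 / 2000 := by rw [hc]; field_simp
  have pw : ∀ (i j : ℕ) {x : ℝ}, i ≤ j → 0 ≤ x → L ^ i * x ≤ L ^ j * x := fun i j x hij hx =>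
    mul_le_mul_of_nonneg_right (pow_le_pow_right₀ hL hij) hx
  have pw0 : ∀ (j : ℕ) {x : ℝ}, 0 ≤ x → x ≤ L ^ j * x := fun j x hx =>
    le_mul_of_one_le_left hx (one_le_pow₀ hL)
  have cw : ∀ (j : ℕ) {x : ℝ}, j ≤ 10 → 0 ≤ x → c * L ^ j * x ≤ 1 / 2000 * x := fun j x hj hx =>
    mul_le_mul_of_nonneg_right (by
      rw [← hcL]; exact mul_le_mul_of_nonneg_left (pow_le_pow_right₀ hL hj) hc0.le) hx
  have hc1 : c ≤ 1 / 2000 := by simpa using cw 0 (x := 1) (by norm_num) zero_le_one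
  have cc : ∀ (j : ℕ) {x : ℝ}, j ≤ 10 → 0 ≤ x → c ^ 2 * L ^ j * x ≤ 1 / 4000000 * x := by
    intro j x hj hx
    have a1 := cw j hj (mul_nonneg hc0.le hx)
    have a2 := mul_le_mul_of_nonneg_right hc1 hx
    nlinarith
  -- the inner gaps
  have e1 : Gy + Gz ≤ 26 * (L ^ 4 * I) + 624 * (L ^ 6 * N) + 624 * (L ^ 8 * k) + 6 * (c * L * Q)
      + 156 * (c ^ 2 * L ^ 8 * U) := by
    have a1 := mul_le_mul_of_nonneg_left h5 (by positivity : 0 ≤ 24 * L ^ 4)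
    have hcU : 0 ≤ c ^ 2 * U := by positivity
    linarith [pw0 4 hI, pw 2 6 (by norm_num) hN, pw 4 8 (by norm_num) hk, pw 4 8 (by norm_num) hcU]
  have e2 : Gy + Gz ≤ 26 * (L ^ 4 * I) + 624 * (L ^ 6 * N) + 7 * (c * L * Q)
      + 156 * (c ^ 2 * L ^ 8 * U) := by
    have a1 := mul_le_mul_of_nonneg_left h1 (by positivity : 0 ≤ L ^ 8)
    have a2 := cw 8 (by norm_num) (mul_nonneg hc0.le hQ)
    have a3 := pw0 1 (mul_nonneg hc0.le hQ)
    have hcQ := mul_nonneg hc0.le hQ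
    linarith
  -- the descent inequality
  have e3 : 1 / 2 * H + 1 / 8 * U ≤ 27 * (L ^ 6 * I) + 625 * (L ^ 8 * N) + Q := by
    have a1 := mul_le_mul_of_nonneg_left e2 (by positivity : 0 ≤ L ^ 2)
    have a2 := mul_le_mul_of_nonneg_left h1 (by positivity : 0 ≤ L ^ 2)
    linarith [pw0 6 hI, pw0 8 hN, cc 2 (by norm_num) hQ, cw 3 (by norm_num) hQ,
      cc 10 (by norm_num) hU]
  -- the displacements
  have e4 : D ≤ 20 * (c ^ 2 * Q) + 3 * (c ^ 2 * U) + 208 * (c ^ 2 * L ^ 6 * I)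
      + 4996 * (c ^ 2 * L ^ 8 * N) := by
    have a1 := mul_le_mul_of_nonneg_left e2 (by positivity : 0 ≤ 8 * c ^ 2 * L ^ 2)
    have a2 := mul_le_mul_of_nonneg_left h1 (by positivity : 0 ≤ 8 * c ^ 2 * L ^ 2)
    have hcQ : 0 ≤ c ^ 2 * Q := by positivity
    have hcU : 0 ≤ c ^ 2 * U := by positivity
    have hcN : 0 ≤ c ^ 2 * N := by positivity
    linarith [cc 2 (by norm_num) hcQ, cw 3 (by norm_num) hcQ, cc 10 (by norm_num) hcU, pw0 8 hcN]
  have e5 : D ≤ 40 * (c ^ 2 * G) + 6 * (c ^ 2 * U) + 416 * (c ^ 2 * L ^ 6 * I)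
      + 9992 * (c ^ 2 * L ^ 8 * n) := by
    have a1 := mul_le_mul_of_nonneg_left h2 (by positivity : 0 ≤ 20 * c ^ 2)
    have a2 := mul_le_mul_of_nonneg_left h3 (by positivity : 0 ≤ 4996 * (c ^ 2 * L ^ 8))
    linarith [cc 2 (by norm_num) hD, cc 10 (by norm_num) hD]
  have a1 := mul_le_mul_of_nonneg_left h3 (by positivity : 0 ≤ 625 * L ^ 8)
  have a2 := mul_le_mul_of_nonneg_left e5 (by positivity : 0 ≤ 15162 * L ^ 10)
  have hLI : 0 ≤ L ^ 6 * I := by positivity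
  have hLn : 0 ≤ L ^ 8 * n := by positivity
  linarith [cc 10 (by norm_num) hG, cc 10 (by norm_num) hU, cc 10 (by norm_num) hLI,
    cc 10 (by norm_num) hLn, pw 2 10 (by norm_num) hD, pw 6 8 (by norm_num) hI, pw0 8 hG]

/-- The summed recursion of a tracker. -/
lemma tracker_sum_le {a ρ L v T e0 p0 M E P : ℝ} (ha0 : 0 < a) (ha1 : a ≤ 1) (hρ0 : 0 < ρ)
    (hρ1 : ρ ≤ 1) (hT : 0 ≤ T) (hM : 0 ≤ M) (hp0 : 0 ≤ p0) (he0 : e0 ≤ 2 * v ^ 2)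
    (hE : a * E ≤ e0 + (8 * L ^ 2 * M + 2 * a ^ 2 * v ^ 2 * T))
    (hP : ρ * P ≤ p0 + 2 / ρ * (3 * a ^ 2 * E + 3 * a ^ 2 * v ^ 2 * T + 3 * L ^ 2 * M)) :
    ρ ^ 2 * P ≤ p0 + 12 * v ^ 2 + 18 * (a ^ 2 * v ^ 2 * T) + 54 * (L ^ 2 * M) := by
  have h1 := mul_le_mul_of_nonneg_left hP hρ0.le
  have h2 : ρ * (p0 + 2 / ρ * (3 * a ^ 2 * E + 3 * a ^ 2 * v ^ 2 * T + 3 * L ^ 2 * M))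
      = ρ * p0 + 2 * (3 * a ^ 2 * E + 3 * a ^ 2 * v ^ 2 * T + 3 * L ^ 2 * M) := by
    field_simp
  have h3 := mul_le_mul_of_nonneg_left hE (by positivity : 0 ≤ 6 * a)
  have h4 : ρ * p0 ≤ p0 := by nlinarith
  have h5 : a * e0 ≤ 2 * v ^ 2 := by nlinarith [sq_nonneg v]
  have hX : 0 ≤ L ^ 2 * M := by positivity
  have hY : 0 ≤ a ^ 2 * v ^ 2 * T := by positivity
  have h6 := mul_le_mul_of_nonneg_right ha1 hX
  have h7 := mul_le_mul_of_nonneg_right ha1 hY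
  rw [h2] at h1
  linarith

/-- The summed recursion of the error of an average estimator, with displacements scaled by
`η² m²`. -/
lemma error_sum_le {α η m κ L v T n0 M N : ℝ} (hα : 0 < α) (hη : 0 < η) (hm : 0 < m) (hκ : 0 < κ)
    (hmα : m ^ 2 ≤ κ * α) (hM : 0 ≤ M)
    (hN : α * η ^ 2 * N ≤ n0 + 1 / κ * (8 * L ^ 2 * M + 2 * (α * η ^ 2) ^ 2 * v ^ 2 * T)) :
    N ≤ n0 / (α * η ^ 2) + 2 * v ^ 2 * T * (α * η ^ 2 / κ) + 8 * L ^ 2 * (M / (η ^ 2 * m ^ 2)) := by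
  have ha : 0 < α * η ^ 2 := by positivity
  have h1 : M / (κ * (α * η ^ 2)) ≤ M / (η ^ 2 * m ^ 2) := by
    refine div_le_div_of_nonneg_left hM (by positivity) ?_
    nlinarith [mul_le_mul_of_nonneg_left hmα (sq_nonneg η)]
  have h2 : N ≤ (n0 + 1 / κ * (8 * L ^ 2 * M + 2 * (α * η ^ 2) ^ 2 * v ^ 2 * T))
      / (α * η ^ 2) := by
    rw [le_div_iff₀ ha]; linarith
  have h3 : (n0 + 1 / κ * (8 * L ^ 2 * M + 2 * (α * η ^ 2) ^ 2 * v ^ 2 * T)) / (α * η ^ 2)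
      = n0 / (α * η ^ 2) + 2 * v ^ 2 * T * (α * η ^ 2 / κ)
        + 8 * L ^ 2 * (M / (κ * (α * η ^ 2))) := by
    field_simp
    ring
  rw [h3] at h2
  have h4 := mul_le_mul_of_nonneg_left h1 (by positivity : 0 ≤ 8 * L ^ 2)
  linarith

/-- The summed recursion of a consensus error. -/
lemma consensus_sum_le {η ρ β c m κ P : ℝ} (hη : 0 < η) (hρ : 0 < ρ) (hP : 0 ≤ P)
    (hβ : β ^ 2 ≤ c ^ 2 * ρ ^ 4 * m ^ 2) (h : η * ρ * κ ≤ 2 * η / ρ * β ^ 2 * P) :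
    κ ≤ 2 * c ^ 2 * m ^ 2 * (ρ ^ 2 * P) := by
  have h1 : κ ≤ 2 * β ^ 2 * P / ρ ^ 2 := by
    rw [le_div_iff₀ (by positivity)]
    have h2 := mul_le_mul_of_nonneg_left h (by positivity : 0 ≤ ρ / η)
    have h3 : ρ / η * (η * ρ * κ) = κ * ρ ^ 2 := by field_simp
    have h4 : ρ / η * (2 * η / ρ * β ^ 2 * P) = 2 * β ^ 2 * P := by field_simp
    linarith
  refine h1.trans ?_
  rw [div_le_iff₀ (by positivity)]
  nlinarith [mul_le_mul_of_nonneg_right hβ hP]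

/-- Bounds on the step sizes in terms of `m = min 1 √(K α_min)`. -/
lemma StepSizes.exists_scale {c : ℝ} {K : ℕ} {lam : ℝ} {p : Params} (h : StepSizes c K lam p)
    (hp : p.Valid) (hK : 1 ≤ K) (hc0 : 0 < c) (hc1 : c ≤ 1) (hl0 : 0 ≤ lam) (hl1 : lam < 1) :
    ∃ m : ℝ, 0 < m ∧ m ≤ 1 ∧ m ^ 2 ≤ K * p.α₁ ∧ m ^ 2 ≤ K * p.α₂ ∧ m ^ 2 ≤ K * p.α₃ ∧
      p.β₁ ^ 2 ≤ c ^ 2 * (1 - lam) ^ 4 * m ^ 2 ∧ p.β₂ ^ 2 ≤ c ^ 2 * (1 - lam) ^ 4 * m ^ 2 ∧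
      p.β₃ ^ 2 ≤ c ^ 2 * (1 - lam) ^ 4 * m ^ 2 ∧ p.β₁ ≤ c ∧ p.β₂ ≤ c ∧
      p.β₃ ≤ c * (1 - lam) ^ 3 := by
  have hK0 : (0 : ℝ) < K := by positivity
  have h1 := hp.α₁_pos
  have h2 := hp.α₂_pos
  have h3 := hp.α₃_pos
  have hα : 0 < min p.α₁ (min p.α₂ p.α₃) := lt_min h1 (lt_min h2 h3)
  obtain ⟨q2, q3, q1⟩ := (⟨h.β₂_le, h.β₃_le, h.β₁_le_β₂⟩ : _ ∧ _ ∧ _)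
  set m := min 1 (√(K * min p.α₁ (min p.α₂ p.α₃))) with hm
  have hm0 : 0 < m := lt_min one_pos (Real.sqrt_pos.2 (mul_pos hK0 hα))
  have hm1 : m ≤ 1 := min_le_left _ _
  have hms : m ^ 2 ≤ K * min p.α₁ (min p.α₂ p.α₃) := by
    have := pow_le_pow_left₀ hm0.le (min_le_right 1 (√(K * min p.α₁ (min p.α₂ p.α₃)))) 2
    rwa [Real.sq_sqrt (mul_pos hK0 hα).le] at this
  set ρ := 1 - lam with hρ
  have hρ0 : 0 < ρ := by linarith
  have hρ1 : ρ ≤ 1 := by linarith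
  have r2 : ρ ^ 2 ≤ 1 := pow_le_one₀ hρ0.le hρ1
  have r4 : ρ ^ 4 ≤ ρ ^ 2 := pow_le_pow_of_le_one hρ0.le hρ1 (by norm_num)
  have r43 : ρ ^ 4 ≤ ρ ^ 3 := pow_le_pow_of_le_one hρ0.le hρ1 (by norm_num)
  have b3 : p.β₃ ≤ c * ρ ^ 2 * m := q3.trans (by gcongr)
  have b1 : p.β₁ ≤ c * ρ ^ 2 * m := by
    refine (q1.trans ?_).trans q2
    nlinarith [hp.β₂_pos]
  have sq : ∀ {β : ℝ}, 0 < β → β ≤ c * ρ ^ 2 * m → β ^ 2 ≤ c ^ 2 * ρ ^ 4 * m ^ 2 := by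
    intro β hβ hb
    have := pow_le_pow_left₀ hβ.le hb 2
    linarith [show (c * ρ ^ 2 * m) ^ 2 = c ^ 2 * ρ ^ 4 * m ^ 2 by ring]
  have cl : c * ρ ^ 2 * m ≤ c := by
    have : ρ ^ 2 * m ≤ 1 := mul_le_one₀ r2 hm0.le hm1
    nlinarith
  refine ⟨m, hm0, hm1, hms.trans ?_, hms.trans ?_, hms.trans ?_, sq hp.β₁_pos b1,
    sq hp.β₂_pos q2, sq hp.β₃_pos b3, b1.trans cl, q2.trans cl, q3.trans ?_⟩
  · gcongr; exact min_le_left _ _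
  · gcongr; exact (min_le_right _ _).trans (min_le_left _ _)
  · gcongr; exact (min_le_right _ _).trans (min_le_right _ _)
  · calc c * ρ ^ 4 * m ≤ c * ρ ^ 4 * 1 := by gcongr
      _ ≤ c * ρ ^ 3 := by rw [mul_one]; gcongr

/-- The summed recursion of an inner gap `γ`, contracted at the rate `η β / (2 L)` and disturbed by
the drift of its target. -/
lemma gap_sum_le {L η β β₁ c g a X r γ U : ℝ} (hL : 0 < L) (hη : 0 < η) (hβ : 0 < β)
    (hβ₁ : 0 ≤ β₁) (h1 : β₁ ≤ c * β) (hU : 0 ≤ U) (hg : g ≤ a)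
    (h : η * β / L / 2 * γ ≤ g + (12 * L * (η * β) * X + r + 3 * L ^ 3 * (η * β₁ ^ 2 / β) * U)) :
    γ ≤ 2 * L * a / (η * β) + 24 * L ^ 2 * X + 2 * L * (r / (η * β)) + 6 * L ^ 4 * c ^ 2 * U := by
  have h2 := mul_le_mul_of_nonneg_left (h.trans (add_le_add_left hg _))
    (by positivity : 0 ≤ 2 * L / (η * β))
  have e1 : 2 * L / (η * β) * (η * β / L / 2 * γ) = γ := by field_simp
  have e2 : 2 * L / (η * β) * (a + (12 * L * (η * β) * X + r + 3 * L ^ 3 * (η * β₁ ^ 2 / β) * U))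
      = 2 * L * a / (η * β) + 24 * L ^ 2 * X + 2 * L * (r / (η * β))
        + 6 * L ^ 4 * (β₁ ^ 2 / β ^ 2) * U := by
    field_simp
    ring
  have e3 : β₁ ^ 2 / β ^ 2 ≤ c ^ 2 := by
    rw [div_le_iff₀ (by positivity), ← mul_pow]
    exact pow_le_pow_left₀ hβ₁ h1 2
  have e4 := mul_le_mul_of_nonneg_right e3 (by positivity : 0 ≤ 6 * L ^ 4 * U)
  rw [e1, e2] at h2
  linarith

set_option maxHeartbeats 1000000 in
/-- The moment recursions bound the sum of the squared hypergradients. -/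
lemma sum_hyperGrad_le {p : Params} {L v lam c a Δ : ℝ} {K : ℕ} (hL : 1 ≤ L)
    (hc : c = 1 / (2000 * L ^ 10)) (hK : 1 ≤ K) (hp : p.Valid) (hst : StepSizes c K lam p)
    (hl0 : 0 ≤ lam) (hl1 : lam < 1) (ha : 0 ≤ a) (hΔ : 0 ≤ Δ) {m : ℕ → Moments}
    (hnn : ∀ t, (m t).Nonneg) (hstep : ∀ t, (m t).Step p L v lam K (m (t + 1)))
    (h0 : (m 0).Start v a K p.B0) {h : ℕ → ℝ} (T : ℕ)
    (hdes : ∑ t ∈ range T, (1 / 2 * h t + 1 / 4 * (m t).u)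
      ≤ Δ / (p.η * p.β₁) + ∑ t ∈ range T, ((m t).nF
        + L ^ 2 * ((m t).kx + (m t).ky + (m t).gy + (m t).gz))) :
    ∑ t ∈ range T, h t ≤ 1400 * L ^ 8 * ((Δ / (p.η * p.β₁) + 2 * L * a / (p.η * p.β₂)
        + 2 * L * a / (p.η * p.β₃))
      + ((2 * v ^ 2 / (K * p.B0) / (p.α₁ * p.η ^ 2) + 2 * v ^ 2 * T * (p.α₁ * p.η ^ 2 / K))
        + (2 * v ^ 2 / (K * p.B0) / (p.α₂ * p.η ^ 2) + 2 * v ^ 2 * T * (p.α₂ * p.η ^ 2 / K))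
        + (2 * v ^ 2 / (K * p.B0) / (p.α₃ * p.η ^ 2) + 2 * v ^ 2 * T * (p.α₃ * p.η ^ 2 / K)))
      + (3 * (16 * v ^ 2 + 2 * a) + 18 * v ^ 2 * T * ((p.α₁ * p.η ^ 2) ^ 2
        + (p.α₂ * p.η ^ 2) ^ 2 + (p.α₃ * p.η ^ 2) ^ 2))) := by
  have hL0 : 0 < L := by linarith
  have hc0 : 0 < c := by rw [hc]; positivity
  have hc1 : c ≤ 1 := by
    rw [hc, div_le_one (by positivity)]
    linarith [one_le_pow₀ hL (n := 10)]
  have hη := hp.η_pos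
  have hη1 := hst.η_le
  have hK0 : (0 : ℝ) < K := by positivity
  obtain ⟨q, hq0, hq1, m1, m2, m3, b1, b2, b3, -, -, b6⟩ :=
    hst.exists_scale hp hK hc0 hc1 hl0 hl1
  have hα1 := hp.α₁_pos
  have hα2 := hp.α₂_pos
  have hα3 := hp.α₃_pos
  have hβ1 := hp.β₁_pos
  have hβ2 := hp.β₂_pos
  have hβ3 := hp.β₃_pos
  have hB0 : (0 : ℝ) < p.B0 := by exact_mod_cast hp.B0_pos
  -- sums over the iterations
  set ρ := 1 - lam with hρ
  have hρ0 : 0 < ρ := by linarith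
  have hρ1 : ρ ≤ 1 := by linarith
  have hlam : lam = 1 - ρ := by linarith
  set Kx := ∑ t ∈ range T, (m t).kx with hKx
  set Ky := ∑ t ∈ range T, (m t).ky with hKy
  set Kz := ∑ t ∈ range T, (m t).kz with hKz
  set Gy := ∑ t ∈ range T, (m t).gy with hGy
  set Gz := ∑ t ∈ range T, (m t).gz with hGz
  set NF := ∑ t ∈ range T, (m t).nF with hNF
  set NG := ∑ t ∈ range T, (m t).nG with hNG
  set NH := ∑ t ∈ range T, (m t).nH with hNH
  set EF := ∑ t ∈ range T, (m t).eF with hEF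
  set EG := ∑ t ∈ range T, (m t).eG with hEG
  set EH := ∑ t ∈ range T, (m t).eH with hEH
  set PP := ∑ t ∈ range T, (m t).pP with hPP
  set PQ := ∑ t ∈ range T, (m t).pQ with hPQ
  set PR := ∑ t ∈ range T, (m t).pR with hPR
  set U := ∑ t ∈ range T, (m t).u with hU
  set M := ∑ t ∈ range T, (m t).move p L with hM
  have hMe : M = p.η ^ 2 * (8 * (Kx + Ky + Kz) + 2 * p.β₁ ^ 2 * (U + PP)
      + 2 * p.β₂ ^ 2 * (2 * NG + 2 * L ^ 2 * (Kx + Ky + Gy) + PQ)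
      + 2 * p.β₃ ^ 2 * (2 * NH + 2 * L ^ 2 * (Kx + Ky + Gy + Gz) + PR)) := by
    simp only [hM, Moments.move, ← mul_sum, sum_add_distrib]
    rfl
  have kx0 : 0 ≤ Kx := sum_nonneg fun t _ => (hnn t).kx
  have ky0 : 0 ≤ Ky := sum_nonneg fun t _ => (hnn t).ky
  have kz0 : 0 ≤ Kz := sum_nonneg fun t _ => (hnn t).kz
  have gy0 : 0 ≤ Gy := sum_nonneg fun t _ => (hnn t).gy
  have gz0 : 0 ≤ Gz := sum_nonneg fun t _ => (hnn t).gz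
  have nF0 : 0 ≤ NF := sum_nonneg fun t _ => (hnn t).nF
  have nG0 : 0 ≤ NG := sum_nonneg fun t _ => (hnn t).nG
  have nH0 : 0 ≤ NH := sum_nonneg fun t _ => (hnn t).nH
  have pP0 : 0 ≤ PP := sum_nonneg fun t _ => (hnn t).pP
  have pQ0 : 0 ≤ PQ := sum_nonneg fun t _ => (hnn t).pQ
  have pR0 : 0 ≤ PR := sum_nonneg fun t _ => (hnn t).pR
  have u0 : 0 ≤ U := sum_nonneg fun t _ => (hnn t).u
  have M0 : 0 ≤ M := by rw [hMe]; positivity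
  have sx := sum_le_of_contraction (fun t => (hnn t).kx) (fun t => (hstep t).kx) T
  have sy := sum_le_of_contraction (fun t => (hnn t).ky) (fun t => (hstep t).ky) T
  have sz := sum_le_of_contraction (fun t => (hnn t).kz) (fun t => (hstep t).kz) T
  have sgy := sum_le_of_contraction (fun t => (hnn t).gy)
    (fun t => (hstep t).gy.trans (le_of_eq (add_assoc _ _ _))) T
  have sgz := sum_le_of_contraction (fun t => (hnn t).gz)
    (fun t => (hstep t).gz.trans (le_of_eq (by rw [add_assoc, add_assoc]))) T
  have sF := sum_le_of_contraction (fun t => (hnn t).nF) (fun t => (hstep t).nF) T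
  have sG := sum_le_of_contraction (fun t => (hnn t).nG) (fun t => (hstep t).nG) T
  have sH := sum_le_of_contraction (fun t => (hnn t).nH) (fun t => (hstep t).nH) T
  have tF := sum_le_of_contraction (fun t => (hnn t).eF) (fun t => (hstep t).eF) T
  have tG := sum_le_of_contraction (fun t => (hnn t).eG) (fun t => (hstep t).eG) T
  have tH := sum_le_of_contraction (fun t => (hnn t).eH) (fun t => (hstep t).eH) T
  have rP := sum_le_of_contraction (θ := ρ) (fun t => (hnn t).pP)
    (fun t => (hstep t).pP.trans (le_of_eq (by rw [sub_sub_cancel]))) T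
  have rQ := sum_le_of_contraction (θ := ρ) (fun t => (hnn t).pQ)
    (fun t => (hstep t).pQ.trans (le_of_eq (by rw [sub_sub_cancel]))) T
  have rR := sum_le_of_contraction (θ := ρ) (fun t => (hnn t).pR)
    (fun t => (hstep t).pR.trans (le_of_eq (by rw [sub_sub_cancel]))) T
  simp only [sum_add_distrib, ← mul_sum, sum_const, card_range, nsmul_eq_mul]
    at sx sy sz sgy sgz sF sG sH tF tG tH rP rQ rR hdes
  simp only [← hKx, ← hKy, ← hKz, ← hGy, ← hGz, ← hNF, ← hNG, ← hNH, ← hEF, ← hEG, ← hEH, ← hPP,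
    ← hPQ, ← hPR, ← hU, ← hM] at sx sy sz sgy sgz sF sG sH tF tG tH rP rQ rR hdes
  -- consensus errors
  have c1 := consensus_sum_le hη hρ0 pP0 b1 (κ := Kx) (sx.trans_eq (by rw [h0.kx, zero_add]))
  have c2 := consensus_sum_le hη hρ0 pQ0 b2 (κ := Ky) (sy.trans_eq (by rw [h0.ky, zero_add]))
  have c3 := consensus_sum_le hη hρ0 pR0 b3 (κ := Kz) (sz.trans_eq (by rw [h0.kz, zero_add]))
  -- errors of the average estimators
  have n1 := error_sum_le (L := L) (v := v) (T := T) (n0 := (m 0).nF) (N := NF) hα1 hη hq0 hK0 m1 M0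
    (by linarith only [sF])
  have n2 := error_sum_le (L := L) (v := v) (T := T) (n0 := (m 0).nG) (N := NG) hα2 hη hq0 hK0 m2 M0
    (by linarith only [sG])
  have n3 := error_sum_le (L := L) (v := v) (T := T) (n0 := (m 0).nH) (N := NH) hα3 hη hq0 hK0 m3 M0
    (by linarith only [sH])
  have n1' := div_le_div_of_nonneg_right h0.nF (by positivity : 0 ≤ p.α₁ * p.η ^ 2)
  have n2' := div_le_div_of_nonneg_right h0.nG (by positivity : 0 ≤ p.α₂ * p.η ^ 2)
  have n3' := div_le_div_of_nonneg_right h0.nH (by positivity : 0 ≤ p.α₃ * p.η ^ 2)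
  -- deviations of the trackers
  have hT0 : (0 : ℝ) ≤ T := Nat.cast_nonneg T
  have t1 := tracker_sum_le (v := v) (T := T) (a := p.α₁ * p.η ^ 2) (L := L) (by positivity)
    hp.α₁_lt.le hρ0 hρ1 hT0 M0 (hnn 0).pP h0.eF (E := EF) (P := PP) (by linarith only [tF])
    (rP.trans (le_of_eq (by ring)))
  have t2 := tracker_sum_le (v := v) (T := T) (a := p.α₂ * p.η ^ 2) (L := L) (by positivity)
    hp.α₂_lt.le hρ0 hρ1 hT0 M0 (hnn 0).pQ h0.eG (E := EG) (P := PQ) (by linarith only [tG])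
    (rQ.trans (le_of_eq (by ring)))
  have t3 := tracker_sum_le (v := v) (T := T) (a := p.α₃ * p.η ^ 2) (L := L) (by positivity)
    hp.α₃_lt.le hρ0 hρ1 hT0 M0 (hnn 0).pR h0.eH (E := EH) (P := PR) (by linarith only [tH])
    (rR.trans (le_of_eq (by ring)))
  -- inner gaps
  have g1 := gap_sum_le (X := NG + L ^ 2 * (Kx + Ky)) (r := 0) (γ := Gy) hL0 hη hβ2 hβ1.le
    hst.β₁_le_β₂ u0 h0.gy (sgy.trans (le_of_eq (by ring)))
  rw [zero_div, mul_zero, add_zero] at g1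
  have g2 := gap_sum_le (X := NH + L ^ 2 * (Kx + Ky + Gy)) (r := 3 * p.η * p.β₃ ^ 2 / ρ * PR)
    (γ := Gz) hL0 hη hβ3 hβ1.le hst.β₁_le_β₃ u0 h0.gz (sgz.trans (le_of_eq (by ring)))
  have g3 : 3 * p.η * p.β₃ ^ 2 / ρ * PR / (p.η * p.β₃) ≤ 3 * c * (ρ ^ 2 * PR) := by
    have e1 : 3 * p.η * p.β₃ ^ 2 / ρ * PR / (p.η * p.β₃) = 3 * (p.β₃ / ρ) * PR := by field_simp
    have e2 : p.β₃ / ρ ≤ c * ρ ^ 2 := by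
      rw [div_le_iff₀ hρ0]; linarith only [b6]
    have e3 := mul_le_mul_of_nonneg_right e2 pR0
    rw [e1]; linarith only [e3]
  set A := ρ ^ 2 * PP
  set B := ρ ^ 2 * PQ
  set R := ρ ^ 2 * PR
  have hA0 : 0 ≤ A := by positivity
  have hB0' : 0 ≤ B := by positivity
  have hR0 : 0 ≤ R := by positivity
  set W := M / (p.η ^ 2 * q ^ 2) with hW
  have hW0 : 0 ≤ W := by positivity
  have hMW : M = W * (p.η ^ 2 * q ^ 2) := by rw [hW]; field_simp
  have hMW' : M ≤ W := by
    rw [hMW]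
    refine mul_le_of_le_one_right hW0 (mul_le_one₀ (pow_le_one₀ hη.le hη1) (sq_nonneg q)
      (pow_le_one₀ hq0.le hq1))
  have hq2 : q ^ 2 ≤ 1 := pow_le_one₀ hq0.le hq1
  have bb : ∀ {β X : ℝ}, β ^ 2 ≤ c ^ 2 * ρ ^ 4 * q ^ 2 → 0 ≤ X →
      β ^ 2 * X ≤ c ^ 2 * q ^ 2 * (ρ ^ 2 * X) ∧ β ^ 2 * X ≤ c ^ 2 * q ^ 2 * X := by
    intro β X hb hX
    have e1 := mul_le_mul_of_nonneg_right hb hX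
    have r2 : ρ ^ 2 ≤ 1 := pow_le_one₀ hρ0.le hρ1
    have e2 : c ^ 2 * ρ ^ 4 * q ^ 2 * X = c ^ 2 * q ^ 2 * (ρ ^ 2 * X) * ρ ^ 2 := by ring
    have e3 : c ^ 2 * q ^ 2 * (ρ ^ 2 * X) * ρ ^ 2 ≤ c ^ 2 * q ^ 2 * (ρ ^ 2 * X) :=
      mul_le_of_le_one_right (by positivity) r2
    have e4 : c ^ 2 * q ^ 2 * (ρ ^ 2 * X) ≤ c ^ 2 * q ^ 2 * X := by
      gcongr
      exact mul_le_of_le_one_left hX r2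
    exact ⟨by linarith only [e1, e2, e3], by linarith only [e1, e2, e3, e4]⟩
  have hcq : ∀ {X : ℝ}, 0 ≤ X → c ^ 2 * q ^ 2 * X ≤ c ^ 2 * X := fun {X} hX => by
    rw [mul_right_comm]; exact mul_le_of_le_one_right (by positivity) hq2
  have hI : 0 ≤ Δ / (p.η * p.β₁) := by positivity
  have hI2 : 0 ≤ 2 * L * a / (p.η * p.β₂) := by positivity
  have hI3 : 0 ≤ 2 * L * a / (p.η * p.β₃) := by positivity
  refine small_gain (U := U) (N := NF + NG + NH) (k := Kx + Ky + Kz) (Gy := Gy) (Gz := Gz)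
    (Q := A + B + R) (D := W) hL hc u0 (by positivity) (by positivity) (by positivity) hW0
    (by positivity) (by positivity) (by positivity) ?_ ?_ ?_ ?_ ?_ ?_ ?_
  · linarith only [hcq hA0, hcq hB0', hcq hR0, c1, c2, c3]
  · have := mul_le_mul_of_nonneg_left hMW' (sq_nonneg L)
    linarith only [h0.pP, h0.pQ, h0.pR, t1, t2, t3, this]
  · linarith only [n1, n2, n3, n1', n2', n3']
  · have e1 : W * q ^ 2 = 8 * (Kx + Ky + Kz) + 2 * p.β₁ ^ 2 * (U + PP)
        + 2 * p.β₂ ^ 2 * (2 * NG + 2 * L ^ 2 * (Kx + Ky + Gy) + PQ)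
        + 2 * p.β₃ ^ 2 * (2 * NH + 2 * L ^ 2 * (Kx + Ky + Gy + Gz) + PR) := by
      have : p.η ^ 2 * (W * q ^ 2) = M := by rw [hMW]; ring
      exact mul_left_cancel₀ (pow_pos hη 2).ne' (this.trans hMe)
    have s1 := (bb b1 u0).2
    have s2 := (bb b1 pP0).1
    have s3 := (bb b2 pQ0).1
    have s4 := (bb b3 pR0).1
    have s5 := (bb b2 (by positivity : 0 ≤ 2 * NG + 2 * L ^ 2 * (Kx + Ky + Gy))).2
    have s6 := (bb b3 (by positivity : 0 ≤ 2 * NH + 2 * L ^ 2 * (Kx + Ky + Gy + Gz))).2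
    refine le_of_mul_le_mul_right ?_ (pow_pos hq0 2)
    rw [e1]
    have z1 : 0 ≤ c ^ 2 * q ^ 2 * NF := by positivity
    have z2 : 0 ≤ c ^ 2 * q ^ 2 * (L ^ 2 * Kz) := by positivity
    have z3 : 0 ≤ c ^ 2 * q ^ 2 * (L ^ 2 * Gz) := by positivity
    linarith only [s1, s2, s3, s4, s5, s6, z1, z2, z3, c1, c2, c3]
  · have z1 : 0 ≤ L ^ 2 * NF := by positivity
    have z2 : 0 ≤ L ^ 2 * NH := by positivity
    have z3 : 0 ≤ L ^ 4 * Kz := by positivity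
    linarith only [g1, z1, z2, z3, hI, hI3]
  · have z1 : 0 ≤ L ^ 2 * NF := by positivity
    have z2 : 0 ≤ L ^ 2 * NG := by positivity
    have z3 : 0 ≤ L ^ 4 * Kz := by positivity
    have z4 : 0 ≤ L * c * A := by positivity
    have z5 : 0 ≤ L * c * B := by positivity
    have z6 := mul_le_mul_of_nonneg_left g3 (by positivity : 0 ≤ 2 * L)
    linarith only [g2, z1, z2, z3, z4, z5, z6, hI, hI2]
  · have z3 : 0 ≤ L ^ 2 * Kz := by positivity
    linarith only [hdes, z3, hI2, hI3, nG0, nH0]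

/-! ### Constants -/

/-- The constant of the landscape in terms of the constants of the problem. -/
def lipConst (μ lfx lfy cfy lgy lgxy lgyy cgxy : ℝ) : ℝ :=
  1 + 1 / μ + (lfx + lgxy * (cfy / μ) + cgxy) + (lfy + lgyy * (cfy / μ) + lgy) + lgy / μ
    + (lfy + lgyy * (cfy / μ) + lgy) * (1 + lgy / μ) / μ
    + (lfx + lfy + cfy / μ * (lgxy + lgyy)) * (1 + (lgy / μ) ^ 2)

section

variable {K dx dy : ℕ} {Sf Sg : Type*} [MeasurableSpace Sf] [MeasurableSpace Sg]
  {D : Problem K dx dy Sf Sg} {μ lfx lfy cfy lgy lgxy lgyy cgxy σ : ℝ}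

/-- A regular problem has the landscape and the oracles of the analysis, with a constant that
depends only on the constants of the losses. The summands `8 (·)²` of the variance bound the
fluctuation of the Hessian-vector products, which are bounded on the ball `‖z‖ ≤ cfy / μ`. -/
lemma Problem.Regular.model (h : D.Regular μ lfx lfy cfy lgy lgxy lgyy cgxy σ) (hK : 1 ≤ K) {v : ℝ}
    (hv : 2 * σ ^ 2 + 8 * (cgxy * (cfy / μ)) ^ 2 + 8 * (lgy * (cfy / μ)) ^ 2 ≤ v ^ 2) :
    D.Model (lipConst μ lfx lfy cfy lgy lgxy lgyy cgxy) (cfy / μ) v := by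
  have p1 := h.μ_pos
  have p2 := h.lfx_pos
  have p3 := h.lfy_pos
  have p4 := h.cfy_pos
  have p5 := h.lgy_pos
  have p6 := h.lgxy_pos
  have p7 := h.lgyy_pos
  have p8 := h.cgxy_pos
  set L := lipConst μ lfx lfy cfy lgy lgxy lgyy cgxy with hL
  rw [lipConst] at hL
  have q1 : 0 < 1 / μ := by positivity
  have q2 : 0 < lfx + lgxy * (cfy / μ) + cgxy := by positivity
  have q3 : 0 < lfy + lgyy * (cfy / μ) + lgy := by positivity
  have q3' : lgy ≤ lfy + lgyy * (cfy / μ) + lgy := by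
    have : 0 < lgyy * (cfy / μ) := by positivity
    linarith
  have q4 : 0 < lgy / μ := by positivity
  have q5 : 0 < (lfy + lgyy * (cfy / μ) + lgy) * (1 + lgy / μ) / μ := by positivity
  have q6 : 0 < (lfx + lfy + cfy / μ * (lgxy + lgyy)) * (1 + (lgy / μ) ^ 2) := by positivity
  have hL1 : 1 ≤ L := by linarith
  have hμ : 1 / L ≤ μ := by
    rw [div_le_iff₀ (by linarith)]
    have : μ * (1 / μ) ≤ μ * L := mul_le_mul_of_nonneg_left (by linarith) p1.le
    rwa [mul_one_div_cancel p1.ne'] at this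
  have s1 := sq_nonneg (cgxy * (cfy / μ))
  have s2 := sq_nonneg (lgy * (cfy / μ))
  have hF : IsOracle D L (cfy / μ) v D.oracleF D.meanF :=
    h.isOracle_F (by linarith) (by linarith)
  have hG : IsOracle D L (cfy / μ) v D.oracleG D.meanG :=
    h.isOracle_G (by linarith) (by linarith)
  have hH : IsOracle D L (cfy / μ) v D.oracleH D.meanH :=
    h.isOracle_H (by linarith) (by linarith)
  refine ⟨h.well, ⟨hL1, h.radius_nonneg, hF.mean_lip h.well, hG.mean_lip h.well,
    hH.mean_lip h.well, h.norm_zStar_le hK, fun x z => h.mean_meanGradG_yStar hK x,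
    h.mean_meanH_zStar hK, fun x y z => ?_, fun x z => ?_, fun x x' => ?_, fun x x' => ?_,
    fun x x' => ?_⟩, hF, hG, hH⟩
  · have e1 := h.mean_meanGradG_mono hK x (D.yStar x) y
    rw [h.mean_meanGradG_yStar hK x, sub_zero] at e1
    exact (mul_le_mul_of_nonneg_right hμ (sq_nonneg _)).trans e1
  · have e1 := h.mean_meanH_mono hK x (D.yStar x) z (D.zStar x)
    rw [h.mean_meanH_zStar hK x, sub_zero] at e1
    exact (mul_le_mul_of_nonneg_right hμ (sq_nonneg _)).trans e1
  · exact (h.yStar_lip hK x x').trans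
      (mul_le_mul_of_nonneg_right (by linarith) (norm_nonneg _))
  · exact (h.zStar_lip hK x x').trans
      (mul_le_mul_of_nonneg_right (by linarith) (norm_nonneg _))
  · exact (h.F_expansion hK x x').trans
      (mul_le_mul_of_nonneg_right (by linarith) (sq_nonneg _))

/-- Bound for the inner gaps and the mean oracles at the initial point. -/
def startConst (μ cfy lgy cgxy Δ : ℝ) : ℝ :=
  Δ / μ ^ 2 + 4 * (cfy / μ) ^ 2 + 2 * Δ + 2 * (cgxy * (cfy / μ)) ^ 2
    + (lgy * (cfy / μ) + cfy) ^ 2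

/-- The gradient bounds at the initial point control the inner gaps there by strong monotonicity, and
the mean oracles there by the bounds on the Jacobians and Hessians on the ball. -/
lemma Problem.Regular.start_bounds (h : D.Regular μ lfx lfy cfy lgy lgxy lgyy cgxy σ) (hK : 1 ≤ K)
    {x0 : Vec dx} {y0 z0 : Vec dy} (hz : ‖z0‖ ≤ cfy / μ) {Δ : ℝ} (hΔ : 0 ≤ Δ)
    (hf : (1 / (K : ℝ)) * ∑ k, ‖grad1 (D.fFull k) x0 y0‖ ^ 2 ≤ Δ)
    (hg : (1 / (K : ℝ)) * ∑ k, ‖grad2 (D.gFull k) x0 y0‖ ^ 2 ≤ Δ) :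
    ‖y0 - D.yStar x0‖ ^ 2 ≤ startConst μ cfy lgy cgxy Δ ∧
    ‖z0 - D.zStar x0‖ ^ 2 ≤ startConst μ cfy lgy cgxy Δ ∧
    msq (fun k => D.meanF k (x0, y0, z0)) ≤ startConst μ cfy lgy cgxy Δ ∧
    msq (fun k => D.meanG k (x0, y0, z0)) ≤ startConst μ cfy lgy cgxy Δ ∧
    msq (fun k => D.meanH k (x0, y0, z0)) ≤ startConst μ cfy lgy cgxy Δ := by
  have p1 := h.μ_pos
  have p5 := h.lgy_pos
  have p8 := h.cgxy_pos
  have hr := h.radius_nonneg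
  simp only [h.grad1_fFull, h.grad2_gFull] at hf hg
  have hG : msq (fun k => D.meanG k (x0, y0, z0)) ≤ Δ := hg
  have hF1 : msq (fun k => D.meanGrad1 k x0 y0) ≤ Δ := hf
  have t1 : 0 ≤ Δ / μ ^ 2 := by positivity
  have t2 := sq_nonneg (cfy / μ)
  have t3 := sq_nonneg (cgxy * (cfy / μ))
  have t4 := sq_nonneg (lgy * (cfy / μ) + cfy)
  unfold startConst
  refine ⟨?_, ?_, ?_, ?_, ?_⟩
  · have e1 : μ * ‖y0 - D.yStar x0‖ ^ 2
        ≤ ⟪DecBilevel.mean (fun k => D.meanGradG k x0 y0), y0 - D.yStar x0⟫ := by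
      have e1 := h.mean_meanGradG_mono hK x0 (D.yStar x0) y0
      rwa [h.mean_meanGradG_yStar hK x0, sub_zero] at e1
    have e2 := e1.trans (real_inner_le_norm _ _)
    have e3 : ‖DecBilevel.mean (fun k => D.meanGradG k x0 y0)‖ ^ 2 ≤ Δ :=
      (norm_mean_sq_le hK _).trans hG
    have e4 : μ * ‖y0 - D.yStar x0‖ ≤ ‖DecBilevel.mean (fun k => D.meanGradG k x0 y0)‖ := by
      rcases (norm_nonneg (y0 - D.yStar x0)).eq_or_lt with h0 | h0
      · rw [← h0, mul_zero]; exact norm_nonneg _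
      · refine le_of_mul_le_mul_right ?_ h0
        linarith
    have e5 := pow_le_pow_left₀ (by positivity) e4 2
    have e6 : ‖y0 - D.yStar x0‖ ^ 2 ≤ Δ / μ ^ 2 := by
      rw [le_div_iff₀ (by positivity)]
      linarith
    linarith
  · have e1 : ‖z0 - D.zStar x0‖ ≤ 2 * (cfy / μ) :=
      (norm_sub_le _ _).trans (by linarith [h.norm_zStar_le hK x0])
    have e2 := pow_le_pow_left₀ (norm_nonneg _) e1 2
    linarith
  · have e1 := msq_sub_le_two (fun k => D.meanGrad1 k x0 y0) (fun k => D.meanJac k x0 y0 z0)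
    have e2 : msq (fun k => D.meanJac k x0 y0 z0) ≤ (cgxy * (cfy / μ)) ^ 2 :=
      avg_le hK fun k => pow_le_pow_left₀ (norm_nonneg _)
        ((h.norm_meanJac_le k x0 y0 z0).trans (mul_le_mul_of_nonneg_left hz p8.le)) 2
    change msq (fun k => D.meanGrad1 k x0 y0 - D.meanJac k x0 y0 z0) ≤ _
    linarith
  · linarith
  · have e2 : msq (fun k => D.meanH k (x0, y0, z0)) ≤ (lgy * (cfy / μ) + cfy) ^ 2 :=
      avg_le hK fun k => pow_le_pow_left₀ (norm_nonneg _)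
        ((norm_sub_le _ _).trans (add_le_add ((h.norm_meanHess_le k x0 y0 z0).trans
          (mul_le_mul_of_nonneg_left hz p5.le))
          (h.norm_meanGrad2_le k x0 y0))) 2
    linarith

lemma Problem.Landscape.hasGradientAt {L r : ℝ} (h : D.Landscape L r) (x : Vec dx) :
    HasGradientAt D.F (D.hyperGrad x) x :=
  hasGradientAt_of_quadratic fun x' => h.expansion x x'

end

/-- Comparison of the summed bound with the rate. -/
lemma bound_le_rate {p : Params} (hp : p.Valid) (hη1 : p.η ≤ 1) {K T : ℕ} (hK : 1 ≤ K) (hT : 1 ≤ T)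
    {L a v Δ : ℝ} (hL : 0 ≤ L) (ha : 0 ≤ a) (hΔ : 0 ≤ Δ) :
    1 / (T : ℝ) * ((Δ / (p.η * p.β₁) + 2 * L * a / (p.η * p.β₂) + 2 * L * a / (p.η * p.β₃))
      + ((2 * v ^ 2 / (K * p.B0) / (p.α₁ * p.η ^ 2) + 2 * v ^ 2 * T * (p.α₁ * p.η ^ 2 / K))
        + (2 * v ^ 2 / (K * p.B0) / (p.α₂ * p.η ^ 2) + 2 * v ^ 2 * T * (p.α₂ * p.η ^ 2 / K))
        + (2 * v ^ 2 / (K * p.B0) / (p.α₃ * p.η ^ 2) + 2 * v ^ 2 * T * (p.α₃ * p.η ^ 2 / K)))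
      + (3 * (16 * v ^ 2 + 2 * a) + 18 * v ^ 2 * T * ((p.α₁ * p.η ^ 2) ^ 2
        + (p.α₂ * p.η ^ 2) ^ 2 + (p.α₃ * p.η ^ 2) ^ 2)))
    ≤ (Δ + 2 * L * a + 48 * v ^ 2 + 6 * a) * rate K T p := by
  obtain ⟨hη, hα1, hα2, hα3, hβ1, hβ2, hβ3⟩ := (⟨hp.η_pos, hp.α₁_pos, hp.α₂_pos, hp.α₃_pos,
    hp.β₁_pos, hp.β₂_pos, hp.β₃_pos⟩ : _ ∧ _ ∧ _ ∧ _ ∧ _ ∧ _ ∧ _)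
  have hT0 : (0 : ℝ) < T := by positivity
  have hK0 : (0 : ℝ) < K := by positivity
  have hB0 : (0 : ℝ) < p.B0 := by exact_mod_cast hp.B0_pos
  have hη4 : ∀ α : ℝ, (α * p.η ^ 2) ^ 2 ≤ α ^ 2 * p.η ^ 3 := fun α => by
    have : p.η ^ 4 ≤ p.η ^ 3 := pow_le_pow_of_le_one hη.le hη1 (by norm_num)
    nlinarith [mul_le_mul_of_nonneg_left this (sq_nonneg α)]
  have hT1 : 1 / (T : ℝ) ≤ 1 / (p.η * T) :=
    one_div_le_one_div_of_le (by positivity) (mul_le_of_le_one_left hT0.le hη1)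
  unfold rate
  set r1 := 1 / (p.β₁ * p.η * T) with h1
  set r2 := 1 / (p.β₂ * p.η * T) with h2
  set r3 := 1 / (p.β₃ * p.η * T) with h3
  set r4 := 1 / (p.η * T) with h4
  set r5 := 1 / (p.η * T * p.B0) with h5
  set r6 := 1 / (p.α₁ * p.η ^ 2 * T * K * p.B0) with h6
  set r7 := 1 / (p.α₂ * p.η ^ 2 * T * K * p.B0) with h7
  set r8 := 1 / (p.α₃ * p.η ^ 2 * T * K * p.B0) with h8
  set r9 := p.α₁ * p.η ^ 2 / K with h9
  set r10 := p.α₂ * p.η ^ 2 / K with h10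
  set r11 := p.α₃ * p.η ^ 2 / K with h11
  set w1 := p.α₁ ^ 2 * p.η ^ 3 with hw1
  set w2 := p.α₂ ^ 2 * p.η ^ 3 with hw2
  set w3 := p.α₃ ^ 2 * p.η ^ 3 with hw3
  have e : 1 / (T : ℝ) * ((Δ / (p.η * p.β₁) + 2 * L * a / (p.η * p.β₂) + 2 * L * a / (p.η * p.β₃))
      + ((2 * v ^ 2 / (K * p.B0) / (p.α₁ * p.η ^ 2) + 2 * v ^ 2 * T * r9)
        + (2 * v ^ 2 / (K * p.B0) / (p.α₂ * p.η ^ 2) + 2 * v ^ 2 * T * r10)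
        + (2 * v ^ 2 / (K * p.B0) / (p.α₃ * p.η ^ 2) + 2 * v ^ 2 * T * r11))
      + (3 * (16 * v ^ 2 + 2 * a) + 18 * v ^ 2 * T * ((p.α₁ * p.η ^ 2) ^ 2
        + (p.α₂ * p.η ^ 2) ^ 2 + (p.α₃ * p.η ^ 2) ^ 2)))
      = Δ * r1 + 2 * L * a * r2 + 2 * L * a * r3 + 2 * v ^ 2 * (r6 + r7 + r8)
        + 2 * v ^ 2 * (r9 + r10 + r11) + 3 * (16 * v ^ 2 + 2 * a) * (1 / T)
        + 18 * v ^ 2 * ((p.α₁ * p.η ^ 2) ^ 2 + (p.α₂ * p.η ^ 2) ^ 2 + (p.α₃ * p.η ^ 2) ^ 2) := by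
    rw [h1, h2, h3, h6, h7, h8]
    field_simp
    ring
  have z1 : 0 ≤ r1 := by positivity
  have z2 : 0 ≤ r2 := by positivity
  have z3 : 0 ≤ r3 := by positivity
  have z4 : 0 ≤ r4 := by positivity
  have z5 : 0 ≤ r5 := by positivity
  have z6 : 0 ≤ r6 := by positivity
  have z7 : 0 ≤ r7 := by positivity
  have z8 : 0 ≤ r8 := by positivity
  have z9 : 0 ≤ r9 := by positivity
  have z10 : 0 ≤ r10 := by positivity
  have z11 : 0 ≤ r11 := by positivity
  have z12 : 0 ≤ w1 := by positivity
  have z13 : 0 ≤ w2 := by positivity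
  have z14 : 0 ≤ w3 := by positivity
  have c1 := mul_le_mul_of_nonneg_left (hη4 p.α₁) (by positivity : 0 ≤ 18 * v ^ 2)
  have c2 := mul_le_mul_of_nonneg_left (hη4 p.α₂) (by positivity : 0 ≤ 18 * v ^ 2)
  have c3 := mul_le_mul_of_nonneg_left (hη4 p.α₃) (by positivity : 0 ≤ 18 * v ^ 2)
  have c4 := mul_le_mul_of_nonneg_left hT1 (by positivity : 0 ≤ 3 * (16 * v ^ 2 + 2 * a))
  rw [e]
  -- every coefficient on the left is at most the common factor on the right
  have hv := sq_nonneg v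
  have hLa : 0 ≤ 2 * L * a := by positivity
  set C := Δ + 2 * L * a + 48 * v ^ 2 + 6 * a with hC
  have hC0 : 0 ≤ C := by positivity
  have d1 := mul_le_mul_of_nonneg_right (show Δ ≤ C by linarith) z1
  have d2 := mul_le_mul_of_nonneg_right (show 2 * L * a ≤ C by linarith) (add_nonneg z2 z3)
  have d3 := mul_le_mul_of_nonneg_right (show 2 * v ^ 2 ≤ C by linarith)
    (add_nonneg (add_nonneg (add_nonneg z6 z7) z8) (add_nonneg (add_nonneg z9 z10) z11))
  have d4 := mul_le_mul_of_nonneg_right (show 3 * (16 * v ^ 2 + 2 * a) ≤ C by linarith) z4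
  have d5 := mul_le_mul_of_nonneg_right (show 18 * v ^ 2 ≤ C by linarith)
    (add_nonneg (add_nonneg z12 z13) z14)
  have d6 := mul_nonneg hC0 z5
  linarith only [c1, c2, c3, c4, d1, d2, d3, d4, d5, d6]

end

end DecBilevel

theorem theorem1
    (μ lfx lfy cfy lgy lgxy lgyy cgxy : ℝ)
    (hμ : 0 < μ) (hlfx : 0 < lfx) (hlfy : 0 < lfy) (hcfy : 0 < cfy)
    (hlgy : 0 < lgy) (hlgxy : 0 < lgxy) (hlgyy : 0 < lgyy) (hcgxy : 0 < cgxy) :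
    ∃ c : ℝ, 0 < c ∧
    ∀ σ A Δ : ℝ, 0 < σ → 0 < A → 0 < Δ →
    ∃ C : ℝ, 0 < C ∧
    ∀ (K dx dy : ℕ), 1 ≤ K →
    ∀ (Sf Sg : Type*) [MeasurableSpace Sf] [MeasurableSpace Sg]
      (D : DecBilevel.Problem K dx dy Sf Sg),
      D.WellPosed →
      D.LowerStronglyConvex μ →
      D.UpperSmooth lfx lfy cfy →
      D.LowerSmooth μ lgy lgxy lgyy cgxy →
      D.BoundedVariance σ →
    ∀ (E : Matrix (Fin K) (Fin K) ℝ) (lam : ℝ), DecBilevel.IsGossip E lam →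
    ∀ (x0 : DecBilevel.Vec dx) (y0 z0 : DecBilevel.Vec dy),
      ‖z0‖ ≤ cfy / μ →
      (∀ x, D.F x0 - D.F x ≤ Δ) →
      (1 / (K : ℝ)) * ∑ k, ‖DecBilevel.grad1 (D.fFull k) x0 y0‖ ^ 2 ≤ Δ →
      (1 / (K : ℝ)) * ∑ k, ‖DecBilevel.grad2 (D.gFull k) x0 y0‖ ^ 2 ≤ Δ →
    ∀ (p : DecBilevel.Params), p.Valid → p.radius = cfy / μ →
      p.α₁ ≤ A / K → p.α₂ ≤ A / K → p.α₃ ≤ A / K →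
      DecBilevel.StepSizes c K lam p →
    ∀ (Ω : Type*) [MeasurableSpace Ω] (Pr : MeasureTheory.Measure Ω)
      [MeasureTheory.IsProbabilityMeasure Pr] (s : ℕ → Fin K → ℕ → Ω → Sf × Sg),
      DecBilevel.IsSampling D Pr s →
    ∀ T : ℕ, 1 ≤ T →
      let xbar : ℕ → Ω → DecBilevel.Vec dx := fun t ω =>
        DecBilevel.mean (DecBilevel.run D E p x0 y0 z0 (fun t k b => s t k b ω) t).X
      Differentiable ℝ D.F ∧
      (∀ t, MeasureTheory.Integrable (fun ω => ‖gradient D.F (xbar t ω)‖ ^ 2) Pr) ∧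
      (1 / (T : ℝ)) * ∑ t ∈ Finset.range T, ∫ ω, ‖gradient D.F (xbar t ω)‖ ^ 2 ∂Pr
        ≤ C * DecBilevel.rate K T p := by

  have hr : 0 ≤ cfy / μ := by positivity
  set L := DecBilevel.lipConst μ lfx lfy cfy lgy lgxy lgyy cgxy with hLdef
  have hL : 1 ≤ L := by
    rw [hLdef, DecBilevel.lipConst, add_assoc, add_assoc, add_assoc, add_assoc, add_assoc]
    exact le_add_of_nonneg_right (by positivity)
  have hL0 : 0 < L := by linarith
  refine ⟨1 / (2000 * L ^ 10), by positivity, fun σ A Δ hσ hA hΔ => ?_⟩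
  set v := √(2 * σ ^ 2 + 8 * (cgxy * (cfy / μ)) ^ 2 + 8 * (lgy * (cfy / μ)) ^ 2) with hv
  set a := DecBilevel.startConst μ cfy lgy cgxy Δ with ha
  have ha0 : 0 ≤ a := by rw [ha, DecBilevel.startConst]; positivity
  refine ⟨1400 * L ^ 8 * (Δ + 2 * L * a + 48 * v ^ 2 + 6 * a), by positivity, ?_⟩
  intro K dx dy hK Sf Sg _ _ D hwell hstrong hupper hlower hvar E lam hE x0 y0 z0 hz hF0 hf0 hg0
    p hp hrad _ _ _ hst Ω _ Pr _ s hs T hT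
  have hreg : D.Regular μ lfx lfy cfy lgy lgxy lgyy cgxy σ := by
    constructor <;> assumption
  have hm : D.Model L p.radius v := by
    rw [hrad]
    exact hreg.model hK (Real.sq_sqrt (by positivity)).ge
  have hz' : ‖z0‖ ≤ p.radius := by rwa [hrad]
  have hl0 := hE.lam_nonneg hK
  have hl1 := hE.gap
  set c : ℝ := 1 / (2000 * L ^ 10) with hc
  have hc0 : 0 < c := by positivity
  have hcL : c * L ^ 10 = 1 / 2000 := by rw [hc]; field_simp
  have hcj : ∀ j ≤ 10, c * L ^ j ≤ 1 / 2000 := fun j hj => by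
    rw [← hcL]
    exact mul_le_mul_of_nonneg_left (pow_le_pow_right₀ hL hj) hc0.le
  have hc1 : c ≤ 1 := by linarith [hcj 0 (by norm_num), pow_zero L]
  obtain ⟨-, -, -, -, -, -, -, -, -, hb1, hb2, hb3⟩ := hst.exists_scale hp hK hc0 hc1 hl0 hl1
  have hβ₁ : 4 * L * p.β₁ ≤ 1 := by
    have := mul_le_mul_of_nonneg_left hb1 (by positivity : 0 ≤ 4 * L)
    linarith [hcj 1 (by norm_num)]
  have hβ₂ : 4 * L ^ 3 * p.β₂ ≤ 1 := by
    have := mul_le_mul_of_nonneg_left hb2 (by positivity : 0 ≤ 4 * L ^ 3)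
    linarith [hcj 3 (by norm_num)]
  have hβ₃ : 9 * L ^ 3 * p.β₃ ≤ 1 - lam := by
    have h1 := mul_le_mul_of_nonneg_left hb3 (by positivity : 0 ≤ 9 * L ^ 3)
    have h2 : (1 - lam) ^ 3 ≤ (1 - lam) ^ 1 :=
      pow_le_pow_of_le_one (by linarith) (by linarith) (by norm_num)
    have h3 := mul_le_mul_of_nonneg_right (hcj 3 (by norm_num))
      (pow_nonneg (by linarith : 0 ≤ 1 - lam) 3)
    linarith
  have hgrad : gradient D.F = D.hyperGrad := funext fun x => (hm.land.hasGradientAt x).gradient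
  have hreg_run := fun t => DecBilevel.stateReg_run hm hs hp hE hst.η_le (x0 := x0) (y0 := y0) hz' t
  intro xbar
  refine ⟨fun x => (hm.land.hasGradientAt x).differentiableAt, fun t => ?_, ?_⟩
  · rw [hgrad]
    exact DecBilevel.integrable_hyperGrad_sq hm hK (hreg_run t)
  · obtain ⟨s1, s2, s3, s4, s5⟩ := hreg.start_bounds hK hz hΔ.le hf0 hg0
    have hsum := DecBilevel.sum_hyperGrad_le hL hc hK hp hst hl0 hl1 ha0 hΔ.le
      (m := fun t => DecBilevel.moments Pr D
        (fun ω => DecBilevel.run D E p x0 y0 z0 (fun t k b => s t k b ω) t))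
      (fun t => DecBilevel.moments_nonneg)
      (fun t => DecBilevel.moments_step hm hs hp hE hK hst.η_le (B := p.batch (t + 1))
        (by simpa [DecBilevel.Params.batch] using hp.B1_pos) (fun ω => rfl) (hreg_run t) hβ₂ hβ₃)
      (DecBilevel.moments_start hm hs hp hK hz' s1 s2 s3 s4 s5) T
      (DecBilevel.integral_descent hm hs hp hE hK hst.η_le hz' hβ₁ hF0 T fun t => rfl)
    have hrate := DecBilevel.bound_le_rate hp hst.η_le hK hT hL0.le ha0 hΔ.le (v := v)
    rw [hgrad]
    refine (mul_le_mul_of_nonneg_left hsum (by positivity)).trans ?_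
    rw [mul_left_comm, mul_assoc (1400 * L ^ 8)]
    exact mul_le_mul_of_nonneg_left hrate (by positivity)
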